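/- Let $n\ge 2$, let $\Omega\subset\mathbb R^n$ be open, and let $F\in\mathcal{DM}^{ext}(\Omega)$, i.e. $F$ is a finite $\mathbb R^n$-valued Radon measure on $\Omega$ with $$|\mathrm{div}\,F|(\Omega):=\sup\Big\{\int_\Omega\nabla\varphi\cdot dF:\ \varphi\in C^1_c(\Omega),\ |\varphi|\le 1\Big\}<\infty .$$ Let $\mathrm{div}\,F$ denote the finite signed measure on $\Omega$ with $\int_\Omega\varphi\,d(\mathrm{div}\,F)=-\int_\Omega\nabla\varphi\cdot dF$ for all $\varphi\in C^1_c(\Omega)$. For $\phi\in W^{1,\infty}(\Omega)$ (always taken as its continuous representative), and likewise for the Lipschitz function $\phi=d$ introduced below, let $\overline{\nabla\phi\cdot F}$ denote the finite signed measure on $\Omega$ characterized by $$\int_\Omega\psi\,d\overline{\nabla\phi\cdot F}=\lim_{\delta\to0^+}\int_\Omega\psi\,\nabla(\phi*\rho_\delta)\cdot dF\qquad\text{for all }\psi\in C_c(\Omega),$$ for every standard mollifier $\rho$. For a Borel set $E$ with $\overline E\subset\Omega$ compact, the normal trace of $F$ on $\partial E$ is $$\langle F\cdot\nu,\phi\rangle_{\partial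 E}:=-\int_E\phi\,d(\mathrm{div}\,F)-\overline{\nabla\phi\cdot F}(E),\qquad \phi\in W^{1,\infty}(\Omega),$$ which for $\phi\in C^1_c(\Omega)$ equals $-\int_E\nabla\phi\cdot dF-\int_E\phi\,d(\mathrm{div}\,F)$; if this distribution on $\Omega$ is a finite signed measure, that measure is denoted $(F\cdot\nu)_{\partial E}$. Let $U$ be open with $\overline U\subset\Omega$ compact, $d(x)=\mathrm{dist}(x,\partial U)$ and $U^t=\{x\in U: d(x)>t\}$. Then the measures $\mathrm{div}\,F$, $\overline{\nabla d\cdot F}$ and $\overline{\nabla\phi\cdot F}$ ($\phi\in W^{1,\infty}(\Omega)$) exist, and the following hold. 1. For every $\phi\in W^{1,\infty}(\Omega)$ the function $t\mapsto\langle F\cdot\nu,\phi\rangle_{\partial U^t}$ is integrable on $(0,\infty)$ and $$\int_0^\infty\langle F\cdot\nu,\phi\rangle_{\partial U^t}\,dt=\int_U\phi\,d\overline{\nabla d\cdot F}.$$ 2. This extends to bounded Borel functions: for $\mathcal L^1$-a.e. $t>0$ the normal trace on $\partial U^t$ is a finite signed measure $(F\cdot\nu)_{\partial U^t}$ concentrated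 on $\partial U^t$, with $\langle F\cdot\nu,\phi\rangle_{\partial U^t}=\int\phi\,d(F\cdot\nu)_{\partial U^t}$ for all $\phi\in W^{1,\infty}(\Omega)$; and for every bounded Borel function $\phi$ on $\Omega$ the function $t\mapsto\int_{\partial U^t}\phi\,d(F\cdot\nu)_{\partial U^t}$ is integrable on $(0,\infty)$ and $$\int_0^\infty\int_{\partial U^t}\phi\,d(F\cdot\nu)_{\partial U^t}\,dt=\int_U\phi\,d\overline{\nabla d\cdot F}.$$ 3. Equivalently, the disintegration of $\overline{\nabla d\cdot F}$ on $U$ along the level sets of $d$ has no singular part in $t$: there exist a finite measure $\tau$ on $(0,\infty)$ and a $\tau$-measurable family of signed measures $\mu_t$ such that, for $\tau$-a.e. $t$, $\mu_t$ is concentrated on $U\cap d^{-1}(t)$ with $|\mu_t|(U\cap d^{-1}(t))=1$, and $\int_U\phi\,d\overline{\nabla d\cdot F}=\int_0^\infty\int\phi\,d\mu_t\,d\tau(t)$ for all bounded Borel $\phi$ on $U$; and for every such pair $(\tau,\mu_t)$ the singular part of $\tau$ with respect to $\mathcal L^1$ vanishes. -/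

import Mathlib

open MeasureTheory Filter Topology Set
open scoped ENNReal ContDiff Gradient

noncomputable section

namespace DMField

/-- Euclidean space `ℝⁿ` (with its Euclidean norm and Borel σ-algebra). -/
abbrev Euc (n : ℕ) : Type := EuclideanSpace ℝ (Fin n)

variable {n : ℕ}

/-- `φ ∈ C¹_c(Ω)`. -/
structure IsTestC1 (Ω : Set (Euc n)) (φ : Euc n → ℝ) : Prop where
  contDiff : ContDiff ℝ 1 φ
  hasCompactSupport : HasCompactSupport φ
  tsupport_subset : tsupport φ ⊆ Ω

/-- A finite (signed or vector valued) Borel measure on `Ω`, seen as a measure on `ℝⁿ` that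
vanishes outside `Ω`. Finite Borel measures on `ℝⁿ` are automatically Radon, and a countably
additive finite dimensional set function has finite total variation. -/
def IsMeasureOn {V : Type*} [AddCommMonoid V] [TopologicalSpace V] (Ω : Set (Euc n))
    (μ : VectorMeasure (Euc n) V) : Prop :=
  ∀ A : Set (Euc n), MeasurableSet A → Disjoint A Ω → μ A = 0

/-- The Euclidean inner product as a continuous bilinear map, used to integrate a vector field
`G` against a vector measure `F`: `∫ G · dF` is `∫ᵛ x, G x ∂[dot n; F]`. -/
def dot (n : ℕ) : Euc n →L[ℝ] Euc n →L[ℝ] ℝ := innerSL ℝ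

theorem dot_apply (x y : Euc n) : dot n x y = inner ℝ x y := rfl

/-- `|div F|(Ω) = sup { ∫_Ω ∇φ · dF : φ ∈ C¹_c(Ω), |φ| ≤ 1 }` (the competitor `φ = 0` gives
the value `0`, so truncating the values at `0` does not change the supremum). -/
def divVariation (Ω : Set (Euc n)) (F : VectorMeasure (Euc n) (Euc n)) : ℝ≥0∞ :=
  ⨆ (φ : Euc n → ℝ) (_ : IsTestC1 Ω φ ∧ ∀ x, |φ x| ≤ 1),
    ENNReal.ofReal (∫ᵛ x, ∇ φ x ∂[dot n; F])

/-- `F ∈ DM^ext(Ω)`: `F` is a finite `ℝⁿ`-valued measure on `Ω` with `|div F|(Ω) < ∞`. -/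
structure IsDMExt (Ω : Set (Euc n)) (F : VectorMeasure (Euc n) (Euc n)) : Prop where
  isMeasureOn : IsMeasureOn Ω F
  divVariation_lt_top : divVariation Ω F < ⊤

/-- The signed measure `σ` on `Ω` is the distributional divergence of `F` in `Ω`. -/
structure IsDivergence (Ω : Set (Euc n)) (F : VectorMeasure (Euc n) (Euc n))
    (σ : SignedMeasure (Euc n)) : Prop where
  isMeasureOn : IsMeasureOn Ω σ
  integral_eq : ∀ φ : Euc n → ℝ, IsTestC1 Ω φ →
    ∫ᵛ x, φ x ∂•σ = - ∫ᵛ x, ∇ φ x ∂[dot n; F]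

open Classical in
/-- The measure `div F` on `Ω` (it is unique if it exists; `0` if it does not exist). -/
def divMeasure (Ω : Set (Euc n)) (F : VectorMeasure (Euc n) (Euc n)) : SignedMeasure (Euc n) :=
  if h : ∃ σ, IsDivergence Ω F σ then h.choose else 0

/-- `φ ∈ W^{1,∞}(Ω)`: `φ` is essentially bounded on `Ω` and has an essentially bounded weak
gradient there. Every class in `W^{1,∞}(Ω)` has exactly one representative that is continuous
on `Ω`, and `φ` is required to be this representative, so that it can be integrated against
measures that charge Lebesgue null sets. Values of `φ` outside `Ω` play no role. -/
structure MemW1Infty (Ω : Set (Euc n)) (φ : Euc n → ℝ) : Prop where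
  continuousOn : ContinuousOn φ Ω
  memLp : MemLp φ ⊤ (volume.restrict Ω)
  exists_weakGradient : ∃ G : Euc n → Euc n, MemLp G ⊤ (volume.restrict Ω) ∧
    ∀ ψ : Euc n → ℝ, ContDiff ℝ ∞ ψ → HasCompactSupport ψ → tsupport ψ ⊆ Ω →
      ∫ x in Ω, φ x • ∇ ψ x = - ∫ x in Ω, ψ x • G x

/-- A standard mollifier. -/
structure IsStandardMollifier (ρ : Euc n → ℝ) : Prop where
  nonneg : ∀ x, 0 ≤ ρ x
  contDiff : ContDiff ℝ ∞ ρ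
  tsupport_subset : tsupport ρ ⊆ Metric.closedBall 0 1
  integral_eq_one : ∫ x, ρ x = 1

/-- The mollification `φ_δ(x) = ∫_Ω δ⁻ⁿ ρ((x - y)/δ) φ(y) dy`; at a point `x ∈ Ω` whose distance
to the complement of `Ω` exceeds `δ` this is the usual `(φ * ρ_δ)(x)`. -/
def mollify (Ω : Set (Euc n)) (ρ : Euc n → ℝ) (δ : ℝ) (φ : Euc n → ℝ) (x : Euc n) : ℝ :=
  ∫ y in Ω, (δ ^ n)⁻¹ * ρ (δ⁻¹ • (x - y)) * φ y

/-- The signed measure `m` on `Ω` is the pairing of `∇φ` and `F`: for every `ψ ∈ C_c(Ω)`,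
`∫ ψ dm = lim_{δ → 0+} ∫ ψ ∇φ_δ · dF` (for every choice of the standard mollifier). -/
structure IsPairing (Ω : Set (Euc n)) (F : VectorMeasure (Euc n) (Euc n)) (φ : Euc n → ℝ)
    (m : SignedMeasure (Euc n)) : Prop where
  isMeasureOn : IsMeasureOn Ω m
  tendsto : ∀ ρ : Euc n → ℝ, IsStandardMollifier ρ →
    ∀ ψ : Euc n → ℝ, Continuous ψ → HasCompactSupport ψ → tsupport ψ ⊆ Ω →
      Tendsto (fun δ : ℝ => ∫ᵛ x, ψ x • ∇ (mollify Ω ρ δ φ) x ∂[dot n; F]) (𝓝[>] 0)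
        (𝓝 (∫ᵛ x, ψ x ∂•m))

open Classical in
/-- The pairing measure `\overline{∇φ · F}` on `Ω` (unique if it exists; `0` if it does not
exist). -/
def pairing (Ω : Set (Euc n)) (F : VectorMeasure (Euc n) (Euc n)) (φ : Euc n → ℝ) :
    SignedMeasure (Euc n) :=
  if h : ∃ m, IsPairing Ω F φ m then h.choose else 0

/-- The normal trace on `∂E`, tested against `φ ∈ W^{1,∞}(Ω)`:
`⟨F·ν, φ⟩_{∂E} = - ∫_E φ d(div F) - \overline{∇φ · F}(E)`. -/
def normalTrace (Ω : Set (Euc n)) (F : VectorMeasure (Euc n) (Euc n)) (E : Set (Euc n))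
    (φ : Euc n → ℝ) : ℝ :=
  - (∫ᵛ x in E, φ x ∂•(divMeasure Ω F)) - pairing Ω F φ E

/-- The signed measure `ν` on `Ω` represents the normal trace distribution
`φ ↦ - ∫_E ∇φ · dF - ∫_E φ d(div F)`, `φ ∈ C¹_c(Ω)`; that is, `ν = (F·ν)_{∂E}`. -/
structure IsNormalTraceMeasure (Ω : Set (Euc n)) (F : VectorMeasure (Euc n) (Euc n))
    (E : Set (Euc n)) (ν : SignedMeasure (Euc n)) : Prop where
  isMeasureOn : IsMeasureOn Ω ν
  integral_eq : ∀ φ : Euc n → ℝ, IsTestC1 Ω φ →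
    ∫ᵛ x, φ x ∂•ν =
      - (∫ᵛ x in E, ∇ φ x ∂[dot n; F]) - ∫ᵛ x in E, φ x ∂•(divMeasure Ω F)

/-- `d(x) = dist(x, ∂U)`. -/
def bdryDist (U : Set (Euc n)) (x : Euc n) : ℝ := Metric.infDist x (frontier U)

/-- `U^t = {x ∈ U : dist(x, ∂U) > t}`. -/
def innerSet (U : Set (Euc n)) (t : ℝ) : Set (Euc n) := {x | x ∈ U ∧ t < bdryDist U x}

/-- `(τ, κ)` is a disintegration of the restriction of `m` to `U` along the level sets of
`d = dist(·, ∂U)`: `τ` is a finite measure on `(0, ∞)`, the map `t ↦ κ_t` is `τ`-measurable, for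
`τ`-a.e. `t` the signed measure `κ_t` lives on `U ∩ d⁻¹(t)` and has total variation `1`, and
`∫_U φ dm = ∫_0^∞ ∫ φ dκ_t dτ(t)` for bounded Borel `φ`. -/
structure IsDisintegration (U : Set (Euc n)) (m : SignedMeasure (Euc n)) (τ : Measure ℝ)
    (κ : ℝ → SignedMeasure (Euc n)) : Prop where
  isFiniteMeasure : IsFiniteMeasure τ
  measure_Iic_zero : τ (Iic 0) = 0
  aemeasurable : ∀ A : Set (Euc n), MeasurableSet A → AEMeasurable (fun t => κ t A) τ
  fiber : ∀ᵐ t ∂τ, (κ t).variation {x | ¬ (x ∈ U ∧ bdryDist U x = t)} = 0 ∧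
    (κ t).variation {x | x ∈ U ∧ bdryDist U x = t} = 1
  integral_eq : ∀ φ : Euc n → ℝ, Measurable φ → (∃ C : ℝ, ∀ x, |φ x| ≤ C) →
    ∫ᵛ x in U, φ x ∂•m = ∫ t, (∫ᵛ x, φ x ∂•(κ t)) ∂τ

end DMField

end

open DMField

noncomputable section

namespace DMField

open scoped NNReal

variable {n : ℕ}

/-! ### Vector measures as bounded densities against a finite positive measure -/

section Density

variable {X E F G : Type*} {mX : MeasurableSpace X}
  [NormedAddCommGroup E] [NormedSpace ℝ E] [NormedAddCommGroup F] [NormedSpace ℝ F]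
  [NormedAddCommGroup G] [NormedSpace ℝ G] {lam : Measure X}

/-! Everything is reduced to scalar functions. The functional φ ↦ ∫ ∇φ · dF is bounded in the sup
norm, so Hahn–Banach and Riesz give the measure div F. With λ = |F| + |div F| one has F = f λ and
div F = s λ, where |f|, |s| ≤ 1 everywhere.

If C¹ functions g_δ tend to φ locally uniformly in Ω with gradients bounded by C, the Leibniz rule
shows that ∫ ψ ∇g_δ · f dλ tends to -∫ φ ∇ψ · f dλ - ∫ φ ψ s dλ for every test function ψ. This
limit does not depend on the family g_δ, and it is at most C ∫ |ψ| dλ. So it has the form ∫ ψ p dλ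
with |p| ≤ C, and p λ is the pairing measure of φ. Write q for the density obtained from φ = d. By
density in L¹(λ), the convergence persists for merely integrable ψ vanishing off a compact subset of
Ω, in particular for indicators.

The heart is a chain rule. Let η be continuous with compact support in (0,∞), and let H be its
primitive vanishing at 0. Testing the pairing of φ with H(d), cut off inside U and approximated by
H(g_δ) with g_δ → d, gives ∫_U H(d) p dλ = -∫_U φ η(d) q dλ - ∫_U H(d) φ s dλ. Since H(d(x)) is the
integral of η over (0, d(x)), Fubini turns this into ∫ η(t) T(t) dt = ∫_U η(d) φ q dλ, where T(t) =
-∫_{U^t} (φ s + p) dλ is the normal trace on ∂U^t tested with φ. Hence T(t) dt is the image under d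
of φ q λ restricted to U, which is the coarea formula on every Borel set of levels
(`IsDivData.coarea`).

On a Lebesgue null set S of levels the left side vanishes for every test function φ, so q = 0 λ-a.e.
on U ∩ d⁻¹(S) (`IsDivData.ae_eq_zero_of_volume_eq_zero`). Therefore the image τ of |q| λ|_U under d
is absolutely continuous. Conditional distributions given d, multiplied by the sign of q, give the
disintegration κ_t, and N_t = (dτ/dt) κ_t is the candidate trace measure. For each test function,
N_t and the normal trace have equal integrals over all Borel sets of levels, so they agree for a.e.
t. Separability of C¹ on the closure of U makes the exceptional null set independent of the test
function, and mollification passes to W^{1,∞}. In any other disintegration, the fibres over S must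
vanish, which contradicts their unit variation unless S is null for its base measure. -/

theorem ae_norm_le_one_of_variation_le [CompleteSpace E] [SigmaFinite lam] {f : X → E}
    (hf : Integrable f lam) (h : (lam.withDensityᵥ f).variation ≤ lam) : ∀ᵐ x ∂lam, ‖f x‖ ≤ 1 := by
  rw [Measure.variation_withDensityᵥ hf] at h
  have h1 : (fun x => ‖f x‖ₑ) ≤ᵐ[lam] fun _ => 1 := by
    refine ae_le_of_forall_setLIntegral_le_of_sigmaFinite₀ hf.1.enorm fun s hs _ => ?_
    have := Measure.le_iff.1 h s hs
    rw [withDensity_apply _ hs] at this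
    simpa using this
  filter_upwards [h1] with x hx
  have : ‖f x‖ₑ ≤ ‖(1 : ℝ)‖ₑ := by simpa using hx
  simpa using enorm_le_iff_norm_le.1 this

theorem variation_withDensityᵥ_le [CompleteSpace E] {f : X → E} (hf : Integrable f lam) {D : ℝ≥0}
    (h1 : ∀ x, ‖f x‖ ≤ D) : (lam.withDensityᵥ f).variation ≤ D • lam := by
  rw [Measure.variation_withDensityᵥ hf]
  have : (D • lam : Measure X) = lam.withDensity fun _ => (D : ℝ≥0∞) := by
    rw [withDensity_const]; rfl
  rw [this]
  refine withDensity_mono (.of_forall fun x => ?_)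
  exact enorm_le_coe.2 (h1 x)

/-- As functions of g in L¹(lam), both sides are linear and Lipschitz with constant ‖B‖ D, because
the variation is at most D • lam; they agree on indicators, hence on L¹. -/
theorem integral_withDensityᵥ [CompleteSpace F] [CompleteSpace G] [IsFiniteMeasure lam] {f : X → F}
    (hfm : AEStronglyMeasurable f lam) {D : ℝ≥0} (h1 : ∀ x, ‖f x‖ ≤ D)
    (B : E →L[ℝ] F →L[ℝ] G) {g : X → E} (hg : Integrable g lam) :
    ∫ᵛ x, g x ∂[B; lam.withDensityᵥ f] = ∫ x, B (g x) (f x) ∂lam := by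
  have hf : Integrable f lam := .of_bound hfm D (.of_forall h1)
  have hv := variation_withDensityᵥ_le hf h1
  have : IsFiniteMeasure (lam.withDensityᵥ f).variation := isFiniteMeasure_of_le _ hv
  have hle : ∀ (g : X → E) x, ‖B (g x) (f x)‖ ≤ ‖B‖ * D * ‖g x‖ := fun g x => by
    refine (B.le_opNorm₂ _ _).trans ?_
    rw [mul_right_comm]
    exact mul_le_mul_of_nonneg_right (mul_le_mul_of_nonneg_left (h1 x) (norm_nonneg B))
      (norm_nonneg _)
  have hint : ∀ {g : X → E}, Integrable g lam → Integrable (fun x => B (g x) (f x)) lam :=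
    fun hg => Integrable.mono' (hg.norm.const_mul (‖B‖ * D))
      (B.aestronglyMeasurable_comp₂ hg.1 hfm) (.of_forall (hle _))
  have hmono : ∀ {g : X → E}, Integrable g lam → (lam.withDensityᵥ f).Integrable g :=
    fun hg => hg.smul_measure_nnreal.mono_measure hv
  have hB : ∀ g : X → E, Integrable g lam → ‖∫ᵛ x, g x ∂[B; lam.withDensityᵥ f]‖ ≤
      ‖B‖ * D * ∫ x, ‖g x‖ ∂lam := fun g hg => by
    refine VectorMeasure.norm_integral_le_integral_norm.trans ?_
    rw [mul_assoc]
    refine mul_le_mul_of_nonneg_left ((integral_mono_measure hv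
      (.of_forall fun _ => norm_nonneg _) hg.norm.smul_measure_nnreal).trans ?_) (norm_nonneg B)
    rw [integral_smul_nnreal_measure]
    rfl
  have hB' : ∀ g : X → E, Integrable g lam → ‖∫ x, B (g x) (f x) ∂lam‖ ≤
      ‖B‖ * D * ∫ x, ‖g x‖ ∂lam := fun g hg => by
    rw [← integral_const_mul]
    exact norm_integral_le_of_norm_le (hg.norm.const_mul _) (.of_forall (hle _))
  refine Integrable.induction (fun g : X → E => ∫ᵛ x, g x ∂[B; lam.withDensityᵥ f] =
    ∫ x, B (g x) (f x) ∂lam) ?_ ?_ ?_ ?_ hg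
  · intro c s hs _
    rw [VectorMeasure.integral_indicator_const _ hs, withDensityᵥ_apply hf hs]
    rw [← ContinuousLinearMap.integral_comp_comm _ hf.integrableOn, ← integral_indicator hs]
    congr with x
    by_cases hx : x ∈ s <;> simp [hx]
  · intro f₁ f₂ _ hf₁ hf₂ ih₁ ih₂
    simp only [Pi.add_apply, map_add, add_apply]
    rw [VectorMeasure.integral_fun_add (hmono hf₁) (hmono hf₂),
      integral_add (hint hf₁) (hint hf₂), ih₁, ih₂]
  · refine isClosed_eq (LipschitzWith.of_dist_le_mul (K := ‖B‖₊ * D) fun g₁ g₂ => ?_).continuous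
      (LipschitzWith.of_dist_le_mul (K := ‖B‖₊ * D) fun g₁ g₂ => ?_).continuous
    · have i₁ := L1.integrable_coeFn g₁
      have i₂ := L1.integrable_coeFn g₂
      rw [dist_eq_norm, ← VectorMeasure.integral_fun_sub (hmono i₁) (hmono i₂),
        L1.dist_eq_integral_dist]
      simp only [dist_eq_norm]
      exact hB _ (i₁.sub i₂)
    · have i₁ := L1.integrable_coeFn g₁
      have i₂ := L1.integrable_coeFn g₂
      rw [dist_eq_norm, ← integral_sub (hint i₁) (hint i₂), L1.dist_eq_integral_dist]
      simp only [dist_eq_norm, ← sub_apply, ← map_sub]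
      exact hB' _ (i₁.sub i₂)
  · intro g₁ g₂ hfg _ ih
    rw [← VectorMeasure.integral_congr_ae ((hv.absolutelyContinuous.trans
      Measure.smul_absolutelyContinuous).ae_le hfg), ih]
    refine integral_congr_ae ?_
    filter_upwards [hfg] with x hx
    rw [hx]

theorem setIntegral_withDensityᵥ [CompleteSpace F] [CompleteSpace G] [IsFiniteMeasure lam]
    {f : X → F} (hfm : AEStronglyMeasurable f lam) {D : ℝ≥0} (h1 : ∀ x, ‖f x‖ ≤ D)
    (B : E →L[ℝ] F →L[ℝ] G) {g : X → E} {A : Set X} (hA : MeasurableSet A) (hg : IntegrableOn g A lam) :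
    ∫ᵛ x in A, g x ∂[B; lam.withDensityᵥ f] = ∫ x in A, B (g x) (f x) ∂lam := by
  rw [← VectorMeasure.integral_indicator hA, integral_withDensityᵥ hfm h1 B
    (hg.integrable_indicator hA), ← integral_indicator hA]
  congr with x
  by_cases hx : x ∈ A <;> simp [hx]

/-- The variation bound forces ‖f‖ ≤ 1 only almost everywhere. Truncating f to 0 elsewhere makes the
bound hold at every point, so that later estimates need no null sets. -/
theorem exists_measurable_density [CompleteSpace E] [MeasurableSpace E] [BorelSpace E]
    [IsFiniteMeasure lam] {v : VectorMeasure X E} (hv : v.variation ≤ lam) {f : X → E}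
    (hf : Integrable f lam) (hfm : Measurable f) (h : v = lam.withDensityᵥ f) :
    ∃ g : X → E, Measurable g ∧ (∀ x, ‖g x‖ ≤ 1) ∧ v = lam.withDensityᵥ g := by
  have h1 := ae_norm_le_one_of_variation_le hf (h ▸ hv)
  refine ⟨{x | ‖f x‖ ≤ 1}.indicator f, hfm.indicator (measurableSet_le hfm.norm measurable_const),
    fun x => ?_, ?_⟩
  · by_cases hx : ‖f x‖ ≤ 1
    · simp [indicator, hx]
    · simp [indicator, hx]
  · rw [h]
    refine WithDensityᵥEq.congr_ae ?_
    filter_upwards [h1] with x hx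
    simp [indicator, hx]

theorem signedMeasure_eq_withDensityᵥ [IsFiniteMeasure lam] {v : SignedMeasure X}
    (hv : v.variation ≤ lam) : lam.withDensityᵥ (v.rnDeriv lam) = v := by
  refine SignedMeasure.withDensityᵥ_rnDeriv_eq v lam (VectorMeasure.AbsolutelyContinuous.mk
    fun A hA h0 => ?_)
  rw [Measure.toENNRealVectorMeasure_apply_measurable hA] at h0
  have := (VectorMeasure.enorm_measure_le_variation v A).trans (hv A)
  rw [h0] at this
  simpa using this

theorem exists_density_signedMeasure [IsFiniteMeasure lam] {v : SignedMeasure X}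
    (hv : v.variation ≤ lam) :
    ∃ g : X → ℝ, Measurable g ∧ (∀ x, ‖g x‖ ≤ 1) ∧ v = lam.withDensityᵥ g :=
  exists_measurable_density hv (SignedMeasure.integrable_rnDeriv _ _)
    (SignedMeasure.measurable_rnDeriv _ _) (signedMeasure_eq_withDensityᵥ hv).symm

instance isFiniteMeasure_variation (v : SignedMeasure X) : IsFiniteMeasure v.variation := by
  rw [← SignedMeasure.totalVariation_eq_variation]; infer_instance

end Density

/-! ### Densities of ℝⁿ-valued measures, componentwise -/

section Euc

variable {X : Type*} {mX : MeasurableSpace X} {lam : Measure X}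

/-- The `i`-th component of a vector measure. -/
def component (v : VectorMeasure X (Euc n)) (i : Fin n) : SignedMeasure X :=
  v.mapRange (EuclideanSpace.proj i : Euc n →L[ℝ] ℝ).toLinearMap.toAddMonoidHom
    (EuclideanSpace.proj i : Euc n →L[ℝ] ℝ).continuous

theorem component_apply (v : VectorMeasure X (Euc n)) (i : Fin n) (A : Set X) :
    component v i A = v A i := rfl

theorem variation_component_le (v : VectorMeasure X (Euc n)) (i : Fin n) :
    (component v i).variation ≤ v.variation := by
  refine VectorMeasure.variation_le_of_forall_enorm_le fun A _ => ?_
  refine le_trans ?_ (VectorMeasure.enorm_measure_le_variation v A)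
  rw [component_apply, enorm_le_iff_norm_le]
  exact PiLp.norm_apply_le (v A) i

/-- The variation is dominated by the sum of the variations of the components, each of which is a
finite signed measure. -/
instance isFiniteMeasure_variation_euc (v : VectorMeasure X (Euc n)) :
    IsFiniteMeasure v.variation := by
  refine isFiniteMeasure_of_le (∑ i, (component v i).variation)
    (VectorMeasure.variation_le_of_forall_enorm_le fun A hA => ?_)
  rw [Measure.finsetSum_apply]
  calc ‖v A‖ₑ ≤ ∑ i, ‖v A i‖ₑ := by
        conv_lhs => rw [← (EuclideanSpace.basisFun (Fin n) ℝ).sum_repr (v A)]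
        refine (enorm_sum_le _ _).trans (Finset.sum_le_sum fun i _ => ?_)
        simp [← ofReal_norm, norm_smul]
    _ ≤ _ := Finset.sum_le_sum fun i _ =>
        VectorMeasure.enorm_measure_le_variation (component v i) A

theorem exists_density_euc [IsFiniteMeasure lam] {v : VectorMeasure X (Euc n)}
    (hv : v.variation ≤ lam) :
    ∃ g : X → Euc n, Measurable g ∧ (∀ x, ‖g x‖ ≤ 1) ∧ v = lam.withDensityᵥ g := by
  have hi := fun i => (variation_component_le v i).trans hv
  set f : X → Euc n := fun x => WithLp.toLp 2 fun i => (component v i).rnDeriv lam x with hfdef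
  have hfm : Measurable f := by
    refine (WithLp.measurable_toLp 2 _).comp (measurable_pi_lambda _ fun i => ?_)
    exact SignedMeasure.measurable_rnDeriv _ _
  have hf : Integrable f lam := by
    rw [← integrable_norm_iff hfm.aestronglyMeasurable]
    refine Integrable.mono' (integrable_finsetSum Finset.univ fun i _ =>
      (SignedMeasure.integrable_rnDeriv (component v i) lam).norm)
      hfm.norm.aestronglyMeasurable (.of_forall fun x => ?_)
    rw [norm_norm]
    conv_lhs => rw [← (EuclideanSpace.basisFun (Fin n) ℝ).sum_repr (f x)]
    refine (norm_sum_le _ _).trans (Finset.sum_le_sum fun i _ => ?_)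
    simp [norm_smul, f]
  refine exists_measurable_density hv hf hfm ?_
  ext A hA i
  rw [withDensityᵥ_apply hf hA, ← component_apply]
  conv_lhs => rw [← signedMeasure_eq_withDensityᵥ (hi i)]
  rw [withDensityᵥ_apply (SignedMeasure.integrable_rnDeriv _ _) hA]
  exact ((EuclideanSpace.proj i : Euc n →L[ℝ] ℝ).integral_comp_comm hf.integrableOn)

end Euc

end DMField

/-! ### Hahn–Banach and Riesz representation on C¹_c(Ω); existence of the divergence -/

namespace DMField

variable {n : ℕ} {Ω : Set (Euc n)}

open CompactlySupported CompactlySupportedContinuousMap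

namespace IsTestC1

theorem zero : IsTestC1 Ω (0 : Euc n → ℝ) :=
  ⟨contDiff_const, HasCompactSupport.zero, by simp [tsupport]⟩

theorem add {φ ψ : Euc n → ℝ} (hφ : IsTestC1 Ω φ) (hψ : IsTestC1 Ω ψ) : IsTestC1 Ω (φ + ψ) :=
  ⟨hφ.contDiff.add hψ.contDiff, hφ.hasCompactSupport.add hψ.hasCompactSupport,
    (tsupport_add _ _).trans (union_subset hφ.tsupport_subset hψ.tsupport_subset)⟩

theorem smul {φ : Euc n → ℝ} (hφ : IsTestC1 Ω φ) (c : ℝ) : IsTestC1 Ω (c • φ) :=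
  ⟨hφ.contDiff.const_smul c, hφ.hasCompactSupport.smul_left (f := fun _ => c),
    (closure_mono (Function.support_const_smul_subset c φ)).trans hφ.tsupport_subset⟩

/-- A test function as a compactly supported continuous map. -/
def toCc {φ : Euc n → ℝ} (hφ : IsTestC1 Ω φ) : C_c(Euc n, ℝ) :=
  ⟨⟨φ, hφ.contDiff.continuous⟩, hφ.hasCompactSupport⟩

theorem coe_toCc {φ : Euc n → ℝ} (hφ : IsTestC1 Ω φ) : ⇑hφ.toCc = φ := rfl

end IsTestC1

/-- The space `C¹_c(Ω)` as a subspace of `C_c(ℝⁿ)`. -/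
def testSpace (Ω : Set (Euc n)) : Submodule ℝ C_c(Euc n, ℝ) where
  carrier := {g | IsTestC1 Ω g}
  add_mem' hf hg := hf.add hg
  zero_mem' := IsTestC1.zero
  smul_mem' c _ hf := hf.smul c

section Riesz

variable {X : Type*} [TopologicalSpace X] [T2Space X] [LocallyCompactSpace X]

theorem exists_cc_one_of_isCompact {K V : Set X} (hK : IsCompact K) (hV : IsOpen V) (hKV : K ⊆ V) :
    ∃ f : C_c(X, ℝ), EqOn f 1 K ∧ tsupport f ⊆ V ∧ ∀ x, f x ∈ Icc (0 : ℝ) 1 := by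
  obtain ⟨f, hf1, hf2, hf3⟩ := exists_continuousMap_one_of_isCompact_subset_isOpen hK hV hKV
  exact ⟨⟨f, hasCompactSupport_def.mpr hf2⟩, hf1, hf3⟩

variable [MeasurableSpace X] [BorelSpace X]

theorem isFiniteMeasure_rieszMeasure (L : C_c(X, ℝ) →ₚ[ℝ] ℝ) {M : ℝ}
    (hL : ∀ f : C_c(X, ℝ), (∀ x, f x ∈ Icc (0 : ℝ) 1) → L f ≤ M) :
    IsFiniteMeasure (RealRMK.rieszMeasure L) := by
  refine ⟨lt_of_le_of_lt ?_ (ENNReal.ofReal_lt_top (r := M))⟩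
  rw [isOpen_univ.measure_eq_iSup_isCompact]
  refine iSup₂_le fun K _ => iSup_le fun hK => ?_
  obtain ⟨f, hf1, -, hf3⟩ := exists_cc_one_of_isCompact hK isOpen_univ (subset_univ _)
  exact (RealRMK.rieszMeasure_le_of_eq_one L (fun x => (hf3 x).1) hK hf1).trans
    (ENNReal.ofReal_le_ofReal (hL f hf3))

/-- On a compact K inside an open V, a Urysohn function bounds the Riesz measure of K by lam V.
Outer regularity of lam gives the inequality on compact sets, inner regularity of the finite Riesz
measure on Borel sets. -/
theorem rieszMeasure_le_of_le_integral (L : C_c(X, ℝ) →ₚ[ℝ] ℝ) {lam : Measure X}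
    [IsFiniteMeasure lam] [lam.OuterRegular]
    (hL : ∀ f : C_c(X, ℝ), (∀ x, f x ∈ Icc (0 : ℝ) 1) → L f ≤ ∫ x, f x ∂lam) :
    RealRMK.rieszMeasure L ≤ lam := by
  have hfin : IsFiniteMeasure (RealRMK.rieszMeasure L) := by
    refine isFiniteMeasure_rieszMeasure L (M := lam.real univ) fun f hf => (hL f hf).trans ?_
    have := integral_mono (μ := lam) f.integrable (integrable_const (1 : ℝ)) fun x => (hf x).2
    simpa using this
  have hK : ∀ K : Set X, IsCompact K → RealRMK.rieszMeasure L K ≤ lam K := by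
    intro K hK
    rw [K.measure_eq_iInf_isOpen lam]
    refine le_iInf₂ fun V hKV => le_iInf fun hV => ?_
    obtain ⟨f, hf1, hf2, hf3⟩ := exists_cc_one_of_isCompact hK hV hKV
    refine (RealRMK.rieszMeasure_le_of_eq_one L (fun x => (hf3 x).1) hK hf1).trans ?_
    refine ENNReal.ofReal_le_of_le_toReal ((hL f hf3).trans ?_)
    change _ ≤ lam.real V
    rw [← integral_indicator_one hV.measurableSet]
    refine integral_mono f.integrable ((integrable_const 1).indicator hV.measurableSet) fun x => ?_
    by_cases hx : x ∈ tsupport f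
    · simp [hf2 hx, (hf3 x).2]
    · simp [image_eq_zero_of_notMem_tsupport hx, indicator_nonneg]
  refine Measure.le_iff.2 fun A hA => ?_
  rw [hA.measure_eq_iSup_isCompact_of_ne_top (measure_ne_top _ _)]
  exact iSup₂_le fun K hKA => iSup_le fun h => (hK K h).trans (measure_mono hKA)

end Riesz

section Represent

variable {Λ : (Euc n → ℝ) → ℝ}

/-- A functional on test functions as a partially defined linear map on `C_c(ℝⁿ)`. -/
def testFunctional (hadd : ∀ φ ψ, IsTestC1 Ω φ → IsTestC1 Ω ψ → Λ (φ + ψ) = Λ φ + Λ ψ)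
    (hsmul : ∀ (c : ℝ) φ, IsTestC1 Ω φ → Λ (c • φ) = c * Λ φ) : testSpace Ω →ₗ[ℝ] ℝ where
  toFun g := Λ g.1
  map_add' g h := hadd _ _ g.2 h.2
  map_smul' c g := hsmul c _ g.2

/-- Extend Λ by Hahn–Banach to L on C_c with L g ≤ C ∫ |g|. Then L + C ∫ is positive and at most 2C
∫ on nonnegative functions, so its Riesz measure has a density in [0, 2C]; subtracting C gives p. -/
theorem exists_density_of_le_integral {lam : Measure (Euc n)} [IsFiniteMeasure lam]
    (hadd : ∀ φ ψ, IsTestC1 Ω φ → IsTestC1 Ω ψ → Λ (φ + ψ) = Λ φ + Λ ψ)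
    (hsmul : ∀ (c : ℝ) φ, IsTestC1 Ω φ → Λ (c • φ) = c * Λ φ) {C : ℝ} (hC : 0 ≤ C)
    (hb : ∀ φ, IsTestC1 Ω φ → Λ φ ≤ C * ∫ x, |φ x| ∂lam) :
    ∃ p : Euc n → ℝ, Measurable p ∧ (∀ x, |p x| ≤ C) ∧
      ∀ φ, IsTestC1 Ω φ → Λ φ = ∫ x, φ x * p x ∂lam := by
  obtain ⟨L, hL1, hL2⟩ := exists_extension_of_le_sublinear
    ⟨testSpace Ω, testFunctional hadd hsmul⟩
    (fun g : C_c(Euc n, ℝ) => C * ∫ x, |g x| ∂lam)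
    (fun c hc g => by
      have : ∀ x, |(c • g) x| = c * |g x| := fun x => by
        rw [CompactlySupportedContinuousMap.smul_apply, smul_eq_mul, abs_mul, abs_of_pos hc]
      simp only [this, integral_const_mul]
      ring)
    (fun g h => by
      rw [← mul_add, ← integral_add g.integrable.abs h.integrable.abs]
      exact mul_le_mul_of_nonneg_left (integral_mono (g + h).integrable.abs
        (g.integrable.abs.add h.integrable.abs) fun x => abs_add_le _ _) hC)
    (fun g => hb _ g.2)
  let P : C_c(Euc n, ℝ) →ₚ[ℝ] ℝ := PositiveLinearMap.mk₀
    (L + C • (integralPositiveLinearMap lam : C_c(Euc n, ℝ) →ₗ[ℝ] ℝ)) (fun g hg => by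
      have h1 := hL2 (-g)
      have h2 : ∫ x, |(-g) x| ∂lam = ∫ x, g x ∂lam := by
        refine integral_congr_ae (.of_forall fun x => ?_)
        have : 0 ≤ g x := hg x
        simp [abs_of_nonneg this]
      rw [map_neg, h2] at h1
      change 0 ≤ L g + C * ∫ x, g x ∂lam
      linarith)
  have hP : ∀ g, P g = L g + C * ∫ x, g x ∂lam := fun g => rfl
  set D : NNReal := (2 * C).toNNReal with hD
  have hDC : (D : ℝ) = 2 * C := Real.coe_toNNReal _ (by positivity)
  have hle : RealRMK.rieszMeasure P ≤ D • lam := by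
    refine rieszMeasure_le_of_le_integral P fun g hg => ?_
    have h2 : ∫ x, |g x| ∂lam = ∫ x, g x ∂lam :=
      integral_congr_ae (.of_forall fun x => abs_of_nonneg (hg x).1)
    have := hL2 g
    rw [h2] at this
    rw [hP, integral_smul_nnreal_measure, NNReal.smul_def, hDC, smul_eq_mul]
    linarith
  set κ := RealRMK.rieszMeasure P with hκ
  have hfin : IsFiniteMeasure κ := isFiniteMeasure_of_le _ hle
  have hac : κ ≪ lam := hle.absolutelyContinuous.trans Measure.smul_absolutelyContinuous
  have hrn : ∀ᵐ x ∂lam, κ.rnDeriv lam x ≤ D := by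
    refine ae_le_of_forall_setLIntegral_le_of_sigmaFinite (κ.measurable_rnDeriv lam)
      fun A hA _ => ?_
    rw [Measure.setLIntegral_rnDeriv hac, setLIntegral_const]
    exact hle A
  -- The truncation changes the density only on a null set and turns the a.e. bound into a bound at
  -- every point.
  refine ⟨fun x => max (-C) (min C ((κ.rnDeriv lam x).toReal - C)), by fun_prop, fun x => ?_,
    fun φ hφ => ?_⟩
  · rw [abs_le]
    exact ⟨le_max_left _ _, max_le (by linarith) (min_le_left _ _)⟩
  · have h1 : Λ φ = L hφ.toCc := (hL1 ⟨hφ.toCc, hφ⟩).symm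
    have h2 : ∫ x, φ x ∂κ = L hφ.toCc + C * ∫ x, φ x ∂lam :=
      (RealRMK.integral_rieszMeasure P hφ.toCc).trans (hP _)
    have hi : Integrable φ lam := hφ.toCc.integrable
    have h3 : ∫ x, φ x * max (-C) (min C ((κ.rnDeriv lam x).toReal - C)) ∂lam =
        ∫ x, ((κ.rnDeriv lam x).toReal • φ x - C * φ x) ∂lam := by
      refine integral_congr_ae ?_
      filter_upwards [hrn] with x hx
      have h4 : (κ.rnDeriv lam x).toReal ≤ 2 * C := by
        rw [← hDC]; exact ENNReal.toReal_le_coe_of_le_coe hx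
      have h5 : 0 ≤ (κ.rnDeriv lam x).toReal := ENNReal.toReal_nonneg
      rw [min_eq_right (by linarith), max_eq_right (by linarith), smul_eq_mul]
      ring
    have h5 : Integrable (fun x => (κ.rnDeriv lam x).toReal • φ x) lam :=
      (integrable_rnDeriv_smul_iff hac).2 hφ.toCc.integrable
    change Λ φ = ∫ x, φ x * max (-C) (min C ((κ.rnDeriv lam x).toReal - C)) ∂lam
    rw [h3, integral_sub h5 (hi.const_mul C), integral_rnDeriv_smul hac, h2, h1,
      integral_const_mul]
    ring

/-- A Jordan decomposition obtained from a single Hahn–Banach extension. The functional (φ, -φ) ↦ Λ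
φ on pairs is dominated by M ‖max(u, v, 0)‖, which vanishes when u, v ≤ 0. Hence both coordinate
restrictions of the extension are positive functionals, and Λ is their difference. -/
theorem exists_measures_of_le_sup
    (hadd : ∀ φ ψ, IsTestC1 Ω φ → IsTestC1 Ω ψ → Λ (φ + ψ) = Λ φ + Λ ψ)
    (hsmul : ∀ (c : ℝ) φ, IsTestC1 Ω φ → Λ (c • φ) = c * Λ φ) {M : ℝ} (hM : 0 ≤ M)
    (hb : ∀ φ, IsTestC1 Ω φ → ∀ C : ℝ, (∀ x, |φ x| ≤ C) → Λ φ ≤ M * C) :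
    ∃ α β : Measure (Euc n), IsFiniteMeasure α ∧ IsFiniteMeasure β ∧
      ∀ φ, IsTestC1 Ω φ → Λ φ = ∫ x, φ x ∂α - ∫ x, φ x ∂β := by
  let dom : Submodule ℝ (C_c(Euc n, ℝ) × C_c(Euc n, ℝ)) :=
    { carrier := {z | IsTestC1 Ω z.1 ∧ z.2 = -z.1}
      add_mem' := fun {a b} ha hb => ⟨ha.1.add hb.1, by simp [ha.2, hb.2, add_comm]⟩
      zero_mem' := ⟨IsTestC1.zero, by simp⟩
      smul_mem' := fun c a ha => ⟨ha.1.smul c, by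
        rw [Prod.smul_snd, ha.2]
        ext x
        exact smul_neg c (a.1 x)⟩ }
  let f : dom →ₗ[ℝ] ℝ :=
    { toFun := fun z => Λ z.1.1
      map_add' := fun a b => hadd _ _ a.2.1 b.2.1
      map_smul' := fun c a => hsmul c _ a.2.1 }
  let N : C_c(Euc n, ℝ) × C_c(Euc n, ℝ) → ℝ := fun z =>
    M * ‖((z.1 ⊔ z.2) ⊔ 0).toBoundedContinuousFunction‖
  have happ : ∀ (u v : C_c(Euc n, ℝ)) x,
      ((u ⊔ v) ⊔ 0).toBoundedContinuousFunction x = max (max (u x) (v x)) 0 := fun u v x => rfl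
  have hNle : ∀ (z : C_c(Euc n, ℝ) × C_c(Euc n, ℝ)) x, max (max (z.1 x) (z.2 x)) 0 ≤
      ‖((z.1 ⊔ z.2) ⊔ 0).toBoundedContinuousFunction‖ := fun z x => by
    rw [← happ]
    exact (Real.le_norm_self _).trans (BoundedContinuousFunction.norm_coe_le_norm
      ((z.1 ⊔ z.2) ⊔ 0).toBoundedContinuousFunction x)
  obtain ⟨L, hL1, hL2⟩ := exists_extension_of_le_sublinear ⟨dom, f⟩ N
    (fun c hc z => by
      have : ((c • z).1 ⊔ (c • z).2 ⊔ 0).toBoundedContinuousFunction =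
          c • ((z.1 ⊔ z.2) ⊔ 0).toBoundedContinuousFunction := by
        ext x
        rw [BoundedContinuousFunction.smul_apply, happ, happ, Prod.smul_fst, Prod.smul_snd,
          CompactlySupportedContinuousMap.smul_apply, CompactlySupportedContinuousMap.smul_apply]
        simp only [smul_eq_mul, mul_max_of_nonneg _ _ hc.le, mul_zero]
      simp only [N]
      rw [this, norm_smul, Real.norm_of_nonneg hc.le]
      ring)
    (fun z w => by
      simp only [N]
      rw [← mul_add]
      refine mul_le_mul_of_nonneg_left ?_ hM
      refine (BoundedContinuousFunction.norm_le (by positivity)).2 fun x => ?_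
      have h1 := hNle z x
      have h2 := hNle w x
      simp only [max_le_iff] at h1 h2
      rw [happ, Real.norm_of_nonneg (le_max_right _ _)]
      refine max_le (max_le ?_ ?_) (by positivity)
      · exact add_le_add h1.1.1 h2.1.1
      · exact add_le_add h1.1.2 h2.1.2)
    (fun z => by
      refine hb _ z.2.1 _ fun x => ?_
      have h1 := hNle z.1 x
      have h2 : z.1.2 x = - z.1.1 x := by rw [z.2.2]; rfl
      simp only [max_le_iff, h2] at h1
      exact abs_le'.2 h1.1)
  have hN0 : ∀ u v : C_c(Euc n, ℝ), (∀ x, u x ≤ 0) → (∀ x, v x ≤ 0) → N (u, v) = 0 := by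
    intro u v hu hv
    have : ((u ⊔ v) ⊔ 0).toBoundedContinuousFunction = 0 := by
      ext x
      rw [happ, max_eq_right (max_le (hu x) (hv x))]
      rfl
    simp only [N, this, norm_zero, mul_zero]
  have hN1 : ∀ u v : C_c(Euc n, ℝ), (∀ x, u x ≤ 1) → (∀ x, v x ≤ 1) → N (u, v) ≤ M := by
    intro u v hu hv
    refine mul_le_of_le_one_right hM ?_
    refine (BoundedContinuousFunction.norm_le zero_le_one).2 fun x => ?_
    rw [happ, Real.norm_of_nonneg (le_max_right _ _)]
    exact max_le (max_le (hu x) (hv x)) zero_le_one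
  let A : C_c(Euc n, ℝ) →ₚ[ℝ] ℝ := PositiveLinearMap.mk₀ (L ∘ₗ LinearMap.inl ℝ _ _)
    (fun g hg => by
      have h1 := hL2 (-g, 0)
      rw [hN0 _ _ (fun x => neg_nonpos.2 (hg x)) (fun x => le_rfl)] at h1
      have h2 : ((-g, 0) : C_c(Euc n, ℝ) × C_c(Euc n, ℝ)) = -(g, 0) := by simp
      rw [h2, map_neg] at h1
      change 0 ≤ L (g, 0)
      linarith)
  let B : C_c(Euc n, ℝ) →ₚ[ℝ] ℝ := PositiveLinearMap.mk₀ (L ∘ₗ LinearMap.inr ℝ _ _)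
    (fun g hg => by
      have h1 := hL2 (0, -g)
      rw [hN0 _ _ (fun x => le_rfl) (fun x => neg_nonpos.2 (hg x))] at h1
      have h2 : ((0, -g) : C_c(Euc n, ℝ) × C_c(Euc n, ℝ)) = -(0, g) := by simp
      rw [h2, map_neg] at h1
      change 0 ≤ L (0, g)
      linarith)
  refine ⟨RealRMK.rieszMeasure A, RealRMK.rieszMeasure B,
    isFiniteMeasure_rieszMeasure A (M := M) fun g hg => (hL2 _).trans (hN1 _ _ (fun x => (hg x).2)
      fun x => zero_le_one),
    isFiniteMeasure_rieszMeasure B (M := M) fun g hg => (hL2 _).trans (hN1 _ _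
      (fun x => zero_le_one) fun x => (hg x).2), fun φ hφ => ?_⟩
  have h1 : L (hφ.toCc, -hφ.toCc) = Λ φ := hL1 ⟨(hφ.toCc, -hφ.toCc), hφ, rfl⟩
  have h2 : ((hφ.toCc, -hφ.toCc) : C_c(Euc n, ℝ) × C_c(Euc n, ℝ)) =
      (hφ.toCc, 0) - (0, hφ.toCc) := by simp
  have h3 := RealRMK.integral_rieszMeasure A hφ.toCc
  have h4 := RealRMK.integral_rieszMeasure B hφ.toCc
  rw [hφ.coe_toCc] at h3 h4
  rw [← h1, h2, map_sub, h3, h4]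
  rfl

end Represent

theorem integral_toSignedMeasure_smul {X : Type*} {mX : MeasurableSpace X} (μ : Measure X)
    [IsFiniteMeasure μ] (g : X → ℝ) : ∫ᵛ x, g x ∂•μ.toSignedMeasure = ∫ x, g x ∂μ := by
  rw [← VectorMeasure.integral_toSignedMeasure]
  congr 1
  ext
  simp

theorem bddGradient_isTestC1 {φ : Euc n → ℝ} (hφ : IsTestC1 Ω φ) :
    Continuous (∇ φ) ∧ HasCompactSupport (∇ φ) ∧ ∃ C : ℝ, ∀ x, ‖∇ φ x‖ ≤ C := by
  have h1 : Continuous (∇ φ) :=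
    (InnerProductSpace.toDual ℝ (Euc n)).symm.continuous.comp
      (hφ.contDiff.continuous_fderiv one_ne_zero)
  have h2 : HasCompactSupport (∇ φ) :=
    (hφ.hasCompactSupport.fderiv (𝕜 := ℝ)).comp_left (map_zero _)
  exact ⟨h1, h2, h1.bounded_above_of_compact_support h2⟩

theorem exists_isDivergence (hΩ : MeasurableSet Ω) {F : VectorMeasure (Euc n) (Euc n)}
    (hF : IsDMExt Ω F) : ∃ σ, IsDivergence Ω F σ := by
  have hint : ∀ φ, IsTestC1 Ω φ → F.Integrable (∇ φ) := fun φ hφ => by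
    obtain ⟨h1, h2, C, hC⟩ := bddGradient_isTestC1 hφ
    exact .of_bound h1.aestronglyMeasurable C (.of_forall hC)
  have hdiff : ∀ φ, IsTestC1 Ω φ → Differentiable ℝ φ := fun φ hφ =>
    hφ.contDiff.differentiable one_ne_zero
  have hadd : ∀ φ ψ, IsTestC1 Ω φ → IsTestC1 Ω ψ → ∫ᵛ x, ∇ (φ + ψ) x ∂[dot n; F] =
      ∫ᵛ x, ∇ φ x ∂[dot n; F] + ∫ᵛ x, ∇ ψ x ∂[dot n; F] := fun φ ψ hφ hψ => by
    rw [← VectorMeasure.integral_fun_add (hint φ hφ) (hint ψ hψ)]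
    congr 1
    ext1 x
    simp only [gradient]
    rw [fderiv_add (hdiff φ hφ x) (hdiff ψ hψ x), map_add]
  have hsmul : ∀ (c : ℝ) φ, IsTestC1 Ω φ → ∫ᵛ x, ∇ (c • φ) x ∂[dot n; F] =
      c * ∫ᵛ x, ∇ φ x ∂[dot n; F] := fun c φ hφ => by
    rw [← smul_eq_mul, ← VectorMeasure.integral_fun_smul]
    congr 1
    ext1 x
    simp only [gradient]
    rw [fderiv_const_smul (hdiff φ hφ x), map_smul]
  set M := (divVariation Ω F).toReal with hMdef
  have hb1 : ∀ φ, IsTestC1 Ω φ → (∀ x, |φ x| ≤ 1) → ∫ᵛ x, ∇ φ x ∂[dot n; F] ≤ M := by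
    intro φ hφ h1
    have : ENNReal.ofReal (∫ᵛ x, ∇ φ x ∂[dot n; F]) ≤ divVariation Ω F :=
      le_iSup₂ (f := fun (φ : Euc n → ℝ) (_ : IsTestC1 Ω φ ∧ ∀ x, |φ x| ≤ 1) =>
        ENNReal.ofReal (∫ᵛ x, ∇ φ x ∂[dot n; F])) φ ⟨hφ, h1⟩
    exact (ENNReal.ofReal_le_iff_le_toReal hF.divVariation_lt_top.ne).1 this
  have hb : ∀ φ, IsTestC1 Ω φ → ∀ C : ℝ, (∀ x, |φ x| ≤ C) →
      ∫ᵛ x, ∇ φ x ∂[dot n; F] ≤ M * C := by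
    intro φ hφ C hC
    rcases ((abs_nonneg _).trans (hC 0)).eq_or_lt with h0 | h0
    · have : φ = 0 := by
        ext x
        have := hC x
        rw [← h0] at this
        simpa using this
      simp [this, gradient, ← h0]
    · have := hb1 _ (hφ.smul C⁻¹) fun x => by
        rw [Pi.smul_apply, smul_eq_mul, abs_mul, abs_of_pos (inv_pos.2 h0)]
        exact (inv_mul_le_one₀ h0).2 (hC x)
      rw [hsmul _ _ hφ] at this
      rwa [inv_mul_le_iff₀ h0, mul_comm] at this
  obtain ⟨α, β, hα, hβ, h⟩ := exists_measures_of_le_sup hadd hsmul ENNReal.toReal_nonneg hb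
  -- The difference is β - α because div F is minus the represented functional; the restriction to Ω
  -- is not felt by test functions.
  refine ⟨(β.toSignedMeasure - α.toSignedMeasure).restrict Ω, ⟨fun A hA hd => ?_,
    fun φ hφ => ?_⟩⟩
  · rw [VectorMeasure.restrict_apply _ hΩ hA, hd.inter_eq, VectorMeasure.empty]
  · have hi : ∀ μ : Measure (Euc n), IsFiniteMeasure μ → Integrable φ μ := fun μ _ =>
      hφ.toCc.integrable
    rw [VectorMeasure.setIntegral_eq_integral_of_forall_compl_eq_zero hΩ fun x hx =>
      image_eq_zero_of_notMem_tsupport fun hx' => hx (hφ.tsupport_subset hx'),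
      VectorMeasure.integral_sub_vectorMeasure (hi _ inferInstance) (hi _ inferInstance),
      integral_toSignedMeasure_smul, integral_toSignedMeasure_smul, h φ hφ]
    ring

end DMField

/-! ### Cutoffs, the Leibniz rule and pairing densities -/

namespace DMField

open scoped Manifold

variable {n : ℕ} {Ω : Set (Euc n)} {lam : Measure (Euc n)} {f : Euc n → Euc n} {s : Euc n → ℝ}

section Cutoff

theorem exists_isTestC1_cutoff (hΩ : IsOpen Ω) {K : Set (Euc n)} (hK : IsCompact K)
    (hKΩ : K ⊆ Ω) : ∃ χ : Euc n → ℝ, ContDiff ℝ ∞ χ ∧ IsTestC1 Ω χ ∧ (∀ᶠ x in 𝓝ˢ K, χ x = 1) ∧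
      ∀ x, χ x ∈ Icc (0 : ℝ) 1 := by
  obtain ⟨L, hL, hKL, hLΩ⟩ := exists_compact_between hK hΩ hKΩ
  obtain ⟨χ, h1, h0, h01⟩ := exists_contMDiffMap_one_nhds_of_subset_interior 𝓘(ℝ, Euc n)
    (n := (⊤ : ℕ∞)) hK.isClosed hKL
  have hsupp : tsupport χ ⊆ L :=
    closure_minimal (fun x hx => by_contra fun h => hx (h0 x h)) hL.isClosed
  have hs : ContDiff ℝ ∞ χ := χ.contMDiff.contDiff
  exact ⟨χ, hs, ⟨hs.of_le (by exact_mod_cast le_top),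
    HasCompactSupport.of_support_subset_isCompact hL ((subset_tsupport _).trans hsupp),
    hsupp.trans hLΩ⟩, h1, h01⟩

/-- Approximate ψ in L¹ by a continuous function, that one uniformly by a smooth h, and multiply h
by a cutoff χ equal to 1 on K. Since ψ = χ ψ, the cutoff does not increase the error. -/
theorem exists_isTestC1_integral_sub_le [IsFiniteMeasure lam] (hΩ : IsOpen Ω) {K : Set (Euc n)}
    (hK : IsCompact K) (hKΩ : K ⊆ Ω) {ψ : Euc n → ℝ} (hψ : Integrable ψ lam)
    (hψK : ∀ x ∉ K, ψ x = 0) {ε : ℝ} (hε : 0 < ε) :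
    ∃ θ, IsTestC1 Ω θ ∧ ∫ x, |ψ x - θ x| ∂lam ≤ ε := by
  obtain ⟨g, hgs, hgi, hgc, hgint⟩ := hψ.exists_hasCompactSupport_integral_sub_le (half_pos hε)
  set m := lam.real univ with hm
  have hm0 : 0 ≤ m := measureReal_nonneg
  obtain ⟨h, hh, hgh⟩ := (hgs.uniformContinuous_of_continuous hgc).exists_contDiff_dist_le
    (ε := ε / (2 * (m + 1))) (by positivity)
  obtain ⟨χ, hχs, hχ, hχ1, hχ01⟩ := exists_isTestC1_cutoff hΩ hK hKΩ
  have hθ : IsTestC1 Ω (fun x => χ x * h x) :=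
    ⟨hχ.contDiff.mul (hh.of_le (by exact_mod_cast le_top)), hχ.hasCompactSupport.mul_right,
      (tsupport_mul_subset_left).trans hχ.tsupport_subset⟩
  refine ⟨_, hθ, ?_⟩
  have hθi : Integrable (fun x => χ x * h x) lam := hθ.toCc.integrable
  have hle : ∀ x, |ψ x - χ x * h x| ≤ ‖ψ x - g x‖ + ε / (2 * (m + 1)) := by
    intro x
    have h1 : ψ x = χ x * ψ x := by
      by_cases hx : x ∈ K
      · rw [(hχ1.self_of_nhdsSet x hx), one_mul]
      · rw [hψK x hx, mul_zero]
    have h2 : |ψ x - χ x * h x| = χ x * |ψ x - h x| := by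
      conv_lhs => rw [h1]
      rw [← mul_sub, abs_mul, abs_of_nonneg (hχ01 x).1]
    rw [h2]
    refine (mul_le_of_le_one_left (abs_nonneg _) (hχ01 x).2).trans ?_
    have h3 := hgh x
    rw [Real.dist_eq, abs_sub_comm] at h3
    calc |ψ x - h x| ≤ |ψ x - g x| + |g x - h x| := abs_sub_le _ _ _
      _ ≤ _ := add_le_add le_rfl h3.le
  have hi : Integrable (fun x => ‖ψ x - g x‖) lam := (hψ.sub hgint).norm
  calc ∫ x, |ψ x - χ x * h x| ∂lam ≤ ∫ x, (‖ψ x - g x‖ + ε / (2 * (m + 1))) ∂lam :=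
        integral_mono (hψ.sub hθi).abs (hi.add (integrable_const _)) hle
    _ = ∫ x, ‖ψ x - g x‖ ∂lam + m * (ε / (2 * (m + 1))) := by
        rw [integral_add hi (integrable_const _), integral_const, smul_eq_mul]
    _ ≤ ε / 2 + ε / 2 := by
        refine add_le_add hgi ?_
        rw [← mul_div_assoc, div_le_div_iff₀ (by positivity) (by positivity)]
        nlinarith
    _ = ε := by ring

/-- Dominated convergence with majorant (M + 1)|b|; the factor b confines everything to K, where the
convergence is uniform. -/
theorem tendsto_integral_mul_of_tendstoUniformlyOn {ι : Type*} {l : Filter ι}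
    [l.IsCountablyGenerated] {g : ι → Euc n → ℝ} {φ b : Euc n → ℝ} {K : Set (Euc n)}
    (hg : ∀ᶠ i in l, AEStronglyMeasurable (g i) lam) (hgφ : TendstoUniformlyOn g φ l K)
    {M : ℝ} (hφ : ∀ x ∈ K, |φ x| ≤ M) (hb : Integrable b lam) (hbK : ∀ x ∉ K, b x = 0) :
    Tendsto (fun i => ∫ x, g i x * b x ∂lam) l (𝓝 (∫ x, φ x * b x ∂lam)) := by
  refine tendsto_integral_filter_of_dominated_convergence (fun x => (M + 1) * |b x|)
    (hg.mono fun i hi => hi.mul hb.1) ?_ (hb.abs.const_mul _) (.of_forall fun x => ?_)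
  · filter_upwards [Metric.tendstoUniformlyOn_iff.1 hgφ 1 one_pos] with i hi
    refine .of_forall fun x => ?_
    rw [Real.norm_eq_abs, abs_mul]
    by_cases hx : x ∈ K
    · refine mul_le_mul_of_nonneg_right ?_ (abs_nonneg _)
      have h1 := hi x hx
      rw [dist_comm, Real.dist_eq] at h1
      have h2 := hφ x hx
      have h3 := abs_sub_abs_le_abs_sub (g i x) (φ x)
      linarith
    · simp [hbK x hx]
  · by_cases hx : x ∈ K
    · exact (hgφ.tendsto_at hx).mul_const _
    · simpa [hbK x hx] using tendsto_const_nhds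

end Cutoff

theorem gradient_mul {φ ψ : Euc n → ℝ} {x : Euc n} (hφ : DifferentiableAt ℝ φ x)
    (hψ : DifferentiableAt ℝ ψ x) :
    ∇ (fun y => φ y * ψ y) x = φ x • ∇ ψ x + ψ x • ∇ φ x := by
  simp only [gradient]
  rw [fderiv_fun_mul hφ hψ, map_add, map_smul, map_smul]

theorem norm_gradient (φ : Euc n → ℝ) (x : Euc n) : ‖∇ φ x‖ = ‖fderiv ℝ φ x‖ :=
  LinearIsometryEquiv.norm_map _ _

theorem continuous_gradient {φ : Euc n → ℝ} (hφ : ContDiff ℝ 1 φ) : Continuous (∇ φ) :=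
  (InnerProductSpace.toDual ℝ (Euc n)).symm.continuous.comp (hφ.continuous_fderiv one_ne_zero)

theorem gradient_eq_zero_of_notMem_tsupport {φ : Euc n → ℝ} {x : Euc n} (hx : x ∉ tsupport φ) :
    ∇ φ x = 0 := by
  simp only [gradient]
  rw [image_eq_zero_of_notMem_tsupport fun h => hx (tsupport_fderiv_subset ℝ h), map_zero]

theorem ContinuousOn.exists_abs_le {φ : Euc n → ℝ} {K : Set (Euc n)} (hK : IsCompact K)
    (hφ : ContinuousOn φ K) : ∃ M, 0 ≤ M ∧ ∀ x ∈ K, |φ x| ≤ M := by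
  obtain ⟨M, hM⟩ := hK.exists_bound_of_continuousOn hφ
  exact ⟨|M|, abs_nonneg _, fun x hx => (hM x hx).trans (le_abs_self _)⟩

theorem integrable_mul_of_bounded {ψ p : Euc n → ℝ} (hψ : Integrable ψ lam) (hp : Measurable p)
    {C : ℝ} (hC : ∀ x, |p x| ≤ C) : Integrable (fun x => ψ x * p x) lam :=
  hψ.mul_bdd hp.aestronglyMeasurable (.of_forall hC)

theorem integrable_mul_of_support {φ b : Euc n → ℝ} {K : Set (Euc n)} {M : ℝ}
    (hφ : Measurable φ) (hφK : ∀ x ∈ K, |φ x| ≤ M) (hb : Integrable b lam)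
    (hbK : ∀ x ∉ K, b x = 0) : Integrable (fun x => φ x * b x) lam := by
  refine Integrable.mono' (hb.abs.const_mul M) (hφ.aestronglyMeasurable.mul hb.1)
    (.of_forall fun x => ?_)
  rw [Real.norm_eq_abs, abs_mul]
  by_cases hx : x ∈ K
  · exact mul_le_mul_of_nonneg_right (hφK x hx) (abs_nonneg _)
  · simp [hbK x hx]

/-- `F = f lam` and `div F = s lam` with densities bounded by `1`. -/
structure IsDivData (Ω : Set (Euc n)) (lam : Measure (Euc n)) (f : Euc n → Euc n)
    (s : Euc n → ℝ) : Prop where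
  isFiniteMeasure : IsFiniteMeasure lam
  measure_compl : lam Ωᶜ = 0
  measurable_field : Measurable f
  norm_field_le : ∀ x, ‖f x‖ ≤ 1
  measurable_div : Measurable s
  abs_div_le : ∀ x, |s x| ≤ 1
  integral_eq : ∀ φ, IsTestC1 Ω φ → ∫ x, φ x * s x ∂lam = -∫ x, inner ℝ (∇ φ x) (f x) ∂lam

/-- `p lam` is the pairing of `∇φ` and `F = f lam`, where `div F = s lam`. -/
structure IsPairingDensity (Ω : Set (Euc n)) (lam : Measure (Euc n)) (f : Euc n → Euc n)
    (s φ p : Euc n → ℝ) : Prop where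
  measurable : Measurable p
  bounded : ∃ C, 0 ≤ C ∧ ∀ x, |p x| ≤ C
  integral_eq : ∀ ψ, IsTestC1 Ω ψ → ∫ x, ψ x * p x ∂lam =
    -(∫ x, φ x * inner ℝ (∇ ψ x) (f x) ∂lam) - ∫ x, φ x * (ψ x * s x) ∂lam

/-- A family of `C¹` functions that tends to `φ` locally uniformly in `Ω` as `δ → 0+`, with
gradients eventually bounded by `C` on every compact subset of `Ω`. -/
structure IsC1Approx (Ω : Set (Euc n)) (φ : Euc n → ℝ) (g : ℝ → Euc n → ℝ) (C : ℝ) : Prop where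
  contDiff : ∀ᶠ δ in 𝓝[>] (0 : ℝ), ContDiff ℝ 1 (g δ)
  tendsto : ∀ K, IsCompact K → K ⊆ Ω → TendstoUniformlyOn g φ (𝓝[>] 0) K
  bound : ∀ K, IsCompact K → K ⊆ Ω → ∀ᶠ δ in 𝓝[>] (0 : ℝ), ∀ x ∈ K, ‖∇ (g δ) x‖ ≤ C

namespace IsDivData

variable (h : IsDivData Ω lam f s)
include h

theorem abs_inner_le (v : Euc n) (x : Euc n) : |inner ℝ v (f x)| ≤ ‖v‖ :=
  (abs_real_inner_le_norm _ _).trans (mul_le_of_le_one_right (norm_nonneg _) (h.norm_field_le x))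

theorem integrable_of_bounded {p : Euc n → ℝ} (hp : Measurable p) {C : ℝ}
    (hC : ∀ x, |p x| ≤ C) : Integrable p lam :=
  have := h.isFiniteMeasure
  .of_bound hp.aestronglyMeasurable C (.of_forall hC)

theorem integrable_continuous {ψ : Euc n → ℝ} (hψ : Continuous ψ) (hs : HasCompactSupport ψ) :
    Integrable ψ lam := by
  have := h.isFiniteMeasure
  obtain ⟨C, hC⟩ := hψ.bounded_above_of_compact_support hs
  exact .of_bound hψ.aestronglyMeasurable C (.of_forall hC)

theorem integrable_inner {v : Euc n → Euc n} (hv : Continuous v) (hs : HasCompactSupport v) :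
    Integrable (fun x => inner ℝ (v x) (f x)) lam := by
  have := h.isFiniteMeasure
  obtain ⟨C, hC⟩ := hv.bounded_above_of_compact_support hs
  exact .of_bound (hv.measurable.inner h.measurable_field).aestronglyMeasurable C
    (.of_forall fun x => (h.abs_inner_le _ _).trans (hC x))

theorem integrable_gradient {ψ : Euc n → ℝ} (hψ : IsTestC1 Ω ψ) :
    Integrable (fun x => inner ℝ (∇ ψ x) (f x)) lam :=
  h.integrable_inner (bddGradient_isTestC1 hψ).1 (bddGradient_isTestC1 hψ).2.1

theorem integrable_div {ψ : Euc n → ℝ} (hψ : IsTestC1 Ω ψ) :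
    Integrable (fun x => ψ x * s x) lam :=
  integrable_mul_of_bounded (h.integrable_continuous hψ.contDiff.continuous
    hψ.hasCompactSupport) h.measurable_div h.abs_div_le

theorem integrable_weak {φ ψ : Euc n → ℝ} (hφ : Measurable φ) (hφc : ContinuousOn φ Ω)
    (hψ : IsTestC1 Ω ψ) : Integrable (fun x => φ x * inner ℝ (∇ ψ x) (f x)) lam ∧
      Integrable (fun x => φ x * (ψ x * s x)) lam := by
  obtain ⟨M, -, hM⟩ := ContinuousOn.exists_abs_le hψ.hasCompactSupport
    (hφc.mono hψ.tsupport_subset)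
  refine ⟨integrable_mul_of_support hφ hM (h.integrable_gradient hψ) fun x hx => ?_,
    integrable_mul_of_support hφ hM (h.integrable_div hψ) fun x hx => ?_⟩
  · rw [gradient_eq_zero_of_notMem_tsupport hx, inner_zero_left]
  · rw [image_eq_zero_of_notMem_tsupport hx, zero_mul]

/-- The Leibniz rule for the product of a test function and a `C¹` function. -/
theorem integral_mul_gradient {ψ g : Euc n → ℝ} (hψ : IsTestC1 Ω ψ) (hg : ContDiff ℝ 1 g) :
    ∫ x, ψ x * inner ℝ (∇ g x) (f x) ∂lam =
      -(∫ x, g x * inner ℝ (∇ ψ x) (f x) ∂lam) - ∫ x, g x * (ψ x * s x) ∂lam := by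
  have hψg : IsTestC1 Ω (fun x => ψ x * g x) :=
    ⟨hψ.contDiff.mul hg, hψ.hasCompactSupport.mul_right,
      tsupport_mul_subset_left.trans hψ.tsupport_subset⟩
  have h1 := h.integral_eq _ hψg
  have h2 : ∀ x, inner ℝ (∇ (fun y => ψ y * g y) x) (f x) =
      ψ x * inner ℝ (∇ g x) (f x) + g x * inner ℝ (∇ ψ x) (f x) := fun x => by
    rw [gradient_mul (hψ.contDiff.differentiable one_ne_zero x)
      (hg.differentiable one_ne_zero x), inner_add_left, inner_smul_left, inner_smul_left]
    rfl
  have i1 : Integrable (fun x => ψ x * inner ℝ (∇ g x) (f x)) lam := by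
    have := h.integrable_inner (v := fun x => ψ x • ∇ g x)
      (hψ.contDiff.continuous.smul (continuous_gradient hg)) hψ.hasCompactSupport.smul_right
    refine this.congr (.of_forall fun x => ?_)
    simp only [inner_smul_left]
    rfl
  have i2 := (h.integrable_weak hg.continuous.measurable hg.continuous.continuousOn hψ).1
  rw [integral_congr_ae (.of_forall h2), integral_add i1 i2] at h1
  have h3 : ∫ x, ψ x * g x * s x ∂lam = ∫ x, g x * (ψ x * s x) ∂lam := by
    congr 1; ext x; ring
  rw [h3] at h1
  linarith

theorem isPairingDensity_of_isTestC1 {φ : Euc n → ℝ} (hφ : IsTestC1 Ω φ) :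
    IsPairingDensity Ω lam f s φ (fun x => inner ℝ (∇ φ x) (f x)) := by
  obtain ⟨h1, -, C, hC⟩ := bddGradient_isTestC1 hφ
  exact ⟨h1.measurable.inner h.measurable_field,
    ⟨C, (norm_nonneg _).trans (hC 0), fun x => (h.abs_inner_le _ _).trans (hC x)⟩,
    fun ψ hψ => h.integral_mul_gradient hψ hφ.contDiff⟩

/-- The Leibniz rule moves the gradient from g δ to ψ, after which uniform convergence on the
support of ψ suffices. The limit involves only φ, which is why the pairing is independent of the
mollifier. -/
theorem tendsto_of_isTestC1 {φ : Euc n → ℝ} {g : ℝ → Euc n → ℝ} {C : ℝ}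
    (hφc : ContinuousOn φ Ω) (hg : IsC1Approx Ω φ g C) {ψ : Euc n → ℝ} (hψ : IsTestC1 Ω ψ) :
    Tendsto (fun δ => ∫ x, ψ x * inner ℝ (∇ (g δ) x) (f x) ∂lam) (𝓝[>] 0)
      (𝓝 (-(∫ x, φ x * inner ℝ (∇ ψ x) (f x) ∂lam) - ∫ x, φ x * (ψ x * s x) ∂lam)) := by
  obtain ⟨M, -, hM⟩ := ContinuousOn.exists_abs_le hψ.hasCompactSupport
    (hφc.mono hψ.tsupport_subset)
  have hmeas : ∀ᶠ δ in 𝓝[>] (0 : ℝ), AEStronglyMeasurable (g δ) lam :=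
    hg.contDiff.mono fun δ hδ => hδ.continuous.aestronglyMeasurable
  have hu := hg.tendsto _ hψ.hasCompactSupport hψ.tsupport_subset
  have t1 := tendsto_integral_mul_of_tendstoUniformlyOn hmeas hu hM (h.integrable_gradient hψ)
    fun x hx => by rw [gradient_eq_zero_of_notMem_tsupport hx, inner_zero_left]
  have t2 := tendsto_integral_mul_of_tendstoUniformlyOn hmeas hu hM (h.integrable_div hψ)
    fun x hx => by rw [image_eq_zero_of_notMem_tsupport hx, zero_mul]
  refine (t1.neg.sub t2).congr' ?_
  filter_upwards [hg.contDiff] with δ hδ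
  exact (h.integral_mul_gradient hψ hδ).symm

theorem abs_integral_mul_gradient_le {g ψ : Euc n → ℝ} {C : ℝ} (hg : ContDiff ℝ 1 g)
    (hψ : Integrable ψ lam) (hC : ∀ x, ψ x ≠ 0 → ‖∇ g x‖ ≤ C) :
    Integrable (fun x => ψ x * inner ℝ (∇ g x) (f x)) lam ∧
    |∫ x, ψ x * inner ℝ (∇ g x) (f x) ∂lam| ≤ C * ∫ x, |ψ x| ∂lam := by
  have hle : ∀ x, ‖ψ x * inner ℝ (∇ g x) (f x)‖ ≤ C * |ψ x| := fun x => by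
    rw [Real.norm_eq_abs, abs_mul, mul_comm]
    by_cases hx : ψ x = 0
    · simp [hx]
    · exact mul_le_mul_of_nonneg_right ((h.abs_inner_le _ _).trans (hC x hx)) (abs_nonneg _)
  refine ⟨Integrable.mono' (hψ.abs.const_mul C) (hψ.1.mul ((continuous_gradient hg).measurable.inner
    h.measurable_field).aestronglyMeasurable) (.of_forall hle), ?_⟩
  rw [← integral_const_mul]
  exact norm_integral_le_of_norm_le (hψ.abs.const_mul C) (.of_forall hle)

/-- The weak form of the pairing is a limit of ∫ ψ ∇(g δ) · f, so it inherits the bound C ∫ |ψ| and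
is represented by a density. -/
theorem exists_isPairingDensity {φ : Euc n → ℝ} {g : ℝ → Euc n → ℝ} {C : ℝ} (hC : 0 ≤ C)
    (hφ : Measurable φ) (hφc : ContinuousOn φ Ω) (hg : IsC1Approx Ω φ g C) :
    ∃ p, IsPairingDensity Ω lam f s φ p := by
  have := h.isFiniteMeasure
  obtain ⟨p, hp, hpC, hp'⟩ := exists_density_of_le_integral (Ω := Ω) (lam := lam)
    (Λ := fun ψ => -(∫ x, φ x * inner ℝ (∇ ψ x) (f x) ∂lam) - ∫ x, φ x * (ψ x * s x) ∂lam)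
    (fun ψ θ hψ hθ => by
      have h1 : ∀ x, φ x * inner ℝ (∇ (ψ + θ) x) (f x) =
          φ x * inner ℝ (∇ ψ x) (f x) + φ x * inner ℝ (∇ θ x) (f x) := fun x => by
        rw [← mul_add, ← inner_add_left]
        simp only [gradient]
        rw [fderiv_add (hψ.contDiff.differentiable one_ne_zero x)
          (hθ.contDiff.differentiable one_ne_zero x), map_add]
      have h2 : ∀ x, φ x * ((ψ + θ) x * s x) = φ x * (ψ x * s x) + φ x * (θ x * s x) :=
        fun x => by simp only [Pi.add_apply]; ring
      have i1 := h.integrable_weak hφ hφc hψ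
      have i2 := h.integrable_weak hφ hφc hθ
      simp only [h1, h2]
      rw [integral_add i1.1 i2.1, integral_add i1.2 i2.2]
      ring)
    (fun c ψ hψ => by
      have h1 : ∀ x, φ x * inner ℝ (∇ (c • ψ) x) (f x) =
          c * (φ x * inner ℝ (∇ ψ x) (f x)) := fun x => by
        simp only [gradient]
        rw [fderiv_const_smul (hψ.contDiff.differentiable one_ne_zero x), map_smul,
          inner_smul_left]
        simp only [conj_trivial]
        ring
      have h2 : ∀ x, φ x * ((c • ψ) x * s x) = c * (φ x * (ψ x * s x)) :=
        fun x => by simp only [Pi.smul_apply, smul_eq_mul]; ring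
      simp only [h1, h2, integral_const_mul]
      ring) hC
    (fun ψ hψ => by
      refine le_of_tendsto (h.tendsto_of_isTestC1 hφc hg hψ) ?_
      filter_upwards [hg.contDiff, hg.bound _ hψ.hasCompactSupport hψ.tsupport_subset] with δ h1 h2
      exact (le_abs_self _).trans (h.abs_integral_mul_gradient_le h1
        (h.integrable_continuous hψ.contDiff.continuous hψ.hasCompactSupport)
        fun x hx => h2 x (subset_tsupport _ hx)).2)
  exact ⟨p, hp, ⟨C, hC, hpC⟩, fun ψ hψ => (hp' ψ hψ).symm⟩

/-- Functionals bounded by C and D times the L¹ norm converge on all integrable ψ vanishing off K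
once they do so on test functions, by density. The gain over test functions is that indicators of
Borel sets are allowed. -/
theorem tendsto_integral_mul_gradient (hΩ : IsOpen Ω) {φ p : Euc n → ℝ} {g : ℝ → Euc n → ℝ}
    {C : ℝ} (hC : 0 ≤ C) (hφc : ContinuousOn φ Ω) (hg : IsC1Approx Ω φ g C)
    (hp : IsPairingDensity Ω lam f s φ p) {ψ : Euc n → ℝ} {K : Set (Euc n)} (hK : IsCompact K)
    (hKΩ : K ⊆ Ω) (hψ : Integrable ψ lam) (hψK : ∀ x ∉ K, ψ x = 0) :
    Tendsto (fun δ => ∫ x, ψ x * inner ℝ (∇ (g δ) x) (f x) ∂lam) (𝓝[>] 0)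
      (𝓝 (∫ x, ψ x * p x ∂lam)) := by
  have := h.isFiniteMeasure
  obtain ⟨D, hD0, hD⟩ := hp.bounded
  rw [Metric.tendsto_nhds]
  intro ε hε
  obtain ⟨θ, hθ, hθε⟩ := exists_isTestC1_integral_sub_le (lam := lam) hΩ hK hKΩ hψ hψK
    -- Replacing ψ by θ costs C times the L¹ error on the left and D times on the right; this choice
    -- keeps the total below ε / 2, with the summand 1 covering C = D = 0.
    (ε := ε / (2 * (C + D + 1))) (by positivity)
  have t := h.tendsto_of_isTestC1 hφc hg hθ
  rw [← hp.integral_eq θ hθ, Metric.tendsto_nhds] at t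
  have hθi := h.integrable_continuous hθ.contDiff.continuous hθ.hasCompactSupport
  have hKs : IsCompact (K ∪ tsupport θ) := hK.union hθ.hasCompactSupport
  filter_upwards [t (ε / 2) (half_pos hε), hg.contDiff,
    hg.bound _ hKs (union_subset hKΩ hθ.tsupport_subset)] with δ h1 h2 h3
  have b1 := h.abs_integral_mul_gradient_le (ψ := fun x => ψ x - θ x) h2 (hψ.sub hθi)
    (C := C) fun x hx => h3 x <| by
      by_contra hx'
      rw [mem_union, not_or] at hx'
      simp [hψK x hx'.1, image_eq_zero_of_notMem_tsupport hx'.2] at hx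
  have b2 := h.abs_integral_mul_gradient_le (ψ := θ) h2 hθi (C := C) fun x hx =>
    h3 x (Or.inr (subset_tsupport _ hx))
  have e1 : ∫ x, ψ x * inner ℝ (∇ (g δ) x) (f x) ∂lam =
      ∫ x, (ψ x - θ x) * inner ℝ (∇ (g δ) x) (f x) ∂lam +
      ∫ x, θ x * inner ℝ (∇ (g δ) x) (f x) ∂lam := by
    rw [← integral_add b1.1 b2.1]
    congr 1; ext x; ring
  have i1 := integrable_mul_of_bounded hψ hp.measurable hD
  have i2 := integrable_mul_of_bounded hθi hp.measurable hD
  have e2 : ∫ x, ψ x * p x ∂lam = ∫ x, (ψ x - θ x) * p x ∂lam + ∫ x, θ x * p x ∂lam := by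
    simp only [sub_mul]
    rw [integral_sub i1 i2]; ring
  have b3 : |∫ x, (ψ x - θ x) * p x ∂lam| ≤ D * ∫ x, |ψ x - θ x| ∂lam := by
    rw [← integral_const_mul]
    refine norm_integral_le_of_norm_le (f := fun x => (ψ x - θ x) * p x)
      ((hψ.sub hθi).abs.const_mul D) (.of_forall fun x => ?_)
    rw [Real.norm_eq_abs, abs_mul, mul_comm]
    exact mul_le_mul_of_nonneg_right (hD x) (abs_nonneg _)
  have b4 : (C + D) * ∫ x, |ψ x - θ x| ∂lam < ε / 2 := by
    calc (C + D) * ∫ x, |ψ x - θ x| ∂lam ≤ (C + D) * (ε / (2 * (C + D + 1))) :=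
          mul_le_mul_of_nonneg_left hθε (by positivity)
      _ < ε / 2 := by
          rw [← mul_div_assoc, div_lt_div_iff₀ (by positivity) (by positivity)]
          nlinarith
  rw [Real.dist_eq] at h1 ⊢
  rw [e1, e2]
  have b5 := b1.2
  rw [abs_lt] at h1 ⊢
  rw [abs_le] at b3 b5
  constructor <;> linarith [b3.1, b3.2, b5.1, b5.2, h1.1, h1.2]

theorem ae_eq_of_integral_eq (hΩ : IsOpen Ω) {p q : Euc n → ℝ} (hp : Integrable p lam)
    (hq : Integrable q lam)
    (hpq : ∀ ψ, IsTestC1 Ω ψ → ∫ x, ψ x * p x ∂lam = ∫ x, ψ x * q x ∂lam) : p =ᵐ[lam] q := by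
  have h1 := hΩ.ae_eq_zero_of_integral_contDiff_smul_eq_zero (μ := lam)
    (f := fun x => p x - q x) ((hp.sub hq).locallyIntegrable.locallyIntegrableOn _)
    fun g hg hgc hgs => by
      have hgt : IsTestC1 Ω g := ⟨hg.of_le (by exact_mod_cast le_top), hgc, hgs⟩
      obtain ⟨C, hC⟩ := hg.continuous.bounded_above_of_compact_support hgc
      have i1 : Integrable (fun x => g x * p x) lam :=
        hp.bdd_mul hg.continuous.aestronglyMeasurable (.of_forall hC)
      have i2 : Integrable (fun x => g x * q x) lam :=
        hq.bdd_mul hg.continuous.aestronglyMeasurable (.of_forall hC)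
      simp only [smul_eq_mul, mul_sub]
      rw [integral_sub i1 i2, hpq g hgt, sub_self]
  have h2 : ∀ᵐ x ∂lam, x ∈ Ω := h.measure_compl
  filter_upwards [h1, h2] with x h3 h4
  exact sub_eq_zero.1 (h3 h4)

end IsDivData

end DMField

/-! ### Mollification: smoothness, local uniform convergence, gradient bounds -/

namespace DMField

open scoped Convolution Pointwise
open ContinuousLinearMap (lsmul)

variable {n : ℕ} {Ω : Set (Euc n)}

/-- The rescaled mollifier `ρ_δ(z) = δ⁻ⁿ ρ(z/δ)`. -/
def scaledMollifier (ρ : Euc n → ℝ) (δ : ℝ) (z : Euc n) : ℝ := (δ ^ n)⁻¹ * ρ (δ⁻¹ • z)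

namespace IsStandardMollifier

theorem exists_isStandardMollifier : ∃ ρ : Euc n → ℝ, IsStandardMollifier ρ := by
  let b : ContDiffBump (0 : Euc n) := ⟨1 / 2, 1, by norm_num, by norm_num⟩
  exact ⟨b.normed volume, fun x => b.nonneg_normed x, b.contDiff_normed,
    b.tsupport_normed_eq.subset, b.integral_normed⟩

variable {ρ : Euc n → ℝ} (hρ : IsStandardMollifier ρ) {δ : ℝ} (hδ : 0 < δ)
include hρ hδ

theorem scaled_nonneg (z : Euc n) : 0 ≤ scaledMollifier ρ δ z :=
  mul_nonneg (by positivity) (hρ.nonneg _)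

omit hδ in
theorem scaled_contDiff : ContDiff ℝ ∞ (scaledMollifier ρ δ) :=
  contDiff_const.mul (hρ.contDiff.comp (contDiff_const_smul _))

theorem scaled_eq_zero {z : Euc n} (hz : δ < ‖z‖) : scaledMollifier ρ δ z = 0 := by
  have : δ⁻¹ • z ∉ tsupport ρ := fun h => by
    have := hρ.tsupport_subset h
    rw [mem_closedBall_zero_iff, norm_smul, Real.norm_of_nonneg (by positivity),
      inv_mul_le_one₀ hδ] at this
    linarith
  simp [scaledMollifier, image_eq_zero_of_notMem_tsupport this]

theorem scaled_tsupport_subset : tsupport (scaledMollifier ρ δ) ⊆ Metric.closedBall 0 δ :=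
  closure_minimal (fun z hz => by
    rw [mem_closedBall_zero_iff]
    by_contra h
    exact hz (hρ.scaled_eq_zero hδ (not_le.1 h))) Metric.isClosed_closedBall

theorem scaled_hasCompactSupport : HasCompactSupport (scaledMollifier ρ δ) :=
  HasCompactSupport.of_support_subset_isCompact (isCompact_closedBall 0 δ)
    ((subset_tsupport _).trans (hρ.scaled_tsupport_subset hδ))

theorem scaled_integral : ∫ z, scaledMollifier ρ δ z = 1 := by
  simp only [scaledMollifier]
  rw [integral_const_mul, Measure.integral_comp_inv_smul_of_nonneg volume ρ hδ.le,
    hρ.integral_eq_one]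
  simp [hδ.ne']

theorem scaled_integrable : Integrable (scaledMollifier ρ δ) volume :=
  (hρ.scaled_contDiff).continuous.integrable_of_hasCompactSupport (hρ.scaled_hasCompactSupport hδ)

end IsStandardMollifier

theorem mollify_eq_convolution (hΩ : MeasurableSet Ω) (ρ : Euc n → ℝ) (δ : ℝ) (φ : Euc n → ℝ) :
    mollify Ω ρ δ φ = scaledMollifier ρ δ ⋆[lsmul ℝ ℝ, volume] (Ω.indicator φ) := by
  ext x
  rw [convolution_lsmul_swap, mollify, ← integral_indicator hΩ]
  congr 1
  ext y
  by_cases hy : y ∈ Ω <;> simp [hy, scaledMollifier]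

theorem mollify_indicator (hΩ : MeasurableSet Ω) (ρ : Euc n → ℝ) (δ : ℝ) (φ : Euc n → ℝ) :
    mollify Ω ρ δ (Ω.indicator φ) = mollify Ω ρ δ φ := by
  rw [mollify_eq_convolution hΩ, mollify_eq_convolution hΩ, indicator_indicator, inter_self]

section Approx

variable {ρ : Euc n → ℝ} (hρ : IsStandardMollifier ρ) {φ : Euc n → ℝ}
include hρ

theorem contDiff_mollify (hΩ : MeasurableSet Ω) {δ : ℝ} (hδ : 0 < δ)
    (hφ : LocallyIntegrable (Ω.indicator φ) volume) : ContDiff ℝ 1 (mollify Ω ρ δ φ) := by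
  rw [mollify_eq_convolution hΩ]
  exact ((hρ.scaled_hasCompactSupport hδ).contDiff_convolution_left (n := ⊤) _
    hρ.scaled_contDiff hφ).of_le (by exact_mod_cast le_top)

theorem tendstoUniformlyOn_mollify (hΩ : IsOpen Ω) (hφc : ContinuousOn φ Ω) {K : Set (Euc n)}
    (hK : IsCompact K) (hKΩ : K ⊆ Ω) :
    TendstoUniformlyOn (fun δ => mollify Ω ρ δ φ) φ (𝓝[>] 0) K := by
  obtain ⟨r, hr, hrΩ⟩ := hK.exists_cthickening_subset_open hΩ hKΩ
  rw [Metric.tendstoUniformlyOn_iff]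
  intro ε hε
  obtain ⟨η, hη, h⟩ := Metric.uniformContinuousOn_iff.1
    (hK.cthickening.uniformContinuousOn_of_continuous (hφc.mono hrΩ)) (ε / 2) (half_pos hε)
  have hpos : 0 < min r η := lt_min hr hη
  filter_upwards [Ioo_mem_nhdsGT hpos] with δ hδ x hx
  rw [mollify_eq_convolution hΩ.measurableSet, dist_comm]
  refine lt_of_le_of_lt (dist_convolution_le (R := min r η) (half_pos hε).le (fun z hz => ?_)
    (hρ.scaled_nonneg hδ.1) (hρ.scaled_integral hδ.1)
    ((aestronglyMeasurable_indicator_iff hΩ.measurableSet).2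
      (hφc.aestronglyMeasurable hΩ.measurableSet))
    fun y hy => ?_) (half_lt_self hε)
  · rw [mem_ball_zero_iff]
    refine lt_of_le_of_lt ?_ hδ.2
    by_contra hz'
    exact hz (hρ.scaled_eq_zero hδ.1 (not_le.1 hz'))
  · have hyr : y ∈ Metric.cthickening r K :=
      Metric.mem_cthickening_of_dist_le y x r K hx
        ((Metric.mem_ball.1 hy).le.trans (min_le_left _ _))
    rw [indicator_of_mem (hrΩ hyr)]
    exact (h y hyr x (Metric.self_subset_cthickening K hx)
      ((Metric.mem_ball.1 hy).trans_le (min_le_right _ _))).le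

theorem norm_gradient_mollify_le_of_lipschitz (hΩ : IsOpen Ω) {C : NNReal}
    (hφ : LipschitzWith C φ) {K : Set (Euc n)} (hK : IsCompact K) (hKΩ : K ⊆ Ω) :
    ∀ᶠ δ in 𝓝[>] (0 : ℝ), ∀ x ∈ K, ‖∇ (mollify Ω ρ δ φ) x‖ ≤ C := by
  obtain ⟨r, hr, hrΩ⟩ := hK.exists_cthickening_subset_open hΩ hKΩ
  filter_upwards [Ioo_mem_nhdsGT (half_pos hr)] with δ hδ x hx
  rw [norm_gradient]
  refine norm_fderiv_le_of_lip' ℝ C.2 ?_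
  have hi := hρ.scaled_integrable hδ.1
  -- For y within r / 2 of x and δ < r / 2 the averaging ball stays in Ω, so the indicator of Ω
  -- disappears and the mollification is an average of translates of φ.
  have key : ∀ y, dist y x < r / 2 → mollify Ω ρ δ φ y =
      ∫ t, scaledMollifier ρ δ t * φ (y - t) := fun y hy => by
    rw [mollify_eq_convolution hΩ.measurableSet, convolution_lsmul]
    congr 1
    ext t
    by_cases ht : ‖t‖ ≤ δ
    · have : y - t ∈ Ω := by
        refine hrΩ (Metric.mem_cthickening_of_dist_le _ x r K hx ?_)
        calc dist (y - t) x ≤ dist (y - t) y + dist y x := dist_triangle _ _ _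
          _ ≤ r / 2 + r / 2 := by
            refine add_le_add ?_ hy.le
            rw [dist_eq_norm, sub_sub_cancel_left, norm_neg]
            exact ht.trans hδ.2.le
          _ = r := by ring
      rw [indicator_of_mem this, smul_eq_mul]
    · simp [hρ.scaled_eq_zero hδ.1 (not_le.1 ht)]
  have hint : ∀ y, Integrable fun t => scaledMollifier ρ δ t * φ (y - t) := fun y =>
    (hρ.scaled_contDiff.continuous.mul
      (hφ.continuous.comp (continuous_const.sub continuous_id))).integrable_of_hasCompactSupport
      (hρ.scaled_hasCompactSupport hδ.1).mul_right
  filter_upwards [Metric.ball_mem_nhds x (half_pos hr)] with y hy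
  rw [key y hy, key x (by simpa using hr), ← integral_sub (hint y) (hint x)]
  calc ‖∫ t, (scaledMollifier ρ δ t * φ (y - t) - scaledMollifier ρ δ t * φ (x - t))‖
      ≤ ∫ t, scaledMollifier ρ δ t * (C * ‖y - x‖) := by
        refine norm_integral_le_of_norm_le (hi.mul_const _) (.of_forall fun t => ?_)
        rw [← mul_sub, norm_mul, Real.norm_of_nonneg (hρ.scaled_nonneg hδ.1 t)]
        refine mul_le_mul_of_nonneg_left ?_ (hρ.scaled_nonneg hδ.1 t)
        have := hφ.dist_le_mul (y - t) (x - t)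
        rwa [dist_sub_right, dist_eq_norm, dist_eq_norm] at this
    _ = C * ‖y - x‖ := by rw [integral_mul_const, hρ.scaled_integral hδ.1, one_mul]

/-- For x in K and δ small, ψ(y) = k(x - y) is admissible in the definition of the weak gradient, so
the gradient of the mollification at x is the average ∫ ψ G, of norm at most M ∫ ψ = M. -/
theorem norm_gradient_mollify_le_of_weakGradient (hΩ : IsOpen Ω)
    (hφ : LocallyIntegrable (Ω.indicator φ) volume) {G : Euc n → Euc n} {M : ℝ} (hM : 0 ≤ M)
    (hGM : ∀ᵐ x ∂(volume.restrict Ω), ‖G x‖ ≤ M)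
    (hweak : ∀ ψ : Euc n → ℝ, ContDiff ℝ ∞ ψ → HasCompactSupport ψ → tsupport ψ ⊆ Ω →
      ∫ x in Ω, φ x • ∇ ψ x = - ∫ x in Ω, ψ x • G x)
    {K : Set (Euc n)} (hK : IsCompact K) (hKΩ : K ⊆ Ω) :
    ∀ᶠ δ in 𝓝[>] (0 : ℝ), ∀ x ∈ K, ‖∇ (mollify Ω ρ δ φ) x‖ ≤ M := by
  obtain ⟨r, hr, hrΩ⟩ := hK.exists_cthickening_subset_open hΩ hKΩ
  filter_upwards [Ioo_mem_nhdsGT hr] with δ hδ x hx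
  set k := scaledMollifier ρ δ with hk
  have hks : ContDiff ℝ ∞ k := hρ.scaled_contDiff
  have hk1 : ContDiff ℝ 1 k := hks.of_le (by exact_mod_cast le_top)
  have hkd : Differentiable ℝ k := hk1.differentiable one_ne_zero
  set ψ : Euc n → ℝ := fun y => k (x - y) with hψ
  have hψs : ContDiff ℝ ∞ ψ := hks.comp (contDiff_const.sub contDiff_id)
  have hψsupp : tsupport ψ ⊆ Metric.closedBall x δ :=
    closure_minimal (fun y hy => by
      rw [Metric.mem_closedBall, dist_comm, dist_eq_norm]
      by_contra h
      exact hy (hρ.scaled_eq_zero hδ.1 (not_le.1 h))) Metric.isClosed_closedBall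
  have hψc : HasCompactSupport ψ := HasCompactSupport.of_support_subset_isCompact
    (isCompact_closedBall x δ) ((subset_tsupport _).trans hψsupp)
  have hψΩ : tsupport ψ ⊆ Ω := hψsupp.trans fun y hy =>
    hrΩ (Metric.mem_cthickening_of_dist_le _ x r K hx ((Metric.mem_closedBall.1 hy).trans hδ.2.le))
  have hw := hweak ψ hψs hψc hψΩ
  have hψ1 : ContDiff ℝ 1 ψ := hψs.of_le (by exact_mod_cast le_top)
  have hfd : ∀ y v, fderiv ℝ k (x - y) v = - inner ℝ v (∇ ψ y) := fun y v => by
    have h1 : HasFDerivAt ψ ((fderiv ℝ k (x - y)).comp (-ContinuousLinearMap.id ℝ (Euc n))) y :=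
      (hkd (x - y)).hasFDerivAt.comp y ((hasFDerivAt_id y).const_sub x)
    rw [inner_gradient_right, h1.fderiv]
    simp
  have hψi : Integrable (fun y => ψ y • M) volume :=
    (hψs.continuous.smul continuous_const).integrable_of_hasCompactSupport hψc.smul_right
  have hbound : ‖∫ y in Ω, ψ y • G y‖ ≤ M := by
    calc ‖∫ y in Ω, ψ y • G y‖ ≤ ∫ y in Ω, ψ y • M := by
          refine norm_integral_le_of_norm_le hψi.integrableOn ?_
          filter_upwards [hGM] with y hy
          rw [norm_smul, Real.norm_of_nonneg (hρ.scaled_nonneg hδ.1 _)]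
          exact mul_le_mul_of_nonneg_left hy (hρ.scaled_nonneg hδ.1 _)
      _ ≤ ∫ y, ψ y • M := setIntegral_le_integral hψi
          (.of_forall fun y => mul_nonneg (hρ.scaled_nonneg hδ.1 _) hM)
      _ = M := by
          simp only [smul_eq_mul]
          rw [integral_mul_const, hψ, integral_sub_left_eq_self k volume x,
            hρ.scaled_integral hδ.1, one_mul]
  rw [norm_gradient, mollify_eq_convolution hΩ.measurableSet]
  have hder := (hρ.scaled_hasCompactSupport hδ.1).hasFDerivAt_convolution_left
    (μ := volume) (lsmul ℝ ℝ) hk1 hφ x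
  rw [hder.fderiv]
  have hfk : Continuous (fderiv ℝ k) := hk1.continuous_fderiv one_ne_zero
  have hex := ((hρ.scaled_hasCompactSupport hδ.1).fderiv (𝕜 := ℝ)).convolutionExists_left
    (μ := volume) ((lsmul ℝ ℝ : ℝ →L[ℝ] ℝ →L[ℝ] ℝ).precompL (Euc n)) hfk hφ x
  have hex' := hex.integrable_swap
  refine ContinuousLinearMap.opNorm_le_bound _ hM fun v => ?_
  rw [convolution_eq_swap, ContinuousLinearMap.integral_apply hex' v]
  have h1 : ∀ y, ((lsmul ℝ ℝ : ℝ →L[ℝ] ℝ →L[ℝ] ℝ).precompL (Euc n) (fderiv ℝ k (x - y))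
      (Ω.indicator φ y)) v = Ω.indicator (fun y => - inner ℝ v (φ y • ∇ ψ y)) y := fun y => by
    rw [ContinuousLinearMap.precompL_apply, ContinuousLinearMap.lsmul_apply, hfd]
    by_cases hy : y ∈ Ω
    · simp only [indicator_of_mem hy, inner_smul_right, smul_eq_mul]
      ring
    · simp [hy]
  refine (congrArg norm (integral_congr_ae (.of_forall h1))).le.trans ?_
  have hint : IntegrableOn (fun y => φ y • ∇ ψ y) Ω := by
    have := hφ.integrable_smul_right_of_hasCompactSupport (continuous_gradient hψ1)
      ((hψc.fderiv (𝕜 := ℝ)).comp_left (map_zero (InnerProductSpace.toDual ℝ (Euc n)).symm))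
    refine (integrable_indicator_iff hΩ.measurableSet).1 (this.congr (.of_forall fun y => ?_))
    by_cases hy : y ∈ Ω <;> simp [hy]
  rw [integral_indicator hΩ.measurableSet, integral_neg, integral_inner hint, hw, inner_neg_right,
    neg_neg, mul_comm]
  exact (norm_inner_le_norm _ _).trans (mul_le_mul_of_nonneg_left hbound (norm_nonneg _))

/-- This serves the distance function, which need not be bounded on Ω and so is not covered by the
class W^{1,∞}(Ω). -/
theorem isC1Approx_of_lipschitz (hΩ : IsOpen Ω) {C : NNReal} (hφ : LipschitzWith C φ) :
    IsC1Approx Ω φ (fun δ => mollify Ω ρ δ φ) C where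
  contDiff := by
    filter_upwards [self_mem_nhdsWithin] with δ hδ
    exact contDiff_mollify hρ hΩ.measurableSet hδ
      (hφ.continuous.locallyIntegrable.indicator hΩ.measurableSet)
  tendsto K hK hKΩ := tendstoUniformlyOn_mollify hρ hΩ hφ.continuous.continuousOn hK hKΩ
  bound K hK hKΩ := norm_gradient_mollify_le_of_lipschitz hρ hΩ hφ hK hKΩ

end Approx

theorem MemW1Infty.exists_isC1Approx (hΩ : IsOpen Ω) {φ : Euc n → ℝ} (hφ : MemW1Infty Ω φ) :
    ∃ C, 0 ≤ C ∧ ∀ ρ, IsStandardMollifier ρ → IsC1Approx Ω φ (fun δ => mollify Ω ρ δ φ) C := by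
  obtain ⟨G, hG, hweak⟩ := hφ.exists_weakGradient
  have hloc : LocallyIntegrable (Ω.indicator φ) volume :=
    ((memLp_indicator_iff_restrict hΩ.measurableSet).2 hφ.memLp).locallyIntegrable le_top
  set M := (eLpNorm G ⊤ (volume.restrict Ω)).toReal with hM
  have hGM : ∀ᵐ x ∂(volume.restrict Ω), ‖G x‖ ≤ M := by
    filter_upwards [ae_le_eLpNormEssSup (f := G) (μ := volume.restrict Ω)] with x hx
    rw [hM, eLpNorm_exponent_top, ← toReal_enorm]
    exact ENNReal.toReal_mono (by simpa using hG.2.ne) hx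
  refine ⟨M, ENNReal.toReal_nonneg, fun ρ hρ => ⟨?_, fun K hK hKΩ => ?_, fun K hK hKΩ => ?_⟩⟩
  · filter_upwards [self_mem_nhdsWithin] with δ hδ
    exact contDiff_mollify hρ hΩ.measurableSet hδ hloc
  · exact tendstoUniformlyOn_mollify hρ hΩ hφ.continuousOn hK hKΩ
  · exact norm_gradient_mollify_le_of_weakGradient hρ hΩ hloc ENNReal.toReal_nonneg hGM
      hweak hK hKΩ

end DMField

/-! ### Uniqueness of the measures, and translation between measures and densities -/

namespace DMField

open scoped NNReal

variable {n : ℕ} {Ω : Set (Euc n)}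

/-- A signed measure that annihilates the smooth functions with compact support in an open set `W`
vanishes on the Borel subsets of `W`. -/
theorem signedMeasure_apply_eq_zero {E : Type*} [NormedAddCommGroup E] [NormedSpace ℝ E]
    [FiniteDimensional ℝ E] [MeasurableSpace E] [BorelSpace E] {m : SignedMeasure E} {W : Set E}
    (hW : IsOpen W) (h : ∀ ψ : E → ℝ, ContDiff ℝ ∞ ψ → HasCompactSupport ψ → tsupport ψ ⊆ W →
      ∫ᵛ x, ψ x ∂•m = 0) {A : Set E} (hA : MeasurableSet A) (hAW : A ⊆ W) : m A = 0 := by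
  obtain ⟨g, hg, hg1, hm⟩ := exists_density_signedMeasure (v := m) le_rfl
  have hgi : Integrable g m.variation := .of_bound hg.aestronglyMeasurable 1 (.of_forall hg1)
  have h0 := hW.ae_eq_zero_of_integral_contDiff_smul_eq_zero (μ := m.variation)
    (hgi.locallyIntegrable.locallyIntegrableOn W) fun ψ hψ hψc hψW => by
      obtain ⟨C, hC⟩ := hψ.continuous.bounded_above_of_compact_support hψc
      have hψi : Integrable ψ m.variation :=
        .of_bound hψ.continuous.aestronglyMeasurable C (.of_forall hC)
      have := h ψ hψ hψc hψW
      conv at this =>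
        enter [1, 1]
        rw [hm]
      rwa [integral_withDensityᵥ hg.aestronglyMeasurable (D := 1) hg1 _ hψi] at this
  rw [hm, withDensityᵥ_apply hgi hA]
  refine integral_eq_zero_of_ae ?_
  filter_upwards [ae_restrict_of_ae h0, ae_restrict_mem hA] with x hx hxA
  exact hx (hAW hxA)

theorem signedMeasure_apply_eq {E : Type*} [NormedAddCommGroup E] [NormedSpace ℝ E]
    [FiniteDimensional ℝ E] [MeasurableSpace E] [BorelSpace E] {m₁ m₂ : SignedMeasure E} {W : Set E}
    (hW : IsOpen W) (h : ∀ ψ : E → ℝ, ContDiff ℝ ∞ ψ → HasCompactSupport ψ → tsupport ψ ⊆ W →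
      ∫ᵛ x, ψ x ∂•m₁ = ∫ᵛ x, ψ x ∂•m₂) {A : Set E} (hA : MeasurableSet A) (hAW : A ⊆ W) :
    m₁ A = m₂ A := by
  rw [← sub_eq_zero, ← sub_apply]
  refine signedMeasure_apply_eq_zero hW (fun ψ hψ hψc hψW => ?_) hA hAW
  obtain ⟨C, hC⟩ := hψ.continuous.bounded_above_of_compact_support hψc
  have hψi : ∀ m : SignedMeasure E, m.Integrable ψ := fun m =>
    .of_bound hψ.continuous.aestronglyMeasurable C (.of_forall hC)
  rw [VectorMeasure.integral_sub_vectorMeasure (hψi _) (hψi _), h ψ hψ hψc hψW, sub_self]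

theorem IsMeasureOn.ext (hΩ : IsOpen Ω) {m₁ m₂ : SignedMeasure (Euc n)} (h₁ : IsMeasureOn Ω m₁)
    (h₂ : IsMeasureOn Ω m₂) (h : ∀ ψ : Euc n → ℝ, ContDiff ℝ ∞ ψ → HasCompactSupport ψ →
      tsupport ψ ⊆ Ω → ∫ᵛ x, ψ x ∂•m₁ = ∫ᵛ x, ψ x ∂•m₂) : m₁ = m₂ := by
  ext A hA
  rw [← inter_union_sdiff A Ω, VectorMeasure.of_union (disjoint_sdiff_inter.symm)
    (hA.inter hΩ.measurableSet) (hA.diff hΩ.measurableSet), VectorMeasure.of_union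
    (disjoint_sdiff_inter.symm) (hA.inter hΩ.measurableSet) (hA.diff hΩ.measurableSet),
    h₁ _ (hA.diff hΩ.measurableSet) disjoint_sdiff_left,
    h₂ _ (hA.diff hΩ.measurableSet) disjoint_sdiff_left,
    signedMeasure_apply_eq hΩ h (hA.inter hΩ.measurableSet) inter_subset_right]

theorem IsPairing.unique (hΩ : IsOpen Ω) {F : VectorMeasure (Euc n) (Euc n)} {φ : Euc n → ℝ}
    {m₁ m₂ : SignedMeasure (Euc n)} (h₁ : IsPairing Ω F φ m₁) (h₂ : IsPairing Ω F φ m₂) :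
    m₁ = m₂ := by
  obtain ⟨ρ, hρ⟩ := IsStandardMollifier.exists_isStandardMollifier (n := n)
  exact h₁.isMeasureOn.ext hΩ h₂.isMeasureOn fun ψ hψ hψc hψΩ =>
    tendsto_nhds_unique (h₁.tendsto ρ hρ ψ hψ.continuous hψc hψΩ)
      (h₂.tendsto ρ hρ ψ hψ.continuous hψc hψΩ)

theorem isPairing_pairing {F : VectorMeasure (Euc n) (Euc n)} {φ : Euc n → ℝ}
    {m : SignedMeasure (Euc n)} (h : IsPairing Ω F φ m) : IsPairing Ω F φ (pairing Ω F φ) := by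
  have hex : ∃ m, IsPairing Ω F φ m := ⟨m, h⟩
  rw [pairing, dif_pos hex]
  exact hex.choose_spec

theorem pairing_eq (hΩ : IsOpen Ω) {F : VectorMeasure (Euc n) (Euc n)} {φ : Euc n → ℝ}
    {m : SignedMeasure (Euc n)} (h : IsPairing Ω F φ m) : pairing Ω F φ = m :=
  (isPairing_pairing h).unique hΩ h

theorem isDivergence_divMeasure (hΩ : MeasurableSet Ω) {F : VectorMeasure (Euc n) (Euc n)}
    (hF : IsDMExt Ω F) : IsDivergence Ω F (divMeasure Ω F) := by
  have hex := exists_isDivergence hΩ hF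
  rw [divMeasure, dif_pos hex]
  exact hex.choose_spec

theorem variation_compl_eq_zero {V : Type*} [NormedAddCommGroup V]
    {v : VectorMeasure (Euc n) V} (hΩ : MeasurableSet Ω) (hv : IsMeasureOn Ω v) :
    v.variation Ωᶜ = 0 := by
  rw [VectorMeasure.variation_apply_eq_zero hΩ.compl]
  exact fun A hA hAm => hv A hAm (disjoint_compl_left.mono_left hA)

/-- The measure |F| + |div F| dominates both variations, so one scalar measure carries F and its
divergence with densities bounded by 1. -/
theorem exists_isDivData (hΩ : MeasurableSet Ω) {F : VectorMeasure (Euc n) (Euc n)}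
    (hF : IsDMExt Ω F) : ∃ (lam : Measure (Euc n)) (f : Euc n → Euc n) (s : Euc n → ℝ),
      IsDivData Ω lam f s ∧ F = lam.withDensityᵥ f ∧ divMeasure Ω F = lam.withDensityᵥ s := by
  have hdiv := isDivergence_divMeasure hΩ hF
  set σ := divMeasure Ω F with hσ
  set lam := F.variation + σ.variation with hlam
  have hle1 : F.variation ≤ lam := Measure.le_add_right le_rfl
  have hle2 : σ.variation ≤ lam := Measure.le_add_left le_rfl
  obtain ⟨f, hf, hf1, hFf⟩ := exists_density_euc hle1
  obtain ⟨s, hs, hs1, hσs⟩ := exists_density_signedMeasure hle2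
  refine ⟨lam, f, s, ⟨inferInstance, ?_, hf, hf1, hs, hs1, fun φ hφ => ?_⟩, hFf, hσs⟩
  · rw [hlam, Measure.add_apply, variation_compl_eq_zero hΩ hF.isMeasureOn,
      variation_compl_eq_zero hΩ hdiv.isMeasureOn, add_zero]
  · have h := hdiv.integral_eq φ hφ
    obtain ⟨g1, g2, C, hC⟩ := bddGradient_isTestC1 hφ
    have e1 : ∫ᵛ x, φ x ∂•σ = ∫ x, φ x * s x ∂lam := by
      rw [hσs]
      exact integral_withDensityᵥ hs.aestronglyMeasurable (D := 1) hs1 _ hφ.toCc.integrable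
    have e2 : ∫ᵛ x, ∇ φ x ∂[dot n; F] = ∫ x, inner ℝ (∇ φ x) (f x) ∂lam := by
      rw [hFf]
      exact integral_withDensityᵥ hf.aestronglyMeasurable (D := 1) hf1 (dot n)
        (.of_bound g1.aestronglyMeasurable C (.of_forall hC))
    rw [← e1, ← e2, h]

namespace IsDivData

variable {lam : Measure (Euc n)} {f : Euc n → Euc n} {s : Euc n → ℝ} (h : IsDivData Ω lam f s)
include h

theorem isMeasureOn_withDensityᵥ {V : Type*} [NormedAddCommGroup V] [NormedSpace ℝ V]
    {g : Euc n → V} (hg : Integrable g lam) : IsMeasureOn Ω (lam.withDensityᵥ g) := by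
  intro A hA hd
  rw [withDensityᵥ_apply hg hA, Measure.restrict_zero_set, integral_zero_measure]
  exact measure_mono_null hd.subset_compl_right h.measure_compl

theorem integral_signed {g b : Euc n → ℝ} (hg : Measurable g) {C : ℝ} (hC : ∀ x, |g x| ≤ C)
    (hb : Integrable b lam) :
    ∫ᵛ x, b x ∂•(lam.withDensityᵥ g) = ∫ x, b x * g x ∂lam := by
  have := h.isFiniteMeasure
  exact integral_withDensityᵥ hg.aestronglyMeasurable (D := C.toNNReal)
    (fun x => (hC x).trans (Real.le_coe_toNNReal C)) _ hb

theorem setIntegral_signed {g b : Euc n → ℝ} (hg : Measurable g) {C : ℝ} (hC : ∀ x, |g x| ≤ C)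
    {A : Set (Euc n)} (hA : MeasurableSet A) (hb : IntegrableOn b A lam) :
    ∫ᵛ x in A, b x ∂•(lam.withDensityᵥ g) = ∫ x in A, b x * g x ∂lam := by
  have := h.isFiniteMeasure
  exact setIntegral_withDensityᵥ hg.aestronglyMeasurable (D := C.toNNReal)
    (fun x => (hC x).trans (Real.le_coe_toNNReal C)) _ hA hb

theorem integral_field {v : Euc n → Euc n} (hv : Integrable v lam) :
    ∫ᵛ x, v x ∂[dot n; lam.withDensityᵥ f] = ∫ x, inner ℝ (v x) (f x) ∂lam := by
  have := h.isFiniteMeasure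
  exact integral_withDensityᵥ h.measurable_field.aestronglyMeasurable (D := 1)
    h.norm_field_le (dot n) hv

theorem setIntegral_field {v : Euc n → Euc n} {A : Set (Euc n)} (hA : MeasurableSet A)
    (hv : IntegrableOn v A lam) :
    ∫ᵛ x in A, v x ∂[dot n; lam.withDensityᵥ f] = ∫ x in A, inner ℝ (v x) (f x) ∂lam := by
  have := h.isFiniteMeasure
  exact setIntegral_withDensityᵥ h.measurable_field.aestronglyMeasurable (D := 1)
    h.norm_field_le (dot n) hA hv

theorem isPairing (hΩ : IsOpen Ω) {φ p : Euc n → ℝ} (hφc : ContinuousOn φ Ω) {C : ℝ} (hC : 0 ≤ C)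
    (hg : ∀ ρ, IsStandardMollifier ρ → IsC1Approx Ω φ (fun δ => mollify Ω ρ δ φ) C)
    (hp : IsPairingDensity Ω lam f s φ p) :
    IsPairing Ω (lam.withDensityᵥ f) φ (lam.withDensityᵥ p) := by
  have := h.isFiniteMeasure
  obtain ⟨D, -, hD⟩ := hp.bounded
  refine ⟨h.isMeasureOn_withDensityᵥ (h.integrable_of_bounded hp.measurable hD),
    fun ρ hρ ψ hψ hψc hψΩ => ?_⟩
  have hψi := h.integrable_continuous hψ hψc
  rw [h.integral_signed hp.measurable hD hψi]
  refine (h.tendsto_integral_mul_gradient hΩ hC hφc (hg ρ hρ) hp hψc hψΩ hψi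
    fun x hx => image_eq_zero_of_notMem_tsupport hx).congr' ?_
  filter_upwards [(hg ρ hρ).contDiff] with δ hδ
  have hv : Continuous fun x => ψ x • ∇ (mollify Ω ρ δ φ) x := hψ.smul (continuous_gradient hδ)
  obtain ⟨B, hB⟩ := hv.bounded_above_of_compact_support hψc.smul_right
  rw [h.integral_field (.of_bound hv.aestronglyMeasurable B (.of_forall hB))]
  simp only [inner_smul_left, conj_trivial]

end IsDivData

end DMField

/-! ### The chain rule for functions of the distance to the boundary -/

namespace DMField


variable {n : ℕ} {Ω U : Set (Euc n)} {lam : Measure (Euc n)} {f : Euc n → Euc n} {s : Euc n → ℝ}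

theorem lipschitzWith_bdryDist (U : Set (Euc n)) : LipschitzWith 1 (bdryDist U) :=
  Metric.lipschitz_infDist_pt _

theorem measurable_bdryDist (U : Set (Euc n)) : Measurable (bdryDist U) :=
  (lipschitzWith_bdryDist U).continuous.measurable

theorem bdryDist_nonneg (U : Set (Euc n)) (x : Euc n) : 0 ≤ bdryDist U x := Metric.infDist_nonneg

theorem isCompact_le_bdryDist (hUc : IsCompact (closure U)) (ε : ℝ) :
    IsCompact {x | x ∈ closure U ∧ ε ≤ bdryDist U x} :=
  hUc.inter_right (isClosed_le continuous_const (lipschitzWith_bdryDist U).continuous)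

theorem le_bdryDist_subset (hU : IsOpen U) {ε : ℝ} (hε : 0 < ε) :
    {x | x ∈ closure U ∧ ε ≤ bdryDist U x} ⊆ U := fun x hx => by
  by_contra h
  have h1 : x ∈ frontier U := by rw [hU.frontier_eq]; exact ⟨hx.1, h⟩
  have h2 : bdryDist U x = 0 := Metric.infDist_zero_of_mem h1
  linarith [hx.2]

theorem gradient_comp {H : ℝ → ℝ} {g : Euc n → ℝ} {x : Euc n} {a : ℝ} (hH : HasDerivAt H a (g x))
    (hg : DifferentiableAt ℝ g x) : ∇ (fun y => H (g y)) x = a • ∇ g x := by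
  simp only [gradient]
  have := hH.comp_hasFDerivAt x hg.hasFDerivAt
  rw [show (fun y => H (g y)) = H ∘ g from rfl, this.fderiv, map_smul]

/-- The chain rule for the pairing, tested with a function of the distance to the boundary. -/
theorem IsDivData.setIntegral_comp_bdryDist (h : IsDivData Ω lam f s) (hΩ : IsOpen Ω)
    (hU : IsOpen U) (hUc : IsCompact (closure U)) (hUΩ : closure U ⊆ Ω) {g : ℝ → Euc n → ℝ} {C : ℝ}
    (hC : 0 ≤ C) (hg : IsC1Approx Ω (bdryDist U) g C) {q φ p : Euc n → ℝ}
    (hq : IsPairingDensity Ω lam f s (bdryDist U) q) (hφ : Measurable φ) (hφc : ContinuousOn φ Ω)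
    (hp : IsPairingDensity Ω lam f s φ p) {H η : ℝ → ℝ} (hH : ∀ t, HasDerivAt H (η t) t)
    (hη : Continuous η) (hηs : HasCompactSupport η) {ε : ℝ} (hε : 0 < ε)
    (hH0 : ∀ t ≤ ε, H t = 0) :
    ∫ x in U, H (bdryDist U x) * p x ∂lam =
      -(∫ x in U, φ x * η (bdryDist U x) * q x ∂lam) -
        ∫ x in U, H (bdryDist U x) * (φ x * s x) ∂lam := by
  have := h.isFiniteMeasure
  set d := bdryDist U with hd
  have hdc : Continuous d := (lipschitzWith_bdryDist U).continuous
  have hHc : Continuous H := continuous_iff_continuousAt.2 fun t => (hH t).continuousAt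
  have hHd : deriv H = η := funext fun t => (hH t).deriv
  have hH1 : ContDiff ℝ 1 H := contDiff_one_iff_deriv.2
    ⟨fun t => (hH t).differentiableAt, hHd ▸ hη⟩
  have hη0 : ∀ t < ε, η t = 0 := fun t ht => by
    rw [← hHd]
    have : H =ᶠ[𝓝 t] fun _ => 0 := by
      filter_upwards [Iio_mem_nhds ht] with y hy using hH0 y (le_of_lt hy)
    rw [this.deriv_eq, deriv_const]
  obtain ⟨D, hD⟩ := hη.bounded_above_of_compact_support hηs
  have hηu : UniformContinuous η := hηs.uniformContinuous_of_continuous hη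
  have hHu : UniformContinuous H := by
    have : LipschitzWith (Real.toNNReal D) H :=
      lipschitzWith_of_nnnorm_deriv_le (fun t => (hH t).differentiableAt) fun t => by
        rw [hHd, ← norm_toNNReal]
        exact Real.toNNReal_le_toNNReal (hD t)
    exact this.uniformContinuous
  have hKU := le_bdryDist_subset (U := U) hU (half_pos hε)
  -- The cutoff is 1 near {d ≥ ε/2} rather than {d ≥ ε}: the margin ε/2 absorbs the distance between
  -- g δ and d.
  obtain ⟨χ, -, hχ, hχ1, hχ01⟩ := exists_isTestC1_cutoff hU (isCompact_le_bdryDist hUc (ε / 2)) hKU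
  have hTU : tsupport χ ⊆ U := hχ.tsupport_subset
  have hUΩ' : U ⊆ Ω := subset_closure.trans hUΩ
  have hTΩ : tsupport χ ⊆ Ω := hTU.trans hUΩ'
  have hT : IsCompact (tsupport χ) := hχ.hasCompactSupport
  have hχi : Integrable χ lam := h.integrable_continuous hχ.contDiff.continuous hT
  obtain ⟨M, hM0, hM⟩ := ContinuousOn.exists_abs_le hT (hφc.mono hTΩ)
  have hχ0 : ∀ x ∉ tsupport χ, χ x = 0 := fun x hx => image_eq_zero_of_notMem_tsupport hx
  have iφχ : Integrable (fun x => φ x * χ x) lam := integrable_mul_of_support hφ hM hχi hχ0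
  obtain ⟨Cp, hCp0, hCp⟩ := hp.bounded
  have iχp : Integrable (fun x => χ x * p x) lam := integrable_mul_of_bounded hχi hp.measurable hCp
  have iφχs : Integrable (fun x => φ x * χ x * s x) lam :=
    integrable_mul_of_bounded iφχ h.measurable_div h.abs_div_le
  have hgu := hg.tendsto _ hT hTΩ
  obtain ⟨MH, -, hMH⟩ := ContinuousOn.exists_abs_le hT (hHc.comp hdc).continuousOn
  have tH : TendstoUniformlyOn (fun δ x => H (g δ x)) (fun x => H (d x)) (𝓝[>] 0) (tsupport χ) :=
    hHu.comp_tendstoUniformlyOn hgu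
  have tη : TendstoUniformlyOn (fun δ x => η (g δ x)) (fun x => η (d x)) (𝓝[>] 0) (tsupport χ) :=
    hηu.comp_tendstoUniformlyOn hgu
  have mH : ∀ᶠ δ in 𝓝[>] (0 : ℝ), AEStronglyMeasurable (fun x => H (g δ x)) lam :=
    hg.contDiff.mono fun δ hδ => (hHc.comp hδ.continuous).aestronglyMeasurable
  have t1 := tendsto_integral_mul_of_tendstoUniformlyOn mH tH hMH iχp fun x hx => by
    rw [hχ0 x hx, zero_mul]
  have t2 := tendsto_integral_mul_of_tendstoUniformlyOn mH tH hMH iφχs fun x hx => by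
    rw [hχ0 x hx, mul_zero, zero_mul]
  have iφχη : Integrable (fun x => φ x * χ x * η (d x)) lam :=
    integrable_mul_of_bounded iφχ (hη.comp hdc).measurable fun x => hD (d x)
  have t3 := h.tendsto_integral_mul_gradient hΩ hC hdc.continuousOn hg hq hT hTΩ iφχη
    fun x hx => by rw [hχ0 x hx, mul_zero, zero_mul]
  have tη' : TendstoUniformlyOn (fun δ x => |η (g δ x) - η (d x)|) (fun _ => 0) (𝓝[>] 0)
      (tsupport χ) := by
    rw [Metric.tendstoUniformlyOn_iff] at tη ⊢
    intro e he
    filter_upwards [tη e he] with δ hδ x hx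
    have := hδ x hx
    rwa [dist_comm, Real.dist_eq, sub_zero, abs_abs, ← Real.dist_eq, dist_comm]
  have t4 := (tendsto_integral_mul_of_tendstoUniformlyOn (M := 0)
    (hg.contDiff.mono fun δ hδ => ((hη.comp hδ.continuous).sub
      (hη.comp hdc)).abs.aestronglyMeasurable) tη' (fun x _ => by simp) iφχ.abs fun x hx => by
        rw [hχ0 x hx, mul_zero, abs_zero]).const_mul C
  simp only [zero_mul, integral_zero, mul_zero] at t4
  -- The argument of η also depends on δ. Freezing it at d costs a term that tends to 0, because η
  -- (g δ) → η (d) uniformly on the support of χ while the gradients stay bounded.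
  have t5 : Tendsto (fun δ => ∫ x, φ x * χ x * (η (g δ x) - η (d x)) * inner ℝ (∇ (g δ) x) (f x) ∂lam)
      (𝓝[>] 0) (𝓝 0) := by
    refine squeeze_zero_norm' ?_ t4
    filter_upwards [hg.contDiff, hg.bound _ hT hTΩ] with δ h1 h2
    have hb : ∀ x, |η (g δ x) - η (d x)| ≤ D + D := fun x =>
      (abs_sub _ _).trans (add_le_add (hD _) (hD _))
    have := (h.abs_integral_mul_gradient_le (ψ := fun x => φ x * χ x * (η (g δ x) - η (d x))) h1
      (integrable_mul_of_bounded iφχ ((hη.comp h1.continuous).sub (hη.comp hdc)).measurable hb)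
      (C := C) fun x hx => h2 x (by
        by_contra h3; exact hx (by rw [hχ0 x h3, mul_zero, zero_mul]))).2
    refine this.trans_eq ?_
    congr 2; ext x; rw [abs_mul, mul_comm]; rfl
  -- This is the defining identity of p tested with the C¹ function χ H(g δ).
  have key : ∀ᶠ δ in 𝓝[>] (0 : ℝ), ∫ x, H (g δ x) * (χ x * p x) ∂lam =
      -((∫ x, φ x * χ x * η (d x) * inner ℝ (∇ (g δ) x) (f x) ∂lam) +
        ∫ x, φ x * χ x * (η (g δ x) - η (d x)) * inner ℝ (∇ (g δ) x) (f x) ∂lam) -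
      ∫ x, H (g δ x) * (φ x * χ x * s x) ∂lam := by
    filter_upwards [hg.contDiff, hg.bound _ hT hTΩ,
      Metric.tendstoUniformlyOn_iff.1 hgu (ε / 2) (half_pos hε)] with δ h1 h2 h3
    have hb : ∀ x, |η (g δ x) - η (d x)| ≤ D + D := fun x =>
      (abs_sub _ _).trans (add_le_add (hD _) (hD _))
    have i1 := (h.abs_integral_mul_gradient_le (ψ := fun x => φ x * χ x * (η (g δ x) - η (d x))) h1
      (integrable_mul_of_bounded iφχ ((hη.comp h1.continuous).sub (hη.comp hdc)).measurable hb)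
      (C := C) fun x hx => h2 x (by
        by_contra h3; exact hx (by rw [hχ0 x h3, mul_zero, zero_mul]))).1
    have i2 := (h.abs_integral_mul_gradient_le (ψ := fun x => φ x * χ x * η (d x)) h1
      iφχη (C := C) fun x hx => h2 x (by
        by_contra h3; exact hx (by rw [hχ0 x h3, mul_zero, zero_mul]))).1
    have ht : IsTestC1 Ω (fun x => χ x * H (g δ x)) :=
      ⟨hχ.contDiff.mul (hH1.comp h1), hχ.hasCompactSupport.mul_right, tsupport_mul_subset_left.trans hTΩ⟩
    have hgrad : ∀ x, φ x * inner ℝ (∇ (fun x => χ x * H (g δ x)) x) (f x) =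
        φ x * χ x * η (d x) * inner ℝ (∇ (g δ) x) (f x) +
        φ x * χ x * (η (g δ x) - η (d x)) * inner ℝ (∇ (g δ) x) (f x) := fun x => by
      -- Either d ≥ ε/2, where χ is locally constant, or d < ε/2, where g δ < ε on the support of χ
      -- and H vanishes.
      have hz : H (g δ x) • ∇ χ x = 0 := by
        by_cases hx : x ∈ tsupport χ
        · by_cases hx2 : ε / 2 ≤ d x
          · have : χ =ᶠ[𝓝 x] fun _ => 1 :=
              (eventually_nhdsSet_iff_forall.1 hχ1) x ⟨subset_closure (hTU hx), hx2⟩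
            simp only [gradient]
            rw [this.fderiv_eq, fderiv_fun_const]
            simp
          · have h4 := h3 x hx
            rw [Real.dist_eq, abs_lt] at h4
            rw [hH0 _ (by linarith), zero_smul]
        · rw [gradient_eq_zero_of_notMem_tsupport hx, smul_zero]
      rw [gradient_mul (ψ := fun y => H (g δ y)) (hχ.contDiff.differentiable one_ne_zero x)
        ((hH1.comp h1).differentiable one_ne_zero x), hz, add_zero,
        gradient_comp (hH _) (h1.differentiable one_ne_zero x), smul_smul, inner_smul_left]
      simp only [conj_trivial]
      ring
    have h5 := hp.integral_eq _ ht
    rw [integral_congr_ae (.of_forall hgrad), integral_add i2 i1] at h5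
    convert h5 using 2
    · ext x; ring
    · congr 1; ext x; ring
  have hlim := tendsto_nhds_unique t1 (((t3.add t5).neg.sub t2).congr' (key.mono fun δ hδ => hδ.symm))
  -- Both H and η vanish below ε, so composed with d they do not distinguish χ from the indicator of
  -- U.
  have hχU : ∀ x, ∀ a : ℝ → ℝ, (∀ t < ε, a t = 0) →
      χ x * a (d x) = U.indicator (fun x => a (d x)) x := fun x a ha => by
    by_cases hx : x ∈ U
    · rw [indicator_of_mem hx]
      by_cases hx2 : ε / 2 ≤ d x
      · rw [hχ1.self_of_nhdsSet x ⟨subset_closure hx, hx2⟩, one_mul]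
      · rw [ha _ (by linarith), mul_zero]
    · rw [indicator_of_notMem hx, hχ0 x fun h => hx (hTU h), zero_mul]
  have e1 : ∀ b : Euc n → ℝ, ∀ a : ℝ → ℝ, (∀ t < ε, a t = 0) →
      ∫ x in U, a (d x) * b x ∂lam = ∫ x, χ x * a (d x) * b x ∂lam := fun b a ha => by
    rw [← integral_indicator hU.measurableSet]
    congr 1; ext x
    rw [hχU x a ha]
    by_cases hx : x ∈ U <;> simp [hx]
  have hH0' : ∀ t < ε, H t = 0 := fun t ht => hH0 t ht.le
  have e2 := e1 p H hH0'
  have e3 := e1 (fun x => φ x * s x) H hH0'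
  have e4 := e1 (fun x => φ x * q x) η hη0
  rw [e2, e3]
  rw [show ∫ x in U, φ x * η (d x) * q x ∂lam = ∫ x in U, η (d x) * (φ x * q x) ∂lam by
    congr 1; ext x; ring, e4]
  convert hlim using 2
  · ext x; ring
  · rw [add_zero]; congr 2; ext x; ring
  · congr 1; ext x; ring

end DMField

/-! ### The layer cake formula and the coarea formula -/

namespace DMField


variable {n : ℕ} {Ω U : Set (Euc n)} {lam : Measure (Euc n)} {f : Euc n → Euc n} {s : Euc n → ℝ}

section Superlevel

variable {X : Type*} {mX : MeasurableSpace X} {μ : Measure X} {d w : X → ℝ}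

theorem measurableSet_superlevel (hd : Measurable d) :
    MeasurableSet {z : ℝ × X | z.1 < d z.2} :=
  measurableSet_lt measurable_fst (hd.comp measurable_snd)

theorem setIntegral_superlevel_eq (hd : Measurable d) (t : ℝ) :
    ∫ x in {x | t < d x}, w x ∂μ = ∫ x, {z : ℝ × X | z.1 < d z.2}.indicator (fun z => w z.2) (t, x) ∂μ := by
  rw [← integral_indicator (measurableSet_lt measurable_const hd)]
  rfl

theorem stronglyMeasurable_setIntegral_superlevel [SFinite μ] (hd : Measurable d) (hw : StronglyMeasurable w) :
    StronglyMeasurable fun t : ℝ => ∫ x in {x | t < d x}, w x ∂μ := by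
  simp_rw [setIntegral_superlevel_eq hd]
  exact StronglyMeasurable.integral_prod_right
    (f := fun t x => {z : ℝ × X | z.1 < d z.2}.indicator (fun z => w z.2) (t, x))
    ((hw.comp_measurable measurable_snd).indicator (measurableSet_superlevel hd))

theorem norm_setIntegral_superlevel_le (hw : Integrable w μ) (t : ℝ) :
    ‖∫ x in {x | t < d x}, w x ∂μ‖ ≤ ∫ x, ‖w x‖ ∂μ :=
  (norm_integral_le_integral_norm _).trans
    (setIntegral_le_integral hw.norm (.of_forall fun x => norm_nonneg (w x)))

theorem setIntegral_superlevel_eq_zero {R : ℝ} (hR : ∀ᵐ x ∂μ, d x ≤ R) {t : ℝ} (ht : R ≤ t) :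
    ∫ x in {x | t < d x}, w x ∂μ = 0 := by
  refine setIntegral_measure_zero _ (measure_mono_null (fun x hx => ?_) hR)
  exact not_le.2 (ht.trans_lt hx)

/-- The layer cake formula for signed functions. -/
theorem integral_mul_setIntegral_superlevel [SFinite μ] (hd : Measurable d) (hd0 : ∀ x, 0 ≤ d x)
    (hw : Integrable w μ) {η : ℝ → ℝ} (hη : IntegrableOn η (Ioi 0)) :
    ∫ t in Ioi (0 : ℝ), η t * ∫ x in {x | t < d x}, w x ∂μ =
      ∫ x, (∫ t in 0..d x, η t) * w x ∂μ := by
  have hi : Integrable (fun z : ℝ × X => {z : ℝ × X | z.1 < d z.2}.indicator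
      (fun z => η z.1 * w z.2) z) ((volume.restrict (Ioi 0)).prod μ) :=
    (Integrable.mul_prod hη hw).indicator (measurableSet_superlevel hd)
  have := integral_integral_swap (f := fun t x => {z : ℝ × X | z.1 < d z.2}.indicator
      (fun z => η z.1 * w z.2) (t, x)) hi
  calc _ = ∫ t in Ioi (0 : ℝ), ∫ x, {z : ℝ × X | z.1 < d z.2}.indicator
        (fun z => η z.1 * w z.2) (t, x) ∂μ := by
        congr 1; ext t
        rw [setIntegral_superlevel_eq hd, ← integral_const_mul]
        congr 1; ext x
        by_cases h : t < d x <;> simp [indicator, h]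
    _ = _ := by
        rw [this]
        congr 1; ext x
        rw [intervalIntegral.integral_of_le (hd0 x), integral_Ioc_eq_integral_Ioo,
          ← Ioi_inter_Iio, inter_comm, ← Measure.restrict_restrict measurableSet_Iio,
          ← integral_indicator measurableSet_Iio, ← integral_mul_const]
        congr 1; ext t
        by_cases h : t < d x <;> simp [indicator, h]

end Superlevel

theorem measurableSet_innerSet (hU : IsOpen U) (t : ℝ) : MeasurableSet (innerSet U t) :=
  hU.measurableSet.inter (measurableSet_lt measurable_const (measurable_bdryDist U))

theorem setIntegral_innerSet (lam : Measure (Euc n)) (t : ℝ) (w : Euc n → ℝ) :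
    ∫ x in innerSet U t, w x ∂lam = ∫ x in {x | t < bdryDist U x}, w x ∂(lam.restrict U) := by
  rw [Measure.restrict_restrict (measurableSet_lt measurable_const (measurable_bdryDist U)),
    inter_comm]
  rfl

theorem exists_bdryDist_le (hUc : IsCompact (closure U)) : ∃ R, 0 ≤ R ∧ ∀ x ∈ U, bdryDist U x ≤ R := by
  obtain ⟨R, h0, hR⟩ := ContinuousOn.exists_abs_le hUc (lipschitzWith_bdryDist U).continuous.continuousOn
  exact ⟨R, h0, fun x hx => (le_abs_self _).trans (hR x (subset_closure hx))⟩

/-- `Metric.infDist` to the empty set is 0, so the frontier must be shown nonempty: U is nonempty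
and has compact closure in the noncompact space ℝⁿ. The bound on n serves only to make ℝⁿ
noncompact. -/
theorem bdryDist_pos (hn : 2 ≤ n) (hU : IsOpen U) (hUc : IsCompact (closure U)) {x : Euc n}
    (hx : x ∈ U) : 0 < bdryDist U x := by
  have : Nonempty (Fin n) := ⟨⟨0, by omega⟩⟩
  have hne : (frontier U).Nonempty := by
    rw [nonempty_frontier_iff]
    refine ⟨⟨x, hx⟩, fun h => ?_⟩
    rw [h, closure_univ] at hUc
    exact noncompact_univ (Euc n) hUc
  refine (Metric.infDist_nonneg).lt_of_ne' fun h => ?_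
  have h2 := (isClosed_frontier.mem_iff_infDist_zero hne).2 h
  rw [hU.frontier_eq] at h2
  exact h2.2 hx

namespace IsDivData

theorem integrableOn_trace (h : IsDivData Ω lam f s) (hUc : IsCompact (closure U))
    (hUΩ : closure U ⊆ Ω) (hU : IsOpen U) {φ p : Euc n → ℝ} (hφ : Measurable φ)
    (hφc : ContinuousOn φ Ω) (hp : IsPairingDensity Ω lam f s φ p) :
    IntegrableOn (fun x => φ x * s x) U lam ∧ IntegrableOn p U lam := by
  have := h.isFiniteMeasure
  obtain ⟨M, hM0, hM⟩ := ContinuousOn.exists_abs_le hUc (hφc.mono hUΩ)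
  obtain ⟨C, hC0, hC⟩ := hp.bounded
  refine ⟨.of_bound (measure_lt_top _ _) (hφ.mul h.measurable_div).aestronglyMeasurable M
    (ae_restrict_of_forall_mem hU.measurableSet fun x hx => ?_),
    (h.integrable_of_bounded hp.measurable hC).integrableOn⟩
  rw [Real.norm_eq_abs, abs_mul]
  exact (mul_le_of_le_one_right (abs_nonneg _) (h.abs_div_le x)).trans (hM x (subset_closure hx))

/-- The coarea formula, localized to a set of levels. -/
theorem coarea (h : IsDivData Ω lam f s) (hΩ : IsOpen Ω)
    (hU : IsOpen U) (hUc : IsCompact (closure U)) (hUΩ : closure U ⊆ Ω) {g : ℝ → Euc n → ℝ} {C : ℝ}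
    (hC : 0 ≤ C) (hg : IsC1Approx Ω (bdryDist U) g C) {q φ p : Euc n → ℝ}
    (hq : IsPairingDensity Ω lam f s (bdryDist U) q) (hφ : Measurable φ) (hφc : ContinuousOn φ Ω)
    (hp : IsPairingDensity Ω lam f s φ p) :
    IntegrableOn (fun t => -∫ x in innerSet U t, (φ x * s x + p x) ∂lam) (Ioi 0) ∧
    ∀ A : Set ℝ, MeasurableSet A → A ⊆ Ioi 0 →
      ∫ t in A, (-∫ x in innerSet U t, (φ x * s x + p x) ∂lam) =
        ∫ x in U ∩ bdryDist U ⁻¹' A, φ x * q x ∂lam := by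
  have := h.isFiniteMeasure
  obtain ⟨R, hR0, hR⟩ := exists_bdryDist_le hUc
  obtain ⟨i1, i2⟩ := h.integrableOn_trace hUc hUΩ hU hφ hφc hp
  have hw : IntegrableOn (fun x => φ x * s x + p x) U lam := i1.add i2
  have hdm := measurable_bdryDist U
  have hR' : ∀ᵐ x ∂(lam.restrict U), bdryDist U x ≤ R := ae_restrict_of_forall_mem hU.measurableSet hR
  set T : ℝ → ℝ := fun t => -∫ x in innerSet U t, (φ x * s x + p x) ∂lam with hT
  have hTe : ∀ t, T t = -∫ x in {x | t < bdryDist U x}, (φ x * s x + p x) ∂(lam.restrict U) :=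
    fun t => congrArg Neg.neg (setIntegral_innerSet lam t _)
  have hTm : StronglyMeasurable T := by
    rw [funext hTe]
    exact (stronglyMeasurable_setIntegral_superlevel hdm
      ((hφ.mul h.measurable_div).add hp.measurable).stronglyMeasurable).neg
  set B := ∫ x in U, ‖φ x * s x + p x‖ ∂lam with hB
  have hTb : ∀ t, ‖T t‖ ≤ B := fun t => by
    rw [hTe, norm_neg]; exact norm_setIntegral_superlevel_le hw t
  have hT0 : ∀ t, R ≤ t → T t = 0 := fun t ht => by
    rw [hTe, setIntegral_superlevel_eq_zero hR' ht, neg_zero]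
  have hTi : IntegrableOn T (Ioi 0) := by
    rw [← Ioc_union_Ioi_eq_Ioi hR0]
    refine IntegrableOn.union (.of_bound (by simp) hTm.aestronglyMeasurable B (.of_forall hTb)) ?_
    exact integrableOn_zero.congr_fun (fun t ht => (hT0 t (le_of_lt ht)).symm) measurableSet_Ioi
  refine ⟨hTi, fun A hA hA0 => ?_⟩
  obtain ⟨M, hM0, hM⟩ := ContinuousOn.exists_abs_le hUc (hφc.mono hUΩ)
  obtain ⟨Cq, hCq0, hCq⟩ := hq.bounded
  set b : Euc n → ℝ := U.indicator fun x => φ x * q x with hb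
  have hbm : Measurable b := (hφ.mul hq.measurable).indicator hU.measurableSet
  have hbb : ∀ x, |b x| ≤ M * Cq := fun x => by
    by_cases hx : x ∈ U
    · rw [hb, indicator_of_mem hx, abs_mul]
      exact mul_le_mul (hM x (subset_closure hx)) (hCq x) (abs_nonneg _) hM0
    · rw [hb, indicator_of_notMem hx, abs_zero]; positivity
  have hbi : Integrable b lam := h.integrable_of_bounded hbm hbb
  have hTi' : Integrable T (volume.restrict (Ioc 0 R)) := hTi.mono_set Ioc_subset_Ioi_self
  -- The trace T(t) dt and the image of b lam under d are compared as signed measures on the line,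
  -- by testing with smooth η supported in (0,∞). Cutting the levels at R makes the Lebesgue measure
  -- finite and loses nothing, since T vanishes beyond R.
  have hsm := signedMeasure_apply_eq (m₁ := (volume.restrict (Ioc 0 R)).withDensityᵥ T)
    (m₂ := (lam.withDensityᵥ b).map (bdryDist U)) (W := Ioi 0) isOpen_Ioi
    (fun η hη hηc hη0 => by
      obtain ⟨D, hD⟩ := hη.continuous.bounded_above_of_compact_support hηc
      have hηi : Integrable η := hη.continuous.integrable_of_hasCompactSupport hηc
      rw [integral_withDensityᵥ hTm.aestronglyMeasurable (D := B.toNNReal)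
          (fun t => (hTb t).trans (Real.le_coe_toNNReal B)) _ hηi.restrict,
        VectorMeasure.integral_map hdm hη.continuous.aestronglyMeasurable
          (.of_bound (hη.continuous.measurable.comp hdm).aestronglyMeasurable D
            (.of_forall fun x => hD _)), h.integral_signed (b := fun x => η (bdryDist U x)) hbm hbb
            (h.integrable_of_bounded (hη.continuous.measurable.comp hdm) fun x => hD _)]
      have e1 : ∫ t in Ioc 0 R, η t * T t = ∫ t in Ioi (0 : ℝ), η t * T t := by
        refine (setIntegral_eq_of_subset_of_forall_sdiff_eq_zero measurableSet_Ioi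
          Ioc_subset_Ioi_self fun t ht => ?_).symm
        rw [hT0 t (not_lt.1 fun hlt => ht.2 ⟨ht.1, hlt.le⟩), mul_zero]
      refine e1.trans ?_
      set H : ℝ → ℝ := fun u => ∫ t in 0..u, η t with hH
      -- H is the primitive of η from 0, so the layer cake formula and the chain rule contain the
      -- same integral of H(d).
      have hHd : ∀ t, HasDerivAt H (η t) t := fun t =>
        intervalIntegral.integral_hasDerivAt_right hηi.intervalIntegrable
          (hη.continuous.stronglyMeasurableAtFilter _ _) hη.continuous.continuousAt
      obtain ⟨ε, hε, hε'⟩ : ∃ ε > 0, ∀ t ≤ ε, H t = 0 := by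
        have h0 : (tsupport η)ᶜ ∈ 𝓝 (0 : ℝ) := (isClosed_tsupport η).isOpen_compl.mem_nhds
          fun hh => lt_irrefl (0 : ℝ) (hη0 hh)
        obtain ⟨ε, hε, hεs⟩ := Metric.mem_nhds_iff.1 h0
        -- Half the radius keeps the points y ≤ ε/2 strictly inside the open ball that misses the
        -- support of η.
        refine ⟨ε / 2, half_pos hε, fun t ht => ?_⟩
        rw [hH]
        refine intervalIntegral.integral_zero_ae (.of_forall fun y hy => ?_)
        by_contra hy0
        have hyt : y ∈ tsupport η := subset_tsupport _ hy0
        have hy1 : 0 < y := hη0 hyt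
        have hy2 : y ≤ ε / 2 := (hy.2.trans (max_le (half_pos hε).le ht))
        refine hεs ?_ hyt
        rw [Metric.mem_ball, dist_zero_right, Real.norm_of_nonneg hy1.le]
        linarith
      have hk := h.setIntegral_comp_bdryDist hΩ hU hUc hUΩ hC hg hq hφ hφc hp hHd hη.continuous hηc hε hε'
      have hl := integral_mul_setIntegral_superlevel hdm (bdryDist_nonneg U) hw hηi.integrableOn
      have hHc : Continuous H := continuous_iff_continuousAt.2 fun t => (hHd t).continuousAt
      have hHb : ∀ x, |H (bdryDist U x)| ≤ ∫ t, ‖η t‖ := fun x =>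
        intervalIntegral.norm_integral_le_integral_norm_uIoc.trans
          (setIntegral_le_integral hηi.norm (.of_forall fun t => norm_nonneg _))
      have hHi : ∀ a : Euc n → ℝ, IntegrableOn a U lam →
          IntegrableOn (fun x => H (bdryDist U x) * a x) U lam := fun a ha =>
        ha.bdd_mul (hHc.measurable.comp hdm).aestronglyMeasurable (.of_forall hHb)
      have e2 : ∀ t, η t * T t = -(η t *
          ∫ x in {x | t < bdryDist U x}, (φ x * s x + p x) ∂(lam.restrict U)) := fun t => by
        rw [hTe, mul_neg]
      simp_rw [e2]
      rw [integral_neg, hl]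
      have e3 : ∫ x in U, H (bdryDist U x) * (φ x * s x + p x) ∂lam =
          -∫ x in U, φ x * η (bdryDist U x) * q x ∂lam := by
        simp_rw [mul_add]
        rw [integral_add (hHi _ i1) (hHi _ i2), hk]
        ring
      rw [e3, neg_neg, ← integral_indicator hU.measurableSet]
      congr 1; ext x
      by_cases hx : x ∈ U
      · simp [hb, hx]; ring
      · simp [hb, hx]) hA hA0
  rw [withDensityᵥ_apply hTi' hA, VectorMeasure.map_apply _ hdm hA,
    withDensityᵥ_apply hbi (hdm hA), Measure.restrict_restrict hA,
    setIntegral_indicator hU.measurableSet, inter_comm _ U] at hsm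
  rw [← hsm]
  refine setIntegral_eq_of_subset_of_forall_sdiff_eq_zero hA inter_subset_left fun t ht => hT0 t ?_
  by_contra hlt
  exact ht.2 ⟨ht.1, hA0 ht.1, (not_le.1 hlt).le⟩

end IsDivData

end DMField

/-! ### Disintegration along level sets; absence of a singular part -/

namespace DMField


open ProbabilityTheory

section Disintegration

variable {X : Type*} {mX : MeasurableSpace X}

theorem apply_eq_zero_of_variation {V : Type*} [NormedAddCommGroup V] {v : VectorMeasure X V}
    {A N : Set X} (hN : v.variation N = 0) (hA : A ⊆ N) : v A = 0 := by
  have h := (VectorMeasure.enorm_measure_le_variation v A).trans_eq (measure_mono_null hA hN)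
  simpa using h

theorem integral_withDensityᵥ_of_abs_le_one {P : Measure X} [IsFiniteMeasure P] {σ φ : X → ℝ}
    (hσ : Measurable σ) (h1 : ∀ x, |σ x| ≤ 1) (hφ : Integrable φ P) :
    ∫ᵛ x, φ x ∂•(P.withDensityᵥ σ) = ∫ x, φ x * σ x ∂P :=
  integral_withDensityᵥ hσ.aestronglyMeasurable (D := 1) h1 _ hφ

/-- Disintegration of the signed measure `q μ` along the level sets of `d`. -/
theorem exists_kernel_disintegration [StandardBorelSpace X] [Nonempty X] {μ : Measure X}
    [IsFiniteMeasure μ] {d q : X → ℝ} (hd : Measurable d) (hq : Measurable q) {C : ℝ}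
    (hC : ∀ x, |q x| ≤ C) {V : Set X} (hV : MeasurableSet V) (hμV : μ Vᶜ = 0) :
    ∃ (τ : Measure ℝ) (K : Kernel ℝ X) (σ : X → ℝ), IsFiniteMeasure τ ∧ IsMarkovKernel K ∧
      Measurable σ ∧ (∀ x, |σ x| = 1) ∧ τ = (μ.withDensity fun x => ‖q x‖ₑ).map d ∧
      (∀ᵐ t ∂τ, K t {x | ¬ (x ∈ V ∧ d x = t)} = 0) ∧
      ∀ φ : X → ℝ, Measurable φ → (∃ B : ℝ, ∀ x, |φ x| ≤ B) →
        Integrable (fun t => ∫ x, φ x * σ x ∂(K t)) τ ∧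
        ∀ A, MeasurableSet A →
          ∫ t in A, (∫ x, φ x * σ x ∂(K t)) ∂τ = ∫ x in d ⁻¹' A, φ x * q x ∂μ := by
  have hqi : Integrable q μ := .of_bound hq.aestronglyMeasurable C (.of_forall hC)
  set α := μ.withDensity fun x => ‖q x‖ₑ with hα
  have : IsFiniteMeasure α := isFiniteMeasure_withDensity hqi.2.ne
  -- K t is the conditional distribution of the point x given d(x) = t under the finite measure |q|
  -- μ.
  set K := condDistrib id d α with hK
  have hcomp : α.map d ⊗ₘ K = α.map fun x => (d x, x) :=
    compProd_map_condDistrib measurable_id.aemeasurable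
  have hg : Measurable fun x => (d x, x) := hd.prodMk measurable_id
  -- The sign of q takes the value 1 where q = 0, so that |σ| = 1 everywhere and each fibre σ K t
  -- has variation exactly K t.
  set σ : X → ℝ := fun x => if 0 ≤ q x then 1 else -1 with hσ
  have hσm : Measurable σ :=
    Measurable.ite (measurableSet_le measurable_const hq) measurable_const measurable_const
  have hσ1 : ∀ x, |σ x| = 1 := fun x => by
    by_cases h : 0 ≤ q x <;> simp [hσ, h]
  have hσq : ∀ x, σ x * |q x| = q x := fun x => by
    by_cases h : 0 ≤ q x
    · simp [hσ, h, abs_of_nonneg h]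
    · simp [hσ, h, abs_of_neg (not_le.1 h)]
  refine ⟨α.map d, K, σ, inferInstance, inferInstance, hσm, hσ1, rfl, ?_, ?_⟩
  · have hαV : ∀ᵐ x ∂α, x ∈ V := (withDensity_absolutelyContinuous μ _) hμV
    have hS : MeasurableSet {z : ℝ × X | z.2 ∈ V ∧ d z.2 = z.1} :=
      (measurable_snd hV).inter (measurableSet_eq_fun (hd.comp measurable_snd) measurable_fst)
    have h1 : ∀ᵐ z ∂(α.map d ⊗ₘ K), z.2 ∈ V ∧ d z.2 = z.1 := by
      rw [hcomp, ae_map_iff hg.aemeasurable hS]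
      filter_upwards [hαV] with x hx using ⟨hx, rfl⟩
    exact Measure.ae_ae_of_ae_compProd h1
  · rintro φ hφ ⟨B, hB⟩
    have hφσ : Measurable fun x => φ x * σ x := hφ.mul hσm
    have hb : ∀ x, ‖φ x * σ x‖ ≤ B := fun x => by
      rw [Real.norm_eq_abs, abs_mul, hσ1, mul_one]; exact hB x
    have hint : Integrable (fun z : ℝ × X => φ z.2 * σ z.2) (α.map d ⊗ₘ K) :=
      .of_bound (hφσ.comp measurable_snd).aestronglyMeasurable B (.of_forall fun z => hb z.2)
    refine ⟨.of_bound (hφσ.stronglyMeasurable.integral_kernel (κ := K)).aestronglyMeasurable B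
      (.of_forall fun t => (norm_integral_le_of_norm_le_const (.of_forall hb)).trans_eq (by simp)), fun A hA => ?_⟩
    have h2 := Measure.setIntegral_compProd hA MeasurableSet.univ
      (f := fun z : ℝ × X => φ z.2 * σ z.2) (μ := α.map d) (κ := K) hint.integrableOn
    simp only [Measure.restrict_univ] at h2
    rw [← h2, hcomp, setIntegral_map (f := fun z : ℝ × X => φ z.2 * σ z.2) (hA.prod MeasurableSet.univ)
      (hφσ.comp measurable_snd).aestronglyMeasurable hg.aemeasurable]
    have h3 : (fun x => (d x, x)) ⁻¹' (A ×ˢ univ) = d ⁻¹' A := by ext x; simp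
    rw [h3, hα, setIntegral_withDensity_eq_setIntegral_toReal_smul hq.enorm
      (.of_forall fun x => enorm_lt_top) _ (hd hA)]
    congr 1; ext x
    simp only [toReal_enorm, smul_eq_mul, Real.norm_eq_abs]
    rw [← mul_assoc, mul_comm |q x|, mul_assoc, mul_comm |q x|, hσq]

end Disintegration

variable {n : ℕ} {U : Set (Euc n)} {lam : Measure (Euc n)} [IsFiniteMeasure lam] {q : Euc n → ℝ}

/-- The set algebra generated by a countable generating family is countable, stable under
intersection and contains the whole space. It allows "for every A, for a.e. t" to become "for a.e.
t, for every A". -/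
theorem ext_of_countable_family {X : Type*} {mX : MeasurableSpace X}
    [MeasurableSpace.CountablyGenerated X] :
    ∃ 𝒜 : Set (Set X), 𝒜.Countable ∧ (∀ A ∈ 𝒜, MeasurableSet A) ∧
      ∀ m : SignedMeasure X, (∀ A ∈ 𝒜, m A = 0) → m = 0 := by
  obtain ⟨b, hb, hgen⟩ := MeasurableSpace.CountablyGenerated.isCountablyGenerated (α := X)
  refine ⟨generateSetAlgebra b, countable_generateSetAlgebra hb, fun A hA => ?_, fun m hm => ?_⟩
  · rw [hgen, ← generateFrom_generateSetAlgebra_eq]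
    exact MeasurableSpace.measurableSet_generateFrom hA
  · refine VectorMeasure.ext_of_generateFrom (generateSetAlgebra b) (fun s hs => hm s hs)
      (by rw [hgen, generateFrom_generateSetAlgebra_eq]) (fun s hs t ht _ => ?_) ?_
    · exact isSetAlgebra_generateSetAlgebra.inter_mem hs ht
    · exact hm _ isSetAlgebra_generateSetAlgebra.univ_mem

/-- Over a Lebesgue null set S the density q vanishes, so the disintegration formula makes the
fibres κ t vanish for τ-a.e. t in S; as they have variation 1, τ(S) = 0. -/
theorem IsDisintegration.singularPart_eq_zero (hU : IsOpen U) {C : ℝ} (hq : Measurable q)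
    (hC : ∀ x, |q x| ≤ C)
    (hac : ∀ S : Set ℝ, MeasurableSet S → volume S = 0 →
      ∀ᵐ x ∂lam, x ∈ U → bdryDist U x ∈ S → q x = 0)
    {τ : Measure ℝ} {κ : ℝ → SignedMeasure (Euc n)}
    (h : IsDisintegration U (lam.withDensityᵥ q) τ κ) : τ.singularPart volume = 0 := by
  have := h.isFiniteMeasure
  refine Measure.singularPart_eq_zero_of_ac (Measure.AbsolutelyContinuous.mk fun S hS hS0 => ?_)
  have hdm := measurable_bdryDist U
  have key : ∀ A, MeasurableSet A → ∀ᵐ t ∂(τ.restrict S), κ t A = 0 := fun A hA => by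
    have hle : ∀ᵐ t ∂τ, ‖κ t A‖ ≤ 1 := by
      filter_upwards [h.fiber] with t ht
      have h1 : (κ t).variation univ ≤ 1 := by
        rw [← union_compl_self {x | x ∈ U ∧ bdryDist U x = t}]
        refine (measure_union_le _ _).trans ?_
        rw [ht.2, show {x | x ∈ U ∧ bdryDist U x = t}ᶜ = {x | ¬ (x ∈ U ∧ bdryDist U x = t)} from rfl,
          ht.1, add_zero]
      have h2 := (VectorMeasure.enorm_measure_le_variation (κ t) A).trans
        ((measure_mono (subset_univ A)).trans h1)
      rw [← enorm_one (G := ℝ)] at h2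
      simpa using enorm_le_iff_norm_le.1 h2
    have hint : Integrable (fun t => κ t A) τ :=
      .of_bound (h.aemeasurable A hA).aestronglyMeasurable 1 hle
    refine (hint.restrict (s := S)).ae_eq_zero_of_forall_setIntegral_eq_zero fun B hB _ => ?_
    -- The formula is tested with the indicator of A ∩ d⁻¹(B ∩ S). Its integral against κ t is κ t A
    -- when t ∈ B ∩ S and 0 otherwise, because κ t lives on d = t.
    rw [Measure.restrict_restrict hB, ← integral_indicator (hB.inter hS)]
    have hE : MeasurableSet (A ∩ bdryDist U ⁻¹' (B ∩ S)) := hA.inter (hdm (hB.inter hS))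
    have hb1 : ∀ x, |(A ∩ bdryDist U ⁻¹' (B ∩ S)).indicator (fun _ => (1 : ℝ)) x| ≤ 1 := fun x => by
      by_cases hx : x ∈ A ∩ bdryDist U ⁻¹' (B ∩ S)
      · rw [indicator_of_mem hx, abs_one]
      · rw [indicator_of_notMem hx, abs_zero]; exact zero_le_one
    have hm1 : Measurable ((A ∩ bdryDist U ⁻¹' (B ∩ S)).indicator fun _ => (1 : ℝ)) :=
      measurable_const.indicator hE
    have h1 := h.integral_eq ((A ∩ bdryDist U ⁻¹' (B ∩ S)).indicator fun _ => 1) hm1 ⟨1, hb1⟩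
    rw [setIntegral_withDensityᵥ hq.aestronglyMeasurable (D := C.toNNReal)
      (fun x => (hC x).trans (Real.le_coe_toNNReal C)) _ hU.measurableSet
      (Integrable.of_bound hm1.aestronglyMeasurable 1 (.of_forall hb1)).integrableOn] at h1
    refine Eq.trans (integral_congr_ae ?_) (h1.symm.trans ?_)
    · filter_upwards [h.fiber] with t ht
      rw [VectorMeasure.integral_indicator_const _ hE]
      simp only [ContinuousLinearMap.lsmul_apply, one_smul]
      by_cases htS : t ∈ B ∩ S
      · rw [indicator_of_mem htS, ← VectorMeasure.of_add_of_sdiff hE hA inter_subset_left,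
          apply_eq_zero_of_variation (A := A \ _) ht.1, add_zero]
        rintro x ⟨hxA, hx⟩ ⟨-, hxt⟩
        exact hx ⟨hxA, by rwa [mem_preimage, hxt]⟩
      · rw [indicator_of_notMem htS, apply_eq_zero_of_variation ht.1]
        rintro x ⟨hxA, hx⟩ ⟨-, hxt⟩
        exact htS (by rwa [mem_preimage, hxt] at hx)
    · refine integral_eq_zero_of_ae ?_
      filter_upwards [ae_restrict_of_ae (hac S hS hS0), ae_restrict_mem hU.measurableSet] with x hx hxU
      by_cases hxE : x ∈ A ∩ bdryDist U ⁻¹' (B ∩ S)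
      · simp [hx hxU hxE.2.2]
      · rw [indicator_of_notMem hxE, map_zero]; rfl
  obtain ⟨𝒜, h𝒜, h𝒜m, hext⟩ := ext_of_countable_family (X := Euc n)
  have h0 : ∀ᵐ t ∂(τ.restrict S), ∀ A ∈ 𝒜, κ t A = 0 :=
    (ae_ball_iff h𝒜).2 fun A hA => key A (h𝒜m A hA)
  have hF : ∀ᵐ t ∂(τ.restrict S), False := by
    filter_upwards [h0, ae_restrict_of_ae h.fiber] with t ht hf
    rw [hext _ ht] at hf
    simp at hf
  rw [ae_iff] at hF
  simpa using hF

end DMField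

/-! ### Trace measures: extension of the test class and support on the frontier -/

namespace DMField


variable {n : ℕ} {Ω U : Set (Euc n)} {lam : Measure (Euc n)} {f : Euc n → Euc n} {s : Euc n → ℝ}

/-- `C¹_c(Ω)` is separable with respect to the `C¹` norm on a compact set. -/
theorem exists_countable_dense_isTestC1 (Ω : Set (Euc n)) {K : Set (Euc n)} (hK : IsCompact K) :
    ∃ D : Set (Euc n → ℝ), D.Countable ∧ (∀ ψ ∈ D, IsTestC1 Ω ψ) ∧
      ∀ φ, IsTestC1 Ω φ → ∀ ε > 0, ∃ ψ ∈ D, ∀ x ∈ K, |φ x - ψ x| ≤ ε ∧ ‖∇ φ x - ∇ ψ x‖ ≤ ε := by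
  have : CompactSpace K := isCompact_iff_compactSpace.1 hK
  let J : {φ : Euc n → ℝ // IsTestC1 Ω φ} → C(K, ℝ × Euc n) := fun φ =>
    ⟨fun x => (φ.1 x, ∇ φ.1 x), (φ.2.contDiff.continuous.prodMk
      (continuous_gradient φ.2.contDiff)).comp continuous_subtype_val⟩
  obtain ⟨c, hc, hcc, hcd⟩ := (TopologicalSpace.IsSeparable.of_separableSpace
    (range J)).exists_countable_dense_subset
  choose r hr using fun y : c => hc y.2
  have := hcc.to_subtype
  refine ⟨range fun y : c => (r y).1, countable_range _, ?_, fun φ hφ ε hε => ?_⟩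
  · rintro _ ⟨y, rfl⟩
    exact (r y).2
  · obtain ⟨y, hy, hyd⟩ := Metric.mem_closure_iff.1 (hcd (mem_range_self ⟨φ, hφ⟩)) ε hε
    refine ⟨_, ⟨⟨y, hy⟩, rfl⟩, fun x hx => ?_⟩
    have h1 := (ContinuousMap.dist_apply_le_dist (f := J ⟨φ, hφ⟩) (g := y) ⟨x, hx⟩).trans hyd.le
    have h0 : J (r ⟨y, hy⟩) = y := hr _
    rw [← h0, Prod.dist_eq, max_le_iff, Real.dist_eq, dist_eq_norm] at h1
    exact h1

/-- The polar density is set to 0 off K, so that limits that are uniform only on K can be passed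
under the integral. -/
theorem integral_signedMeasure_eq (ν : SignedMeasure (Euc n)) {K : Set (Euc n)}
    (hK : MeasurableSet K) (hν : ν.variation Kᶜ = 0) :
    ∃ b : Euc n → ℝ, Measurable b ∧ (∀ x, |b x| ≤ 1) ∧ (∀ x ∉ K, b x = 0) ∧
      ∀ φ : Euc n → ℝ, Integrable φ ν.variation → ∫ᵛ x, φ x ∂•ν = ∫ x, φ x * b x ∂ν.variation := by
  obtain ⟨g, hg, hg1, hm⟩ := exists_density_signedMeasure (v := ν) le_rfl
  refine ⟨K.indicator g, hg.indicator hK, fun x => ?_, fun x hx => indicator_of_notMem hx _,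
    fun φ hφ => ?_⟩
  · by_cases hx : x ∈ K
    · simpa [hx] using hg1 x
    · simp [hx]
  · conv_lhs => rw [hm]
    rw [integral_withDensityᵥ hg.aestronglyMeasurable (D := 1) hg1 _ hφ]
    have : ∀ᵐ x ∂ν.variation, x ∈ K := hν
    refine integral_congr_ae ?_
    filter_upwards [this] with x hx
    simp [hx]

namespace IsDivData

variable {E K : Set (Euc n)} {ν : SignedMeasure (Euc n)}

theorem integrable_trace (h : IsDivData Ω lam f s) {φ : Euc n → ℝ} (hφ : IsTestC1 Ω φ) :
    Integrable (fun x => φ x * s x + inner ℝ (∇ φ x) (f x)) lam :=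
  (h.integrable_div hφ).add (h.integrable_gradient hφ)

/-- Both sides are continuous in the C¹ norm on K: replacing φ by an ε-close ψ changes their sum by
at most ε(|ν|(ℝⁿ) + 2 lam(E)). Only countably many ψ can be handled with one null set of levels,
hence the dense family. -/
theorem integral_eq_trace_of_dense (h : IsDivData Ω lam f s) (hK : IsCompact K)
    (hν : ν.variation Kᶜ = 0) (hE : MeasurableSet E) (hEK : E ⊆ K) {D : Set (Euc n → ℝ)}
    (hD : ∀ ψ ∈ D, IsTestC1 Ω ψ)
    (hDd : ∀ φ, IsTestC1 Ω φ → ∀ ε > 0, ∃ ψ ∈ D, ∀ x ∈ K, |φ x - ψ x| ≤ ε ∧ ‖∇ φ x - ∇ ψ x‖ ≤ ε)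
    (hνD : ∀ ψ ∈ D, ∫ᵛ x, ψ x ∂•ν = -∫ x in E, (ψ x * s x + inner ℝ (∇ ψ x) (f x)) ∂lam)
    {φ : Euc n → ℝ} (hφ : IsTestC1 Ω φ) :
    ∫ᵛ x, φ x ∂•ν = -∫ x in E, (φ x * s x + inner ℝ (∇ φ x) (f x)) ∂lam := by
  have := h.isFiniteMeasure
  obtain ⟨b, hb, hb1, hb0, hbν⟩ := integral_signedMeasure_eq ν hK.measurableSet hν
  have hint : ∀ ψ, IsTestC1 Ω ψ → Integrable ψ ν.variation := fun ψ hψ => by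
    obtain ⟨C, hC⟩ := hψ.contDiff.continuous.bounded_above_of_compact_support hψ.hasCompactSupport
    exact .of_bound hψ.contDiff.continuous.aestronglyMeasurable C (.of_forall hC)
  set M := ν.variation.real univ + 2 * (lam.restrict E).real univ with hM
  have hM0 : 0 ≤ M := by positivity
  have key : ∀ ε > 0, |∫ᵛ x, φ x ∂•ν + ∫ x in E, (φ x * s x + inner ℝ (∇ φ x) (f x)) ∂lam| ≤
      ε * M := fun ε hε => by
    obtain ⟨ψ, hψD, hψ⟩ := hDd φ hφ ε hε
    have hψt := hD ψ hψD
    have e1 : ∫ᵛ x, φ x ∂•ν - ∫ᵛ x, ψ x ∂•ν = ∫ x, (φ x - ψ x) * b x ∂ν.variation := by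
      rw [hbν φ (hint φ hφ), hbν ψ (hint ψ hψt), ← integral_sub
        (integrable_mul_of_bounded (hint φ hφ) hb hb1) (integrable_mul_of_bounded (hint ψ hψt) hb hb1)]
      congr 1; ext x; ring
    have e2 : ∫ x in E, (φ x * s x + inner ℝ (∇ φ x) (f x)) ∂lam -
        ∫ x in E, (ψ x * s x + inner ℝ (∇ ψ x) (f x)) ∂lam =
        ∫ x in E, ((φ x - ψ x) * s x + inner ℝ (∇ φ x - ∇ ψ x) (f x)) ∂lam := by
      rw [← integral_sub (h.integrable_trace hφ).integrableOn (h.integrable_trace hψt).integrableOn]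
      congr 1; ext x; rw [inner_sub_left]; ring
    have b1 : |∫ x, (φ x - ψ x) * b x ∂ν.variation| ≤ ε * ν.variation.real univ := by
      rw [← Real.norm_eq_abs]
      refine norm_integral_le_of_norm_le_const (.of_forall fun x => ?_)
      rw [Real.norm_eq_abs, abs_mul]
      by_cases hx : x ∈ K
      · exact (mul_le_of_le_one_right (abs_nonneg _) (hb1 x)).trans (hψ x hx).1
      · rw [hb0 x hx, abs_zero, mul_zero]; exact hε.le
    have b2 : |∫ x in E, ((φ x - ψ x) * s x + inner ℝ (∇ φ x - ∇ ψ x) (f x)) ∂lam| ≤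
        (2 * ε) * (lam.restrict E).real univ := by
      rw [← Real.norm_eq_abs]
      refine norm_integral_le_of_norm_le_const (ae_restrict_of_forall_mem hE fun x hx => ?_)
      refine (abs_add_le _ _).trans ?_
      rw [abs_mul, two_mul]
      exact add_le_add ((mul_le_of_le_one_right (abs_nonneg _) (h.abs_div_le x)).trans
        (hψ x (hEK hx)).1) ((h.abs_inner_le _ _).trans (hψ x (hEK hx)).2)
    rw [← e1] at b1
    rw [← e2] at b2
    rw [hνD ψ hψD] at b1
    have := abs_add_le (∫ᵛ x, φ x ∂•ν - -∫ x in E, (ψ x * s x + inner ℝ (∇ ψ x) (f x)) ∂lam)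
      (∫ x in E, (φ x * s x + inner ℝ (∇ φ x) (f x)) ∂lam -
        ∫ x in E, (ψ x * s x + inner ℝ (∇ ψ x) (f x)) ∂lam)
    rw [show ∀ a c e : ℝ, a - -c + (e - c) = a + e by intros; ring] at this
    rw [hM]
    linarith
  rw [eq_neg_iff_add_eq_zero]
  by_contra hne
  have hpos := abs_pos.2 hne
  -- With ε equal to the discrepancy divided by 2(M + 1), the bound would make a positive
  -- discrepancy smaller than itself.
  have := key (|∫ᵛ x, φ x ∂•ν + ∫ x in E, (φ x * s x + inner ℝ (∇ φ x) (f x)) ∂lam| / (2 * (M + 1)))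
    (by positivity)
  rw [div_mul_eq_mul_div, le_div_iff₀ (by positivity)] at this
  nlinarith

/-- A measure that represents the normal trace on `C¹_c` functions represents it on Lipschitz
functions. -/
theorem integral_eq_trace (h : IsDivData Ω lam f s) (hΩ : IsOpen Ω) (hK : IsCompact K)
    (hKΩ : K ⊆ Ω) (hν : ν.variation Kᶜ = 0) (hE : MeasurableSet E) (hEK : E ⊆ K)
    (hνE : ∀ ψ, IsTestC1 Ω ψ →
      ∫ᵛ x, ψ x ∂•ν = -∫ x in E, (ψ x * s x + inner ℝ (∇ ψ x) (f x)) ∂lam)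
    {φ p : Euc n → ℝ} {g : ℝ → Euc n → ℝ} {C : ℝ} (hC : 0 ≤ C) (hφ : Measurable φ)
    (hφc : ContinuousOn φ Ω) (hg : IsC1Approx Ω φ g C) (hp : IsPairingDensity Ω lam f s φ p) :
    ∫ᵛ x, φ x ∂•ν = -∫ x in E, (φ x * s x + p x) ∂lam := by
  have := h.isFiniteMeasure
  obtain ⟨b, hb, hb1, hb0, hbν⟩ := integral_signedMeasure_eq ν hK.measurableSet hν
  obtain ⟨M, hM0, hM⟩ := ContinuousOn.exists_abs_le hK (hφc.mono hKΩ)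
  obtain ⟨χ, -, hχ, hχ1, -⟩ := exists_isTestC1_cutoff hΩ hK hKΩ
  have hKae : ∀ᵐ x ∂ν.variation, x ∈ K := hν
  have iφ : Integrable φ ν.variation := .of_bound hφ.aestronglyMeasurable M (hKae.mono hM)
  have hbi : Integrable b ν.variation := .of_bound hb.aestronglyMeasurable 1 (.of_forall hb1)
  have hgu := hg.tendsto K hK hKΩ
  have t1 := tendsto_integral_mul_of_tendstoUniformlyOn (lam := ν.variation)
    (hg.contDiff.mono fun δ hδ => hδ.continuous.aestronglyMeasurable) hgu hM hbi hb0
  have h1i : Integrable (E.indicator fun _ => (1 : ℝ)) lam :=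
    (integrable_const (1 : ℝ)).indicator hE
  have h10 : ∀ x ∉ K, E.indicator (fun _ => (1 : ℝ)) x = 0 := fun x hx =>
    indicator_of_notMem (fun hxE => hx (hEK hxE)) _
  have t2 := tendsto_integral_mul_of_tendstoUniformlyOn (lam := lam)
    (hg.contDiff.mono fun δ hδ => hδ.continuous.aestronglyMeasurable) hgu hM
    (integrable_mul_of_bounded h1i h.measurable_div h.abs_div_le) fun x hx => by
      rw [h10 x hx, zero_mul]
  have t3 := h.tendsto_integral_mul_gradient hΩ hC hφc hg hp hK hKΩ h1i h10
  -- χ g δ is a test function with the same values and gradients as g δ on K, so the hypothesis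
  -- applies to it, and the limit is taken on both sides. The term with gradients is tested with the
  -- indicator of E.
  have hlim := tendsto_nhds_unique_of_eventuallyEq t1 (t2.add t3).neg <| by
    filter_upwards [hg.contDiff, hg.bound K hK hKΩ] with δ h1 h2
    have ht : IsTestC1 Ω (fun x => χ x * g δ x) :=
      ⟨hχ.contDiff.mul h1, hχ.hasCompactSupport.mul_right,
        tsupport_mul_subset_left.trans hχ.tsupport_subset⟩
    have hev : ∀ x ∈ K, (fun x => χ x * g δ x) =ᶠ[𝓝 x] g δ := fun x hx => by
      filter_upwards [(eventually_nhdsSet_iff_forall.1 hχ1) x hx] with y hy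
      rw [hy, one_mul]
    have hgr : ∀ x ∈ K, ∇ (fun x => χ x * g δ x) x = ∇ (g δ) x := fun x hx => by
      simp only [gradient]
      rw [(hev x hx).fderiv_eq]
    have h3 := hνE _ ht
    obtain ⟨B, hB⟩ := ht.contDiff.continuous.bounded_above_of_compact_support ht.hasCompactSupport
    rw [hbν _ (.of_bound ht.contDiff.continuous.aestronglyMeasurable B (.of_forall hB))] at h3
    have e1 : ∫ x, g δ x * b x ∂ν.variation = ∫ x, χ x * g δ x * b x ∂ν.variation := by
      congr 1; ext x
      by_cases hx : x ∈ K
      · rw [(hev x hx).eq_of_nhds]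
      · rw [hb0 x hx, mul_zero, mul_zero]
    have i3 := (h.abs_integral_mul_gradient_le h1 h1i (C := C) fun x hx => h2 x (by
      by_contra h4; exact hx (h10 x h4))).1
    have i2 : Integrable (fun x => g δ x * (E.indicator (fun _ => 1) x * s x)) lam := by
      obtain ⟨B', -, hB'⟩ := ContinuousOn.exists_abs_le hK h1.continuous.continuousOn
      exact integrable_mul_of_support h1.continuous.measurable hB'
        (integrable_mul_of_bounded h1i h.measurable_div h.abs_div_le) fun x hx => by
          rw [h10 x hx, zero_mul]
    rw [e1, h3, ← integral_add i2 i3, ← integral_indicator hE]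
    congr 2; ext x
    by_cases hx : x ∈ E
    · simp only [indicator_of_mem hx, hgr x (hEK hx), (hev x (hEK hx)).eq_of_nhds, one_mul]
    · simp [indicator_of_notMem hx]
  have i4 : Integrable (fun x => φ x * (E.indicator (fun _ => 1) x * s x)) lam :=
    integrable_mul_of_support hφ hM
      (integrable_mul_of_bounded h1i h.measurable_div h.abs_div_le) fun x hx => by
        rw [h10 x hx, zero_mul]
  obtain ⟨D, -, hD⟩ := hp.bounded
  rw [hbν φ iφ, hlim, ← integral_add i4 (integrable_mul_of_bounded h1i hp.measurable hD),
    ← integral_indicator hE]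
  congr 2; ext x
  by_cases hx : x ∈ E <;> simp [hx]

/-- If ψ vanishes near the frontier of the open set E, then ψ times the indicator of E is again a C¹
test function, and the divergence identity for it says that the trace of ψ is zero. -/
theorem isMeasureOn_frontier (h : IsDivData Ω lam f s) (hΩ : IsOpen Ω) (hK : MeasurableSet K)
    (hKΩ : K ⊆ Ω) (hν : ν.variation Kᶜ = 0) (hE : IsOpen E)
    (hνE : ∀ ψ, IsTestC1 Ω ψ →
      ∫ᵛ x, ψ x ∂•ν = -∫ x in E, (ψ x * s x + inner ℝ (∇ ψ x) (f x)) ∂lam) :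
    IsMeasureOn (frontier E) ν := by
  have := h.isFiniteMeasure
  intro A hA hAE
  rw [← VectorMeasure.of_add_of_sdiff (hA.inter hK) hA inter_subset_left,
    apply_eq_zero_of_variation (A := A \ (A ∩ K)) hν fun x hx hxK => hx.2 ⟨hx.1, hxK⟩, add_zero]
  refine signedMeasure_apply_eq_zero (W := Ω \ frontier E) (hΩ.sdiff isClosed_frontier)
    (fun ψ hψ hψc hψW => ?_) (hA.inter hK) fun x hx => ⟨hKΩ hx.2, fun hxE =>
      disjoint_left.1 hAE hx.1 hxE⟩
  have hψ1 : ContDiff ℝ 1 ψ := hψ.of_le (by exact_mod_cast le_top)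
  have hψt : IsTestC1 Ω ψ := ⟨hψ1, hψc, hψW.trans sdiff_subset⟩
  have hin : ∀ x ∈ E, E.indicator ψ =ᶠ[𝓝 x] ψ := fun x hx => by
    filter_upwards [hE.mem_nhds hx] with y hy using indicator_of_mem hy _
  have hout : ∀ x ∉ E, E.indicator ψ =ᶠ[𝓝 x] fun _ => 0 := fun x hx => by
    by_cases hxc : x ∈ closure E
    · have hx' : x ∉ tsupport ψ := fun h => (hψW h).2 (by rw [hE.frontier_eq]; exact ⟨hxc, hx⟩)
      filter_upwards [(isClosed_tsupport ψ).isOpen_compl.mem_nhds hx'] with y hy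
      rw [indicator_apply_eq_zero]
      exact fun _ => image_eq_zero_of_notMem_tsupport hy
    · filter_upwards [isClosed_closure.isOpen_compl.mem_nhds hxc] with y hy
      exact indicator_of_notMem (fun h => hy (subset_closure h)) _
  have hθ : IsTestC1 Ω (E.indicator ψ) := by
    have hs : tsupport (E.indicator ψ) ⊆ tsupport ψ := closure_mono (by
      rw [support_indicator]; exact inter_subset_right)
    refine ⟨contDiff_iff_contDiffAt.2 fun x => ?_, hψc.of_isClosed_subset (isClosed_tsupport _) hs,
      hs.trans (hψW.trans sdiff_subset)⟩
    by_cases hx : x ∈ E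
    · exact hψ1.contDiffAt.congr_of_eventuallyEq (hin x hx)
    · exact contDiffAt_const.congr_of_eventuallyEq (hout x hx)
  have hgr : ∀ x, ∇ (E.indicator ψ) x = E.indicator (∇ ψ) x := fun x => by
    by_cases hx : x ∈ E
    · rw [indicator_of_mem hx]
      simp only [gradient]
      rw [(hin x hx).fderiv_eq]
    · rw [indicator_of_notMem hx]
      simp only [gradient]
      rw [(hout x hx).fderiv_eq, fderiv_fun_const]
      simp
  rw [hνE ψ hψt, ← integral_indicator hE.measurableSet, neg_eq_zero]
  have h1 := h.integral_eq _ hθ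
  rw [← sub_eq_zero, sub_neg_eq_add, ← integral_add (h.integrable_div hθ) (h.integrable_gradient hθ)]
    at h1
  rw [← h1]
  congr 1; ext x
  rw [hgr]
  by_cases hx : x ∈ E <;> simp [hx]

end IsDivData

end DMField

/-! ### Absolute continuity in the level, and construction of the trace measures -/

namespace DMField


variable {n : ℕ} {Ω U : Set (Euc n)} {lam : Measure (Euc n)} {f : Euc n → Euc n} {s : Euc n → ℝ}

namespace IsDivData

/-- The coarea formula over a null set of levels reads 0 = ∫ φ q over U ∩ d⁻¹(S) for every test
function φ, which forces q = 0 there. Discarding the levels t ≤ 0 is harmless because d > 0 on U. -/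
theorem ae_eq_zero_of_volume_eq_zero (h : IsDivData Ω lam f s) (hn : 2 ≤ n) (hΩ : IsOpen Ω)
    (hU : IsOpen U) (hUc : IsCompact (closure U)) (hUΩ : closure U ⊆ Ω) {g : ℝ → Euc n → ℝ} {C : ℝ}
    (hC : 0 ≤ C) (hg : IsC1Approx Ω (bdryDist U) g C) {q : Euc n → ℝ}
    (hq : IsPairingDensity Ω lam f s (bdryDist U) q) {S : Set ℝ} (hS : MeasurableSet S)
    (hS0 : volume S = 0) : ∀ᵐ x ∂lam, x ∈ U → bdryDist U x ∈ S → q x = 0 := by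
  have := h.isFiniteMeasure
  obtain ⟨Cq, -, hCq⟩ := hq.bounded
  have hqi : Integrable q lam := h.integrable_of_bounded hq.measurable hCq
  have hS' : MeasurableSet (S ∩ Ioi 0) := hS.inter measurableSet_Ioi
  have hE : MeasurableSet (U ∩ bdryDist U ⁻¹' (S ∩ Ioi 0)) :=
    hU.measurableSet.inter (measurable_bdryDist U hS')
  have h0 := h.ae_eq_of_integral_eq hΩ (hqi.indicator hE) (integrable_zero _ _ _) fun ψ hψ => by
    have h1 := (h.coarea hΩ hU hUc hUΩ hC hg hq hψ.contDiff.continuous.measurable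
      hψ.contDiff.continuous.continuousOn (h.isPairingDensity_of_isTestC1 hψ)).2 _ hS'
      inter_subset_right
    rw [setIntegral_measure_zero _ (measure_mono_null inter_subset_left hS0),
      ← integral_indicator hE] at h1
    simp only [Pi.zero_apply, mul_zero, integral_zero]
    refine Eq.trans ?_ h1.symm
    congr 1; ext x
    by_cases hx : x ∈ U ∩ bdryDist U ⁻¹' (S ∩ Ioi 0)
    · simp only [indicator_of_mem hx]
    · simp only [indicator_of_notMem hx, mul_zero]
  filter_upwards [h0] with x hx hxU hxS
  have hxE : x ∈ U ∩ bdryDist U ⁻¹' (S ∩ Ioi 0) := ⟨hxU, hxS, bdryDist_pos hn hU hUc hxU⟩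
  rwa [indicator_of_mem hxE] at hx

/-- The disintegration of the pairing of `∇d` and `F` along the level sets of `d`, and the normal
traces on the boundaries of the superlevel sets. -/
theorem exists_disintegration (h : IsDivData Ω lam f s) (hn : 2 ≤ n) (hΩ : IsOpen Ω)
    (hU : IsOpen U) (hUc : IsCompact (closure U)) (hUΩ : closure U ⊆ Ω) {g : ℝ → Euc n → ℝ} {C : ℝ}
    (hC : 0 ≤ C) (hg : IsC1Approx Ω (bdryDist U) g C) {q : Euc n → ℝ}
    (hq : IsPairingDensity Ω lam f s (bdryDist U) q) :
    (∃ τ κ, IsDisintegration U (lam.withDensityᵥ q) τ κ) ∧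
    ∃ N : ℝ → SignedMeasure (Euc n),
      (∀ᵐ t ∂(volume.restrict (Ioi (0 : ℝ))), (N t).variation (closure U)ᶜ = 0 ∧
        ∀ ψ, IsTestC1 Ω ψ → ∫ᵛ x, ψ x ∂•(N t) =
          -∫ x in innerSet U t, (ψ x * s x + inner ℝ (∇ ψ x) (f x)) ∂lam) ∧
      ∀ φ : Euc n → ℝ, Measurable φ → (∃ B : ℝ, ∀ x, |φ x| ≤ B) →
        IntegrableOn (fun t => ∫ᵛ x, φ x ∂•(N t)) (Ioi 0) ∧
        ∫ t in Ioi (0 : ℝ), (∫ᵛ x, φ x ∂•(N t)) = ∫ x in U, φ x * q x ∂lam := by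
  have := h.isFiniteMeasure
  obtain ⟨Cq, -, hCq⟩ := hq.bounded
  have hdm := measurable_bdryDist U
  have hd0 : ∀ x ∈ U, 0 < bdryDist U x := fun x hx => bdryDist_pos hn hU hUc hx
  obtain ⟨τ, K, σ, hτ, hKM, hσ, hσ1, hτα, hfib, hint⟩ := exists_kernel_disintegration
    (μ := lam.restrict U) hdm hq.measurable hCq (V := U) hU.measurableSet
    (by rw [Measure.restrict_apply hU.measurableSet.compl]; simp)
  have hσ1' : ∀ x, |σ x| ≤ 1 := fun x => (hσ1 x).le
  have hσi : ∀ t, Integrable σ (K t) := fun t => .of_bound hσ.aestronglyMeasurable 1 (.of_forall hσ1')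
  have hαd : ∀ S : Set ℝ, MeasurableSet S → (∀ᵐ x ∂lam, x ∈ U → bdryDist U x ∈ S → q x = 0) →
      τ S = 0 := fun S hS h0 => by
    rw [hτα, Measure.map_apply hdm hS, withDensity_apply _ (hdm hS)]
    rw [lintegral_eq_zero_iff hq.measurable.enorm, Measure.restrict_restrict (hdm hS)]
    filter_upwards [ae_restrict_of_ae h0, ae_restrict_mem ((hdm hS).inter hU.measurableSet)]
      with x hx hxS
    simp [hx hxS.2 hxS.1]
  have hτ0 : τ (Iic 0) = 0 := hαd _ measurableSet_Iic
    (.of_forall fun x hx hx0 => absurd (hd0 x hx) (not_lt.2 hx0))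
  have hac : τ ≪ volume := Measure.AbsolutelyContinuous.mk fun S hS hS0 =>
    hαd S hS (h.ae_eq_zero_of_volume_eq_zero hn hΩ hU hUc hUΩ hC hg hq hS hS0)
  set κ : ℝ → SignedMeasure (Euc n) := fun t => (K t).withDensityᵥ σ with hκ
  have hvar : ∀ t, (κ t).variation = K t := fun t => by
    rw [hκ, Measure.variation_withDensityᵥ (hσi t)]
    have : (fun x => ‖σ x‖ₑ) = 1 := funext fun x => by
      rw [← enorm_norm, Real.norm_eq_abs, hσ1, Pi.one_apply, enorm_one]
    rw [this, withDensity_one]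
  have hκi : ∀ φ : Euc n → ℝ, Measurable φ → (∃ B : ℝ, ∀ x, |φ x| ≤ B) → ∀ t,
      ∫ᵛ x, φ x ∂•(κ t) = ∫ x, φ x * σ x ∂(K t) := fun φ hφ hB t => by
    obtain ⟨B, hB⟩ := hB
    exact integral_withDensityᵥ_of_abs_le_one hσ hσ1'
      (.of_bound hφ.aestronglyMeasurable B (.of_forall hB))
  have hfm : ∀ t, MeasurableSet {x | x ∈ U ∧ bdryDist U x = t} := fun t =>
    hU.measurableSet.inter (hdm (measurableSet_singleton t))
  refine ⟨⟨τ, κ, hτ, hτ0, fun A hA => ?_, ?_, fun φ hφ hB => ?_⟩, ?_⟩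
  · have h1 := (hint (A.indicator fun _ => 1) (measurable_const.indicator hA) ⟨1, fun x => by
      by_cases hx : x ∈ A <;> simp [hx]⟩).1
    refine h1.1.aemeasurable.congr (.of_forall fun t => ?_)
    simp only [hκ]
    rw [withDensityᵥ_apply (hσi t) hA, ← integral_indicator hA]
    congr 1; ext x
    by_cases hx : x ∈ A <;> simp [hx]
  · filter_upwards [hfib] with t ht
    rw [hvar]
    exact ⟨ht, (prob_compl_eq_zero_iff (hfm t)).1 ht⟩
  · have h1 := (hint φ hφ hB).2 univ MeasurableSet.univ
    obtain ⟨B, hB'⟩ := hB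
    rw [h.setIntegral_signed hq.measurable hCq hU.measurableSet
      (h.integrable_of_bounded hφ hB').integrableOn]
    simp only [Measure.restrict_univ, preimage_univ] at h1
    rw [← h1]
    exact integral_congr_ae (.of_forall fun t => (hκi φ hφ ⟨B, hB'⟩ t).symm)
  -- Since τ has no singular part, its Lebesgue density can be absorbed into the fibres, giving
  -- measures indexed by t and integrated against dt.
  · set N : ℝ → SignedMeasure (Euc n) := fun t => (τ.rnDeriv volume t).toReal • κ t with hN
    have hNi : ∀ φ : Euc n → ℝ, Measurable φ → (∃ B : ℝ, ∀ x, |φ x| ≤ B) → ∀ t,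
        ∫ᵛ x, φ x ∂•(N t) = (τ.rnDeriv volume t).toReal • ∫ x, φ x * σ x ∂(K t) :=
      fun φ hφ hB t => by
        rw [hN, VectorMeasure.integral_smul_vectorMeasure, hκi φ hφ hB]
    have hNint : ∀ φ : Euc n → ℝ, Measurable φ → (∃ B : ℝ, ∀ x, |φ x| ≤ B) →
        Integrable (fun t => ∫ᵛ x, φ x ∂•(N t)) ∧ ∀ A, MeasurableSet A →
          ∫ t in A, (∫ᵛ x, φ x ∂•(N t)) = ∫ x in U ∩ bdryDist U ⁻¹' A, φ x * q x ∂lam :=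
      fun φ hφ hB => by
        obtain ⟨h1, h2⟩ := hint φ hφ hB
        simp only [hNi φ hφ hB]
        refine ⟨(integrable_rnDeriv_smul_iff hac).2 h1, fun A hA => ?_⟩
        rw [setIntegral_rnDeriv_smul hac hA, h2 A hA,
          Measure.restrict_restrict (hdm hA), inter_comm]
    -- The fibre property is known only τ-a.e., that is, at Lebesgue-a.e. t with positive density of
    -- τ; at the other levels N t is zero.
    have hNv : ∀ᵐ t ∂(volume : Measure ℝ), (N t).variation (closure U)ᶜ = 0 := by
      have h1 := hfib
      rw [← Measure.withDensity_rnDeriv_eq τ volume hac,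
        ae_withDensity_iff (Measure.measurable_rnDeriv _ _)] at h1
      filter_upwards [h1] with t ht
      rw [hN, VectorMeasure.variation_smul, hvar]
      by_cases h0 : τ.rnDeriv volume t = 0
      · simp [h0]
      · have : K t (closure U)ᶜ = 0 :=
          measure_mono_null (t := {x | ¬(x ∈ U ∧ bdryDist U x = t)})
            (fun x hx hx' => hx (subset_closure hx'.1)) (ht h0)
        simp [this]
    refine ⟨N, ?_, fun φ hφ hB => ?_⟩
    · obtain ⟨D, hDc, hD, hDd⟩ := exists_countable_dense_isTestC1 Ω hUc
      have hDt : ∀ᵐ t ∂(volume.restrict (Ioi (0 : ℝ))), ∀ ψ ∈ D, ∫ᵛ x, ψ x ∂•(N t) =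
          -∫ x in innerSet U t, (ψ x * s x + inner ℝ (∇ ψ x) (f x)) ∂lam := by
        refine (ae_ball_iff hDc).2 fun ψ hψ => ?_
        have hψt := hD ψ hψ
        have hψm := hψt.contDiff.continuous.measurable
        obtain ⟨i1, h1⟩ := h.coarea hΩ hU hUc hUΩ hC hg hq hψm
          hψt.contDiff.continuous.continuousOn (h.isPairingDensity_of_isTestC1 hψt)
        obtain ⟨i2, h2⟩ := hNint ψ hψm
          (hψt.contDiff.continuous.bounded_above_of_compact_support hψt.hasCompactSupport)
        -- Over every Borel set of levels, the disintegration and the coarea formula yield the same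
        -- integral of ψ q.
        refine Integrable.ae_eq_of_forall_setIntegral_eq _ _ i2.integrableOn i1 fun A hA _ => ?_
        rw [Measure.restrict_restrict hA, h1 _ (hA.inter measurableSet_Ioi) inter_subset_right,
          h2 _ (hA.inter measurableSet_Ioi)]
      filter_upwards [hDt, ae_restrict_of_ae hNv] with t ht hv
      exact ⟨hv, fun ψ hψ => h.integral_eq_trace_of_dense hUc hv (measurableSet_innerSet hU t)
        (fun x hx => subset_closure hx.1) hD hDd ht hψ⟩
    · obtain ⟨i2, h2⟩ := hNint φ hφ hB
      refine ⟨i2.integrableOn, (h2 _ measurableSet_Ioi).trans ?_⟩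
      rw [inter_eq_left.2 (show U ⊆ bdryDist U ⁻¹' Ioi 0 from fun x hx => hd0 x hx)]

end IsDivData

end DMField

/-! ### Functions in W^{1,∞}(Ω): independence of the values outside Ω -/

namespace DMField


variable {n : ℕ} {Ω U : Set (Euc n)} {lam : Measure (Euc n)} {f : Euc n → Euc n} {s : Euc n → ℝ}

theorem IsC1Approx.indicator {φ : Euc n → ℝ} {g : ℝ → Euc n → ℝ} {C : ℝ}
    (hg : IsC1Approx Ω φ g C) : IsC1Approx Ω (Ω.indicator φ) g C :=
  ⟨hg.contDiff, fun K hK hKΩ => (hg.tendsto K hK hKΩ).congr_right fun _ hx =>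
    (indicator_of_mem (hKΩ hx) φ).symm, hg.bound⟩

/-- Outside Ω a function in W^{1,∞}(Ω) is arbitrary and may fail to be measurable; multiplying by
the indicator of Ω repairs this without changing its mollifications or pairing. -/
theorem measurable_indicator_of_continuousOn (hΩ : IsOpen Ω) {φ : Euc n → ℝ}
    (hφ : ContinuousOn φ Ω) : Measurable (Ω.indicator φ) := by
  classical
  rw [← piecewise_eq_indicator]
  exact hφ.measurable_piecewise continuousOn_const hΩ.measurableSet

theorem continuousOn_indicator_self {φ : Euc n → ℝ} (hφ : ContinuousOn φ Ω) :
    ContinuousOn (Ω.indicator φ) Ω :=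
  hφ.congr fun _ hx => indicator_of_mem hx φ

/-- The pairing of a `W^{1,∞}` function and `F` has a bounded density. -/
theorem IsDivData.exists_isPairingDensity_of_memW1Infty (h : IsDivData Ω lam f s) (hΩ : IsOpen Ω)
    {φ : Euc n → ℝ} (hφ : MemW1Infty Ω φ) :
    ∃ (p : Euc n → ℝ) (g : ℝ → Euc n → ℝ) (C : ℝ), 0 ≤ C ∧ IsC1Approx Ω (Ω.indicator φ) g C ∧
      IsPairingDensity Ω lam f s (Ω.indicator φ) p ∧
      IsPairing Ω (lam.withDensityᵥ f) φ (lam.withDensityᵥ p) := by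
  obtain ⟨C, hC, hg⟩ := hφ.exists_isC1Approx hΩ
  obtain ⟨ρ, hρ⟩ := IsStandardMollifier.exists_isStandardMollifier (n := n)
  have hc := continuousOn_indicator_self hφ.continuousOn
  obtain ⟨p, hp⟩ := h.exists_isPairingDensity hC
    (measurable_indicator_of_continuousOn hΩ hφ.continuousOn) hc (hg ρ hρ).indicator
  refine ⟨p, _, C, hC, (hg ρ hρ).indicator, hp, ?_⟩
  have := h.isPairing hΩ hc hC (fun ρ hρ => by
    simp only [mollify_indicator hΩ.measurableSet]
    exact (hg ρ hρ).indicator) hp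
  refine ⟨this.isMeasureOn, fun ρ hρ ψ hψ hψc hψΩ => ?_⟩
  have ht := this.tendsto ρ hρ ψ hψ hψc hψΩ
  simpa only [mollify_indicator hΩ.measurableSet] using ht

theorem IsDivData.normalTrace_eq (h : IsDivData Ω lam f s) (hΩ : IsOpen Ω)
    {F : VectorMeasure (Euc n) (Euc n)} (hFd : divMeasure Ω F = lam.withDensityᵥ s)
    {φ p : Euc n → ℝ} (hφ : ContinuousOn φ Ω) (hp : IsPairingDensity Ω lam f s (Ω.indicator φ) p)
    (hpair : IsPairing Ω F φ (lam.withDensityᵥ p)) {E K : Set (Euc n)} (hE : MeasurableSet E)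
    (hK : IsCompact K) (hKΩ : K ⊆ Ω) (hEK : E ⊆ K) :
    normalTrace Ω F E φ = -∫ x in E, (Ω.indicator φ x * s x + p x) ∂lam := by
  have := h.isFiniteMeasure
  obtain ⟨M, -, hM⟩ := ContinuousOn.exists_abs_le hK (hφ.mono hKΩ)
  obtain ⟨C, -, hC⟩ := hp.bounded
  have hpi := h.integrable_of_bounded hp.measurable hC
  have hind : ∀ x ∈ E, Ω.indicator φ x = φ x := fun x hx => indicator_of_mem (hKΩ (hEK hx)) φ
  have hφi : IntegrableOn (Ω.indicator φ) E lam := .of_bound (measure_lt_top _ _)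
    (measurable_indicator_of_continuousOn hΩ hφ).aestronglyMeasurable M
    (ae_restrict_of_forall_mem hE fun x hx => by rw [hind x hx]; exact hM x (hEK hx))
  have hφi' : IntegrableOn φ E lam := hφi.congr_fun hind hE
  have hφs : IntegrableOn (fun x => Ω.indicator φ x * s x) E lam :=
    integrable_mul_of_bounded hφi h.measurable_div h.abs_div_le
  rw [normalTrace, hFd, pairing_eq hΩ hpair, withDensityᵥ_apply hpi hE,
    h.setIntegral_signed h.measurable_div h.abs_div_le hE hφi',
    integral_add hφs hpi.integrableOn, neg_add, ← sub_eq_add_neg]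
  congr 2
  exact setIntegral_congr_fun hE fun x hx => by simp only [hind x hx]

end DMField

end

/-! ### The main theorem -/

theorem theorem4p1 {n : ℕ} (hn : 2 ≤ n) {Ω U : Set (Euc n)} (hΩ : IsOpen Ω)
    (F : VectorMeasure (Euc n) (Euc n)) (hF : IsDMExt Ω F)
    (hU : IsOpen U) (hUc : IsCompact (closure U)) (hUΩ : closure U ⊆ Ω) :
    -- the measures `div F`, `∇d · F` and `∇φ · F` exist, so that the formulas below are meaningful
    (IsDivergence Ω F (divMeasure Ω F) ∧
      IsPairing Ω F (bdryDist U) (pairing Ω F (bdryDist U)) ∧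
      ∀ φ : Euc n → ℝ, MemW1Infty Ω φ → IsPairing Ω F φ (pairing Ω F φ)) ∧
    -- the coarea formula for `φ ∈ W^{1,∞}(Ω)`
    (∀ φ : Euc n → ℝ, MemW1Infty Ω φ →
      IntegrableOn (fun t => normalTrace Ω F (innerSet U t) φ) (Ioi 0) ∧
      ∫ t in Ioi (0 : ℝ), normalTrace Ω F (innerSet U t) φ =
        ∫ᵛ x in U, φ x ∂•(pairing Ω F (bdryDist U))) ∧
    -- its extension to bounded Borel `φ`, through the measures `(F·ν)_{∂U^t}`, for a.e. `t > 0`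
    (∃ N : ℝ → SignedMeasure (Euc n),
      (∀ᵐ t ∂(volume.restrict (Ioi (0 : ℝ))),
        IsNormalTraceMeasure Ω F (innerSet U t) (N t) ∧
        IsMeasureOn (frontier (innerSet U t)) (N t) ∧
        ∀ φ : Euc n → ℝ, MemW1Infty Ω φ →
          normalTrace Ω F (innerSet U t) φ = ∫ᵛ x, φ x ∂•(N t)) ∧
      ∀ φ : Euc n → ℝ, Measurable φ → (∃ C : ℝ, ∀ x, |φ x| ≤ C) →
        IntegrableOn (fun t => ∫ᵛ x, φ x ∂•(N t)) (Ioi 0) ∧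
        ∫ t in Ioi (0 : ℝ), (∫ᵛ x, φ x ∂•(N t)) =
          ∫ᵛ x in U, φ x ∂•(pairing Ω F (bdryDist U))) ∧
    -- the disintegration of `∇d · F` along the level sets of `d` has no singular part in `t`
    ((∃ (τ : Measure ℝ) (κ : ℝ → SignedMeasure (Euc n)),
        IsDisintegration U (pairing Ω F (bdryDist U)) τ κ) ∧
      ∀ (τ : Measure ℝ) (κ : ℝ → SignedMeasure (Euc n)),
        IsDisintegration U (pairing Ω F (bdryDist U)) τ κ → τ.singularPart volume = 0) := by
  obtain ⟨lam, f, s, h, hFf, hFd⟩ := exists_isDivData hΩ.measurableSet hF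
  have := h.isFiniteMeasure
  have hUΩ' : U ⊆ Ω := subset_closure.trans hUΩ
  have hdl := lipschitzWith_bdryDist U
  obtain ⟨ρ, hρ⟩ := IsStandardMollifier.exists_isStandardMollifier (n := n)
  have hg := isC1Approx_of_lipschitz hρ hΩ hdl
  obtain ⟨q, hq⟩ := h.exists_isPairingDensity (by simp) (measurable_bdryDist U)
    hdl.continuous.continuousOn hg
  obtain ⟨Cq, -, hCq⟩ := hq.bounded
  have hdpair : IsPairing Ω F (bdryDist U) (lam.withDensityᵥ q) := hFf ▸ h.isPairing hΩ
    hdl.continuous.continuousOn (by simp) (fun ρ hρ => isC1Approx_of_lipschitz hρ hΩ hdl) hq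
  have hpd := pairing_eq hΩ hdpair
  have hW : ∀ φ : Euc n → ℝ, MemW1Infty Ω φ → ∃ (p : Euc n → ℝ) (g : ℝ → Euc n → ℝ) (C : ℝ),
      0 ≤ C ∧ IsC1Approx Ω (Ω.indicator φ) g C ∧
      IsPairingDensity Ω lam f s (Ω.indicator φ) p ∧ IsPairing Ω F φ (lam.withDensityᵥ p) := by
    rw [hFf]
    exact fun φ hφ => h.exists_isPairingDensity_of_memW1Infty hΩ hφ
  have hin : ∀ t, MeasurableSet (innerSet U t) := measurableSet_innerSet hU
  have hinU : ∀ t, innerSet U t ⊆ closure U := fun t x hx => subset_closure hx.1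
  -- The family N is fixed once and serves all φ: its exceptional null set of levels depends neither
  -- on test functions nor on W^{1,∞} functions.
  obtain ⟨hdis, N, hN, hNφ⟩ := h.exists_disintegration hn hΩ hU hUc hUΩ (by simp) hg hq
  refine ⟨⟨isDivergence_divMeasure hΩ.measurableSet hF, isPairing_pairing hdpair, fun φ hφ => ?_⟩,
    fun φ hφ => ?_, ⟨N, ?_, fun φ hφ hB => ?_⟩, ?_⟩
  · obtain ⟨p, -, -, -, -, -, hpair⟩ := hW φ hφ
    exact isPairing_pairing hpair
  · obtain ⟨p, -, -, -, -, hp, hpair⟩ := hW φ hφ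
    have hφm := measurable_indicator_of_continuousOn hΩ hφ.continuousOn
    have hφc := continuousOn_indicator_self hφ.continuousOn
    obtain ⟨h1, h2⟩ := h.coarea hΩ hU hUc hUΩ (by simp) hg hq hφm hφc hp
    simp only [h.normalTrace_eq hΩ hFd hφ.continuousOn hp hpair (hin _) hUc hUΩ (hinU _)]
    refine ⟨h1, (h2 _ measurableSet_Ioi subset_rfl).trans ?_⟩
    obtain ⟨M, -, hM⟩ := ContinuousOn.exists_abs_le hUc (hφ.continuousOn.mono hUΩ)
    have hφi : IntegrableOn (Ω.indicator φ) U lam := .of_bound (measure_lt_top _ _)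
      hφm.aestronglyMeasurable M (ae_restrict_of_forall_mem hU.measurableSet fun x hx => by
        rw [indicator_of_mem (hUΩ' hx)]; exact hM x (subset_closure hx))
    rw [hpd, h.setIntegral_signed hq.measurable hCq hU.measurableSet
        (hφi.congr_fun (fun x hx => indicator_of_mem (hUΩ' hx) φ) hU.measurableSet),
      inter_eq_left.2 (show U ⊆ bdryDist U ⁻¹' Ioi 0 from fun x hx => bdryDist_pos hn hU hUc hx)]
    exact setIntegral_congr_fun hU.measurableSet fun x hx => by
      simp only [indicator_of_mem (hUΩ' hx)]
  · filter_upwards [hN] with t ⟨hv, ht⟩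
    refine ⟨⟨fun A _ hAΩ => apply_eq_zero_of_variation hv fun x hx hxU =>
      disjoint_left.1 hAΩ hx (hUΩ hxU), fun ψ hψ => ?_⟩,
      h.isMeasureOn_frontier hΩ hUc.measurableSet hUΩ hv
        (hU.inter (isOpen_lt continuous_const hdl.continuous)) ht, fun φ hφ => ?_⟩
    · obtain ⟨g1, g2, C, hC⟩ := bddGradient_isTestC1 hψ
      have hgi : Integrable (∇ ψ) lam := .of_bound g1.aestronglyMeasurable C (.of_forall hC)
      have hψi := h.integrable_continuous hψ.contDiff.continuous hψ.hasCompactSupport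
      rw [ht ψ hψ, hFd, h.setIntegral_signed h.measurable_div h.abs_div_le (hin t) hψi.integrableOn,
        hFf, h.setIntegral_field (hin t) hgi.integrableOn,
        integral_add (h.integrable_div hψ).integrableOn (h.integrable_gradient hψ).integrableOn]
      ring
    · obtain ⟨p, g, C, hC, hgφ, hp, hpair⟩ := hW φ hφ
      rw [h.normalTrace_eq hΩ hFd hφ.continuousOn hp hpair (hin t) hUc hUΩ (hinU t),
        ← h.integral_eq_trace hΩ hUc hUΩ hv (hin t) (hinU t) ht hC
          (measurable_indicator_of_continuousOn hΩ hφ.continuousOn)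
          (continuousOn_indicator_self hφ.continuousOn) hgφ hp]
      -- N t does not charge the complement of the closure of U, so the indicator of Ω can be
      -- dropped.
      have hae : ∀ᵐ x ∂(N t).variation, x ∈ closure U := hv
      refine VectorMeasure.integral_congr_ae ?_
      filter_upwards [hae] with x hx using indicator_of_mem (hUΩ hx) φ
  · obtain ⟨h1, h2⟩ := hNφ φ hφ hB
    obtain ⟨B, hB'⟩ := hB
    refine ⟨h1, h2.trans ?_⟩
    rw [hpd, h.setIntegral_signed hq.measurable hCq hU.measurableSet
      (h.integrable_of_bounded hφ hB').integrableOn]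
  · rw [hpd]
    exact ⟨hdis, fun τ κ hτκ => hτκ.singularPart_eq_zero hU hq.measurable hCq fun S hS hS0 =>
      h.ae_eq_zero_of_volume_eq_zero hn hΩ hU hUc hUΩ (by simp) hg hq hS hS0⟩
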